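/- Let $1\le m<n$, let $D\subset\mathbb{C}^m$ and $\Omega\subset\mathbb{C}^n$ be bounded domains, and let $F=(F_1,\dots,F_n):D\to\Omega$ be a proper holomorphic map. Write ${\sf m}_{2m}$ for Lebesgue measure on $\mathbb{C}^m$, $\beta_m=(i/2)^m\,dz_1\wedge d\bar z_1\wedge\dots\wedge dz_m\wedge d\bar z_m$, and normalize $dd^c$ so that $dd^cu=\frac i2\sum_{j,k}\frac{\partial^2u}{\partial z_j\partial\bar z_k}\,dz_j\wedge d\bar z_k$. Let $\rho:\Omega\to\mathbb{R}$ be continuous and plurisubharmonic, and suppose that, in the sense of currents on $\Omega$, $$dd^c\rho=\frac i2\sum_{\mu,\nu=1}^n b_{\mu\bar\nu}\,dw_\mu\wedge d\bar w_\nu\quad\text{with } b_{\mu\bar\nu}\in L^\infty(\Omega)\text{ for all }\mu,\nu .$$ Then: (a) The classes $b_{\mu\bar\nu}$ have Borel representatives $\tilde b_{\mu\bar\nu}$ that satisfy $|\tilde b_{\mu\bar\nu}|\le\|b_{\mu\bar\nu}\|_{L^\infty(\Omega)}$ everywhere on $\Omega$, and $\tilde b_{\mu\bar\nu}(w)=\lim_{\varepsilon\to0^+}\frac{1}{|P(w,\varepsilon)|}\int_{P(w,\varepsilon)}b_{\mu\bar\nu}$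 at every $w\in\Omega$ at which this limit exists, where $P(w,\varepsilon)$ is the polydisc with centre $w$ and all radii $\varepsilon$ and $|P(w,\varepsilon)|$ is its Lebesgue measure (in particular $\tilde b_{\mu\bar\nu}(w)=b_{\mu\bar\nu}(w)$ wherever $b_{\mu\bar\nu}$ is continuous), such that, in the sense of currents on $D$, $$dd^c(\rho\circ F)=\frac i2\sum_{j,k=1}^m\Big(\sum_{\mu,\nu=1}^n(\tilde b_{\mu\bar\nu}\circ F)\,\frac{\partial F_\mu}{\partial z_j}\,\overline{\frac{\partial F_\nu}{\partial z_k}}\Big)dz_j\wedge d\bar z_k .$$ (b) Suppose that, for some $p\in(m,\infty]$, $\frac{\partial F_\mu}{\partial z_j}\,\overline{\frac{\partial F_\nu}{\partial z_k}}\in L^p(D,{\sf m}_{2m})$ for all $1\le j,k\le m$ and $1\le\mu,\nu\le n$. Then the Bedford–Taylor Monge–Ampère current of $\rho\circ F$ is $(dd^c(\rho\circ F))^m=\tilde f\,\beta_m$ for a function $\tilde f$ that is non-negative almost everywhere and belongs to $L^{p/m}(D,{\sf m}_{2m})$. -/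

import Mathlib

open MeasureTheory Set Filter Topology
open scoped ENNReal

/-! Complex coordinate space `ℂ^m` is `Fin m → ℂ`; its `volume` is the product, i.e. the
`2m`-dimensional, Lebesgue measure. The normalization of `dd^c` is
`dd^c u = (i/2) ∑_{j,k} (∂²u / ∂z_j ∂z̄_k) dz_j ∧ dz̄_k`. -/

namespace SCV

noncomputable section

/-- The Wirtinger derivative `∂f/∂z_j = (∂f/∂x_j - i ∂f/∂y_j)/2`. -/
def dz {m : ℕ} (j : Fin m) (f : (Fin m → ℂ) → ℂ) (z : Fin m → ℂ) : ℂ :=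
  (1 / 2) * (fderiv ℝ f z (Pi.single j 1) - Complex.I * fderiv ℝ f z (Pi.single j Complex.I))

/-- The Wirtinger derivative `∂f/∂z̄_j = (∂f/∂x_j + i ∂f/∂y_j)/2`. -/
def dzbar {m : ℕ} (j : Fin m) (f : (Fin m → ℂ) → ℂ) (z : Fin m → ℂ) : ℂ :=
  (1 / 2) * (fderiv ℝ f z (Pi.single j 1) + Complex.I * fderiv ℝ f z (Pi.single j Complex.I))

/-- The complex partial derivative `∂F_μ/∂z_j` of a holomorphic map `F`. -/
def partialDeriv {m n : ℕ} (F : (Fin m → ℂ) → (Fin n → ℂ)) (μ : Fin n) (j : Fin m)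
    (z : Fin m → ℂ) : ℂ :=
  fderiv ℂ F z (Pi.single j 1) μ

/-- A real-valued function `u` is plurisubharmonic on the open set `U`: it is upper semicontinuous
there, and satisfies the sub-mean value inequality on every closed affine disc
`{z + t v : |t| ≤ 1}` contained in `U` (where circle averages exist, as `u` is never `-∞`). -/
def Plurisubharmonic {m : ℕ} (U : TopologicalSpace.Opens (Fin m → ℂ))
    (u : (Fin m → ℂ) → ℝ) : Prop :=
  UpperSemicontinuousOn u U ∧
    ∀ z v : Fin m → ℂ, (∀ t : ℂ, ‖t‖ ≤ 1 → z + t • v ∈ U) →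
      CircleIntegrable (fun t : ℂ => u (z + t • v)) 0 1 ∧
        u z ≤ Real.circleAverage (fun t : ℂ => u (z + t • v)) 0 1

/-- In the sense of currents on `U`, `dd^c u = (i/2) ∑_{j,k} a_{jk} dz_j ∧ dz̄_k`, with locally
integrable coefficients: for all `j, k`, the distribution `∂²u / ∂z_j ∂z̄_k` is the
function `a_{jk}`. -/
def HasDDc {m : ℕ} (U : TopologicalSpace.Opens (Fin m → ℂ)) (u : (Fin m → ℂ) → ℝ)
    (a : Fin m → Fin m → (Fin m → ℂ) → ℂ) : Prop :=
  ∀ j k, LocallyIntegrableOn (a j k) U ∧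
    ∀ φ : TestFunction U ℂ ⊤,
      ∫ z in U, (u z : ℂ) * dz j (dzbar k φ) z = ∫ z in U, a j k z * φ z

/-- A current `T` on `U` of bidegree `(m-r, m-r)` and of order zero (that is, with measure
coefficients). It is given by the measures `dens e · mass` on `U`, one for each
`e = ((j_1, k_1), …, (j_r, k_r))`, which represent
`T ∧ (i/2)dz_{j_1} ∧ dz̄_{k_1} ∧ … ∧ (i/2)dz_{j_r} ∧ dz̄_{k_r}`. -/
structure Current {m : ℕ} (U : TopologicalSpace.Opens (Fin m → ℂ)) (r : ℕ) where
  /-- A positive measure dominating all coefficients. -/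
  mass : Measure (Fin m → ℂ)
  /-- The densities of the coefficients with respect to `mass`. -/
  dens : (Fin r → Fin m × Fin m) → (Fin m → ℂ) → ℂ
  integrableOn_compact : ∀ e (K : Set (Fin m → ℂ)), IsCompact K → K ⊆ U →
    IntegrableOn (dens e) K mass
  /-- The coefficients are alternating in `(j_1, …, j_r)` and in `(k_1, …, k_r)`. -/
  alternating : ∀ e (σ τ : Equiv.Perm (Fin r)), ∀ᵐ z ∂(mass.restrict U),
    dens (fun i => ((e (σ i)).1, (e (τ i)).2)) z
      = ((σ.sign : ℤ) : ℂ) * ((τ.sign : ℤ) : ℂ) * dens e z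

/-- The value of the current `T` on the form
`φ · (i/2)dz_{j_1} ∧ dz̄_{k_1} ∧ … ∧ (i/2)dz_{j_r} ∧ dz̄_{k_r}`. -/
def Current.pair {m r : ℕ} {U : TopologicalSpace.Opens (Fin m → ℂ)} (T : Current U r)
    (φ : (Fin m → ℂ) → ℂ) (e : Fin r → Fin m × Fin m) : ℂ :=
  ∫ z in U, φ z * T.dens e z ∂T.mass

/-- The constant `c` such that
`(i/2)dz_{j_1} ∧ dz̄_{k_1} ∧ … ∧ (i/2)dz_{j_m} ∧ dz̄_{k_m} = c β_m`, where
`β_m = (i/2)^m dz_1 ∧ dz̄_1 ∧ … ∧ dz_m ∧ dz̄_m` is the Lebesgue volume form. -/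
def topCoeff {m : ℕ} (e : Fin m → Fin m × Fin m) : ℂ :=
  ((1 : Matrix (Fin m) (Fin m) ℂ).submatrix (fun i => (e i).1) id).det *
    ((1 : Matrix (Fin m) (Fin m) ℂ).submatrix (fun i => (e i).2) id).det

theorem topCoeff_perm {m : ℕ} (e : Fin m → Fin m × Fin m) (σ τ : Equiv.Perm (Fin m)) :
    topCoeff (fun i => ((e (σ i)).1, (e (τ i)).2))
      = ((σ.sign : ℤ) : ℂ) * ((τ.sign : ℤ) : ℂ) * topCoeff e := by
  have h1 := Matrix.det_permute σ
    ((1 : Matrix (Fin m) (Fin m) ℂ).submatrix (fun i => (e i).1) id)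
  have h2 := Matrix.det_permute τ
    ((1 : Matrix (Fin m) (Fin m) ℂ).submatrix (fun i => (e i).2) id)
  rw [Matrix.submatrix_submatrix] at h1 h2
  change Matrix.det ((1 : Matrix (Fin m) (Fin m) ℂ).submatrix (fun i => (e (σ i)).1) id) = _ at h1
  change Matrix.det ((1 : Matrix (Fin m) (Fin m) ℂ).submatrix (fun i => (e (τ i)).2) id) = _ at h2
  unfold topCoeff
  rw [h1, h2]
  ring

/-- The constant function `1`, as a current of bidegree `(0, 0)`. -/
def Current.one {m : ℕ} (U : TopologicalSpace.Opens (Fin m → ℂ)) : Current U m where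
  mass := volume
  dens e _ := topCoeff e
  integrableOn_compact _ _ hK _ := integrableOn_const hK.measure_lt_top.ne
  alternating e σ τ := Filter.Eventually.of_forall fun _ => topCoeff_perm e σ τ

/-- `T = dd^c(u S)`: for a continuous function `u` and a current `S` of order zero,
`⟨T, φ γ⟩ = ⟨u S, dd^c φ ∧ γ⟩` for all test functions `φ` and all constant forms `γ`. -/
def IsDDcMul {m r : ℕ} {U : TopologicalSpace.Opens (Fin m → ℂ)} (u : (Fin m → ℂ) → ℝ)
    (S : Current U (r + 1)) (T : Current U r) : Prop :=
  ∀ (φ : TestFunction U ℂ ⊤) (e : Fin r → Fin m × Fin m),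
    T.pair φ e = ∑ j, ∑ k, S.pair (fun z => (u z : ℂ) * dz j (dzbar k φ) z) (Fin.cons (j, k) e)

/-- `IsDDcPower u T`, for `T` of bidegree `(m-r, m-r)`: `T` is the power `(dd^c u)^{m-r}` of
Bedford and Taylor, which is defined inductively for continuous plurisubharmonic `u` by
`(dd^c u)^0 = 1` and `(dd^c u)^{q+1} = dd^c(u (dd^c u)^q)`, each power being a current of order
zero. -/
inductive IsDDcPower {m : ℕ} {U : TopologicalSpace.Opens (Fin m → ℂ)} (u : (Fin m → ℂ) → ℝ) :
    {r : ℕ} → Current U r → Prop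
  | zero : IsDDcPower u (Current.one U)
  | succ {r : ℕ} {S : Current U (r + 1)} {T : Current U r} :
      IsDDcPower u S → IsDDcMul u S T → IsDDcPower u T

/-- The Monge–Ampère equation `(dd^c u)^m = f β_m` on `U`, in the sense of currents, with a
locally integrable density `f`. -/
def MongeAmpereEq {m : ℕ} (U : TopologicalSpace.Opens (Fin m → ℂ)) (u f : (Fin m → ℂ) → ℝ) :
    Prop :=
  LocallyIntegrableOn f U ∧
    ∃ T : Current U 0, IsDDcPower u T ∧
      ∀ φ : TestFunction U ℂ ⊤, T.pair φ Fin.elim0 = ∫ z in U, φ z * (f z : ℂ)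

/-- `b'` is a precise representative on `U` of the essentially bounded function `b`: a Borel
function, equal to `b` almost everywhere, bounded everywhere by the essential supremum of `|b|`,
and equal to the limit of the averages of `b` over shrinking polydiscs wherever it exists. -/
def IsPreciseRepr {n : ℕ} (U : TopologicalSpace.Opens (Fin n → ℂ))
    (b b' : (Fin n → ℂ) → ℂ) : Prop :=
  Measurable b' ∧ b' =ᵐ[volume.restrict U] b ∧
    (∀ w ∈ U, ‖b' w‖ₑ ≤ eLpNorm b ∞ (volume.restrict U)) ∧
    ∀ w ∈ U, ∀ L : ℂ,
      Tendsto (fun ε : ℝ => ⨍ x in Metric.ball w ε, b x) (𝓝[>] 0) (𝓝 L) → b' w = L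

end

end SCV

/-! Convolving `ρ` with smooth kernels `χ_k` gives smooth functions whose Levi coefficients are the
mollifications `b_k` of the coefficients `b`. For these the chain rule is classical: the Levi matrix
of `(ρ * χ_k) ∘ F` is the pull-back of the `b_k`. Since `ρ * χ_k → ρ` locally uniformly, these
pull-backs converge to `dd^c (ρ ∘ F)` as distributions (`tendsto_integral_moll_comp`). The
difficulty is to name the limit: `F(D)` is Lebesgue null because `m < n`, so convergence `b_k → b`
almost everywhere says nothing there.

For (a), the bound `|b_k| ≤ ‖b‖_∞` holds at every point. Hence `b_k` has a weak limit `h` along an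
ultrafilter in `L²` of the push-forward of Lebesgue measure under `F`, and then `b_k ∘ F → h ∘ F`
weakly on `D`. By dominated convergence `h` agrees, almost everywhere for the push-forward, with the
pointwise limit of `b_k` wherever that limit exists, so `h` may be redefined to equal it there
(`exists_weak_limit_comp_of_bound`). The kernels are nearly normalized indicators of polydiscs, so
`b_k` converges wherever the polydisc averages of `b` do; Lebesgue differentiation then gives `h =
b` almost everywhere.

For (b), put `u = ρ ∘ F`. The coefficients `a` of `dd^c u` lie in `L^p`, because the representatives
are bounded everywhere. The powers are built one at a time, the `q`-th having coefficients in
`L^{p/q}` and being closed. The main point is that `dd^c (u S) = dd^c u ∧ S` for such a power `S`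
(`sum_integral_mul_wirt_wirt_eq`): for smooth functions in place of `u` this is integration by parts
against a closed current. In general `u` is mollified, with uniform convergence on one side and weak
`L^m` convergence against the dual exponent on the other. The top power has density `m! det a`.
Averaging the sub-mean value inequality makes the mollified Levi forms semidefinite; this survives
pull-back and the distributional limit, so `a` is semidefinite almost everywhere and the density is
non-negative. -/

namespace SCV

noncomputable section

/-! ### Wirtinger calculus -/

/-- The operator `(∂f/∂x_j + s i ∂f/∂y_j)/2`, which is `∂/∂z_j` for `s = -1` and `∂/∂z̄_j` for
`s = 1`. -/
def wirt {m : ℕ} (s : ℂ) (j : Fin m) (f : (Fin m → ℂ) → ℂ) (z : Fin m → ℂ) : ℂ :=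
  (1 / 2) * (fderiv ℝ f z (Pi.single j 1) + s * Complex.I * fderiv ℝ f z (Pi.single j Complex.I))

theorem dz_eq_wirt {m : ℕ} (j : Fin m) (f : (Fin m → ℂ) → ℂ) : dz j f = wirt (-1) j f := by
  funext z; simp only [dz, wirt]; ring

theorem dzbar_eq_wirt {m : ℕ} (j : Fin m) (f : (Fin m → ℂ) → ℂ) : dzbar j f = wirt 1 j f := by
  funext z; simp only [dzbar, wirt]; ring

section Wirtinger

variable {m : ℕ} {s t : ℂ} {j k : Fin m} {f g : (Fin m → ℂ) → ℂ} {z : Fin m → ℂ}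

theorem wirt_congr (h : f =ᶠ[𝓝 z] g) : wirt s j f z = wirt s j g z := by
  simp only [wirt, h.fderiv_eq]

theorem wirt_mul (hf : DifferentiableAt ℝ f z) (hg : DifferentiableAt ℝ g z) :
    wirt s j (fun x => f x * g x) z = wirt s j f z * g z + f z * wirt s j g z := by
  simp only [wirt]
  rw [fderiv_fun_mul hf hg]
  simp only [_root_.add_apply, _root_.smul_apply, smul_eq_mul]
  ring

theorem wirt_const_mul (c : ℂ) (hf : DifferentiableAt ℝ f z) :
    wirt s j (fun x => c * f x) z = c * wirt s j f z := by
  simp only [wirt]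
  rw [fderiv_const_mul hf]
  simp only [_root_.smul_apply, smul_eq_mul]
  ring

theorem wirt_sum {ι : Type*} (S : Finset ι) {f : ι → (Fin m → ℂ) → ℂ}
    (hf : ∀ i ∈ S, DifferentiableAt ℝ (f i) z) :
    wirt s j (fun x => ∑ i ∈ S, f i x) z = ∑ i ∈ S, wirt s j (f i) z := by
  simp only [wirt]
  rw [fderiv_fun_sum hf]
  simp only [_root_.sum_apply, Finset.mul_sum, ← Finset.sum_add_distrib]

theorem contDiffAt_wirt {n k : WithTop ℕ∞} (hf : ContDiffAt ℝ k f z) (hk : n + 1 ≤ k) :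
    ContDiffAt ℝ n (wirt s j f) z := by
  have h := hf.fderiv_right hk
  unfold wirt
  exact contDiffAt_const.mul ((h.clm_apply contDiffAt_const).add
    (contDiffAt_const.mul (h.clm_apply contDiffAt_const)))

theorem contDiff_wirt {n k : WithTop ℕ∞} (hf : ContDiff ℝ k f) (hk : n + 1 ≤ k) :
    ContDiff ℝ n (wirt s j f) :=
  contDiff_iff_contDiffAt.2 fun _ => contDiffAt_wirt hf.contDiffAt hk

theorem fderiv_wirt (hf : ContDiffAt ℝ 2 f z) (v : Fin m → ℂ) :
    fderiv ℝ (wirt s j f) z v = (1 / 2) * (fderiv ℝ (fderiv ℝ f) z v (Pi.single j 1)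
      + s * Complex.I * fderiv ℝ (fderiv ℝ f) z v (Pi.single j Complex.I)) := by
  have hd : DifferentiableAt ℝ (fderiv ℝ f) z :=
    (hf.fderiv_right (m := 1) (by norm_num)).differentiableAt (by norm_num)
  have h1 : ∀ w : Fin m → ℂ, HasFDerivAt (fun x => fderiv ℝ f x w)
      ((fderiv ℝ (fderiv ℝ f) z).flip w) z := fun w => by
    simpa using hd.hasFDerivAt.clm_apply (hasFDerivAt_const w z)
  have h2 : HasFDerivAt (wirt s j f) _ z :=
    ((h1 (Pi.single j 1)).add ((h1 (Pi.single j Complex.I)).const_mul (s * Complex.I))).const_mul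
      (1 / 2 : ℂ)
  rw [h2.fderiv]
  simp [mul_add]

theorem wirt_comm (hf : ContDiffAt ℝ 2 f z) :
    wirt s j (wirt t k f) z = wirt t k (wirt s j f) z := by
  have hsym := hf.isSymmSndFDerivAt (by simp)
  rw [wirt, wirt, fderiv_wirt hf, fderiv_wirt hf, fderiv_wirt hf, fderiv_wirt hf,
    hsym (Pi.single j 1), hsym (Pi.single j Complex.I), hsym (Pi.single j 1),
    hsym (Pi.single j Complex.I)]
  ring

/-- The mixed terms cancel by symmetry of the second derivative, leaving a quarter of the Laplacian
in the variable `z_j`. -/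
theorem wirt_neg_one_wirt_one (hf : ContDiffAt ℝ 2 f z) :
    wirt (-1) j (wirt 1 j f) z
      = (1 / 4) * (fderiv ℝ (fderiv ℝ f) z (Pi.single j 1) (Pi.single j 1)
        + fderiv ℝ (fderiv ℝ f) z (Pi.single j Complex.I) (Pi.single j Complex.I)) := by
  rw [wirt, fderiv_wirt hf, fderiv_wirt hf,
    hf.isSymmSndFDerivAt (by simp) (Pi.single j Complex.I) (Pi.single j 1)]
  linear_combination (-1 / 4 * fderiv ℝ (fderiv ℝ f) z (Pi.single j Complex.I)
    (Pi.single j Complex.I)) * Complex.I_mul_I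

theorem tsupport_wirt_subset : tsupport (wirt s j f) ⊆ tsupport f := by
  refine closure_minimal (fun x hx => ?_) (isClosed_tsupport f)
  by_contra h
  refine hx ?_
  have : f =ᶠ[𝓝 x] fun _ => (0 : ℂ) := notMem_tsupport_iff_eventuallyEq.1 h
  rw [wirt_congr this]
  simp [wirt]

theorem wirt_one_of_holomorphic (hf : DifferentiableAt ℂ f z) : wirt 1 j f z = 0 := by
  have h : ((Pi.single j Complex.I : Fin m → ℂ)) = Complex.I • Pi.single j 1 := by
    rw [← Pi.single_smul]; simp
  simp only [wirt, hf.fderiv_restrictScalars ℝ, ContinuousLinearMap.coe_restrictScalars', h,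
    map_smul, smul_eq_mul]
  linear_combination (1 / 2 * fderiv ℂ f z (Pi.single j 1)) * Complex.I_mul_I

theorem wirt_conj (hf : DifferentiableAt ℝ f z) :
    wirt s j (fun x => (starRingEnd ℂ) (f x)) z
      = (starRingEnd ℂ) (wirt (-(starRingEnd ℂ) s) j f z) := by
  have h : HasFDerivAt (fun x => (starRingEnd ℂ) (f x))
      ((Complex.conjCLE : ℂ →L[ℝ] ℂ).comp (fderiv ℝ f z)) z :=
    (Complex.conjCLE : ℂ →L[ℝ] ℂ).hasFDerivAt.comp z hf.hasFDerivAt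
  have h2 : (starRingEnd ℂ) 2 = 2 := Complex.conj_ofNat 2
  simp only [wirt, h.fderiv]
  simp [h2]

theorem wirt_conj_of_holomorphic (hf : DifferentiableAt ℂ f z) :
    wirt (-1) j (fun x => (starRingEnd ℂ) (f x)) z = 0 := by
  rw [wirt_conj (hf.restrictScalars ℝ)]
  simp [wirt_one_of_holomorphic hf]

theorem differentiableAt_wirt (hf : ContDiffAt ℝ 2 f z) : DifferentiableAt ℝ (wirt s j f) z :=
  (contDiffAt_wirt (n := 1) hf (by norm_num)).differentiableAt (by norm_num)

end Wirtinger

/-! ### Chain rule for composition with holomorphic maps -/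

section Chain

variable {m n : ℕ} {F : (Fin m → ℂ) → (Fin n → ℂ)} {g : (Fin n → ℂ) → ℂ} {z : Fin m → ℂ}

/-- This splits the real differential into its complex linear and antilinear parts; the chain rules
below come from it. -/
theorem fderiv_real_eq_sum_wirt (w v : Fin n → ℂ) :
    fderiv ℝ g w v = ∑ μ, (wirt (-1) μ g w * v μ + wirt 1 μ g w * (starRingEnd ℂ) (v μ)) := by
  have hv : v = ∑ μ, ((v μ).re • (Pi.single μ 1 : Fin n → ℂ)
      + (v μ).im • (Pi.single μ Complex.I : Fin n → ℂ)) := by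
    ext i
    simp only [Finset.sum_apply, Pi.add_apply, Pi.smul_apply, Finset.sum_add_distrib]
    simp [Pi.single_apply]
  conv_lhs => rw [hv]
  rw [map_sum]
  refine Finset.sum_congr rfl fun μ _ => ?_
  rw [map_add, map_smul, map_smul]
  simp only [wirt, Complex.real_smul]
  have h1 : (starRingEnd ℂ) (v μ) = (v μ).re - (v μ).im * Complex.I := by
    apply Complex.ext <;> simp
  have h2 : v μ = (v μ).re + (v μ).im * Complex.I := (Complex.re_add_im _).symm
  rw [h1]
  conv_rhs => rw [h2]
  simp only [Complex.add_re, Complex.add_im, Complex.ofReal_re, Complex.ofReal_im, Complex.mul_re,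
    Complex.mul_im, Complex.I_re, Complex.I_im, mul_zero, mul_one, sub_zero, add_zero, zero_add]
  linear_combination (fderiv ℝ g w (Pi.single μ Complex.I) * (v μ).im) * Complex.I_mul_I

theorem partialDeriv_smul (j : Fin m) (μ : Fin n) :
    fderiv ℂ F z (Pi.single j Complex.I) μ = Complex.I * partialDeriv F μ j z := by
  have h : ((Pi.single j Complex.I : Fin m → ℂ)) = Complex.I • Pi.single j 1 := by
    rw [← Pi.single_smul]; simp
  rw [h, map_smul, Pi.smul_apply, smul_eq_mul, partialDeriv]

/-- Keeping `s` as a parameter yields both chain rules at once: at `s = ±1` one of the weights `(1 -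
s) / 2` and `(1 + s) / 2` vanishes. -/
theorem wirt_comp (s : ℂ) (hg : DifferentiableAt ℝ g (F z)) (hF : DifferentiableAt ℂ F z)
    (j : Fin m) :
    wirt s j (fun x => g (F x)) z = ∑ μ, ((1 - s) / 2 * (wirt (-1) μ g (F z) * partialDeriv F μ j z)
      + (1 + s) / 2 * (wirt 1 μ g (F z) * (starRingEnd ℂ) (partialDeriv F μ j z))) := by
  have h : HasFDerivAt (fun x => g (F x)) _ z :=
    hg.hasFDerivAt.comp z (hF.restrictScalars ℝ).hasFDerivAt
  rw [wirt, h.fderiv]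
  simp only [ContinuousLinearMap.comp_apply, fderiv_real_eq_sum_wirt (g := g),
    hF.fderiv_restrictScalars ℝ, ContinuousLinearMap.coe_restrictScalars', partialDeriv_smul]
  simp only [Finset.mul_sum, ← Finset.sum_add_distrib]
  refine Finset.sum_congr rfl fun μ _ => ?_
  change 1 / 2 * ((wirt (-1) μ g (F z) * partialDeriv F μ j z
    + wirt 1 μ g (F z) * (starRingEnd ℂ) (partialDeriv F μ j z)) + _) = _
  simp only [map_mul, Complex.conj_I]
  linear_combination (s / 2 * (wirt (-1) μ g (F z) * partialDeriv F μ j z -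
    wirt 1 μ g (F z) * (starRingEnd ℂ) (partialDeriv F μ j z))) * Complex.I_mul_I

theorem wirt_neg_one_comp (hg : DifferentiableAt ℝ g (F z)) (hF : DifferentiableAt ℂ F z)
    (j : Fin m) :
    wirt (-1) j (fun x => g (F x)) z = ∑ μ, wirt (-1) μ g (F z) * partialDeriv F μ j z := by
  rw [wirt_comp _ hg hF]; norm_num

theorem wirt_one_comp (hg : DifferentiableAt ℝ g (F z)) (hF : DifferentiableAt ℂ F z)
    (j : Fin m) :
    wirt 1 j (fun x => g (F x)) z
      = ∑ μ, wirt 1 μ g (F z) * (starRingEnd ℂ) (partialDeriv F μ j z) := by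
  rw [wirt_comp _ hg hF]; norm_num

/-- The Levi matrix of `g ∘ F`, for a holomorphic map `F` whose partial derivatives are
holomorphic. -/
theorem wirt_wirt_comp {D : Set (Fin m → ℂ)} (hD : IsOpen D) (hg : ContDiff ℝ 2 g)
    (hF : DifferentiableOn ℂ F D)
    (hF' : ∀ μ j, DifferentiableOn ℂ (partialDeriv F μ j) D) (hz : z ∈ D) (j k : Fin m) :
    wirt (-1) j (wirt 1 k (fun x => g (F x))) z
      = ∑ μ, ∑ ν, wirt (-1) μ (wirt 1 ν g) (F z)
          * (partialDeriv F μ j z * (starRingEnd ℂ) (partialDeriv F ν k z)) := by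
  have hFz : ∀ x ∈ D, DifferentiableAt ℂ F x := fun x hx => hF.differentiableAt (hD.mem_nhds hx)
  have hFz' : ∀ μ j, DifferentiableAt ℂ (partialDeriv F μ j) z :=
    fun μ j => (hF' μ j).differentiableAt (hD.mem_nhds hz)
  have hgd : ∀ ν, Differentiable ℝ (wirt 1 ν g) := fun ν x => differentiableAt_wirt hg.contDiffAt
  have h1 : wirt 1 k (fun x => g (F x)) =ᶠ[𝓝 z]
      fun x => ∑ ν, wirt 1 ν g (F x) * (starRingEnd ℂ) (partialDeriv F ν k x) := by
    filter_upwards [hD.mem_nhds hz] with x hx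
    exact wirt_one_comp (hg.differentiable (by norm_num) _) (hFz x hx) k
  have hd1 : ∀ ν, DifferentiableAt ℝ (fun x => wirt 1 ν g (F x)) z := fun ν =>
    (hgd ν (F z)).comp z ((hFz z hz).restrictScalars ℝ)
  have hd2 : ∀ ν, DifferentiableAt ℝ (fun x => (starRingEnd ℂ) (partialDeriv F ν k x)) z :=
    fun ν => (Complex.conjCLE : ℂ →L[ℝ] ℂ).differentiableAt.comp z
      ((hFz' ν k).restrictScalars ℝ)
  rw [wirt_congr h1, wirt_sum _ fun ν _ => (hd1 ν).fun_mul (hd2 ν), Finset.sum_comm]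
  refine Finset.sum_congr rfl fun ν _ => ?_
  -- The conjugated derivative of `F` is antiholomorphic, so `∂/∂z_j` only acts on the other factor
  -- and no second derivative of `F` survives.
  rw [wirt_mul (hd1 ν) (hd2 ν), wirt_conj_of_holomorphic (hFz' ν k), mul_zero, add_zero,
    wirt_neg_one_comp (hgd ν _) (hFz z hz), Finset.sum_mul]
  exact Finset.sum_congr rfl fun μ _ => by ring

end Chain

/-! ### Integration by parts against test functions -/

section IntegrationByParts

variable {m : ℕ} {D : TopologicalSpace.Opens (Fin m → ℂ)} {s t : ℂ} {j k : Fin m}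

/-- Functions controlled only on `U` can be treated as global after multiplication by `ψ`: at a
point outside `U` the product vanishes in a neighbourhood. -/
theorem continuous_mul_of_tsupport_subset {X : Type*} [TopologicalSpace X] {U : Set X}
    (hU : IsOpen U) {h ψ : X → ℂ} (hh : ContinuousOn h U) (hψ : Continuous ψ)
    (hs : tsupport ψ ⊆ U) : Continuous fun x => h x * ψ x := by
  refine continuous_iff_continuousAt.2 fun x => ?_
  by_cases hx : x ∈ U
  · exact (hh.continuousAt (hU.mem_nhds hx)).mul hψ.continuousAt
  · have h0 : ψ =ᶠ[𝓝 x] fun _ => 0 :=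
      notMem_tsupport_iff_eventuallyEq.1 fun h => hx (hs h)
    have : (fun x => h x * ψ x) =ᶠ[𝓝 x] fun _ => 0 := h0.mono fun y hy => by simp [hy]
    exact continuousAt_const.congr this.symm

theorem integrable_mul_of_tsupport_subset {h ψ : (Fin m → ℂ) → ℂ} (hh : ContinuousOn h D)
    (hψ : Continuous ψ) (hc : HasCompactSupport ψ) (hs : tsupport ψ ⊆ D) :
    Integrable fun x => h x * ψ x :=
  (continuous_mul_of_tsupport_subset D.isOpen hh hψ hs).integrable_of_hasCompactSupport
    (hc.mul_left)

theorem setIntegral_mul_eq_integral {h ψ : (Fin m → ℂ) → ℂ} (hs : tsupport ψ ⊆ D) :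
    ∫ x in D, h x * ψ x = ∫ x, h x * ψ x :=
  setIntegral_eq_integral_of_forall_compl_eq_zero fun x hx => by
    rw [image_eq_zero_of_notMem_tsupport fun h => hx (hs h), mul_zero]

theorem integral_mul_wirt {g φ : (Fin m → ℂ) → ℂ} (hg : ContDiffOn ℝ 1 g D)
    (hφ : ContDiff ℝ 1 φ) (hc : HasCompactSupport φ) (hs : tsupport φ ⊆ D) :
    ∫ z in D, g z * wirt s j φ z = - ∫ z in D, wirt s j g z * φ z := by
  have hgd : ∀ x ∈ (D : Set (Fin m → ℂ)), ContDiffAt ℝ 1 g x :=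
    fun x hx => hg.contDiffAt (D.isOpen.mem_nhds hx)
  have hfd : ∀ v, ContinuousOn (fun x => fderiv ℝ g x v) D := fun v x hx =>
    (((hgd x hx).fderiv_right (m := 0) (by norm_num)).continuousAt.clm_apply
      continuousAt_const).continuousWithinAt
  have hφd : ∀ v, Continuous fun x => fderiv ℝ φ x v := fun v =>
    (hφ.continuous_fderiv (by norm_num)).clm_apply continuous_const
  have hsd : ∀ v, tsupport (fun x => fderiv ℝ φ x v) ⊆ D := fun v =>
    (tsupport_fderiv_apply_subset ℝ v).trans hs
  have hcd : ∀ v, HasCompactSupport (fun x => fderiv ℝ φ x v) := fun v => hc.fderiv_apply ℝ v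
  have i1 := fun v => integrable_mul_of_tsupport_subset hg.continuousOn (hφd v) (hcd v) (hsd v)
  have i2 := fun v => integrable_mul_of_tsupport_subset (hfd v) hφ.continuous hc hs
  have key : ∀ v, ∫ x, g x * fderiv ℝ φ x v = - ∫ x, fderiv ℝ g x v * φ x := fun v =>
    integral_mul_fderiv_eq_neg_fderiv_mul_of_integrable (i2 v) (i1 v)
      (integrable_mul_of_tsupport_subset hg.continuousOn hφ.continuous hc hs)
      (fun x hx => (hgd x (hs hx)).differentiableAt (by norm_num))
      (fun x _ => hφ.differentiable (by norm_num) x)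
  rw [setIntegral_mul_eq_integral (tsupport_wirt_subset.trans hs), setIntegral_mul_eq_integral hs]
  have e1 : ∀ x, g x * wirt s j φ x = (1 / 2) * (g x * fderiv ℝ φ x (Pi.single j 1))
      + s * Complex.I / 2 * (g x * fderiv ℝ φ x (Pi.single j Complex.I)) := fun x => by
    simp only [wirt]; ring
  have e2 : ∀ x, wirt s j g x * φ x = (1 / 2) * (fderiv ℝ g x (Pi.single j 1) * φ x)
      + s * Complex.I / 2 * (fderiv ℝ g x (Pi.single j Complex.I) * φ x) := fun x => by
    simp only [wirt]; ring
  simp only [e1, e2]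
  rw [integral_add ((i1 _).const_mul _) ((i1 _).const_mul _),
    integral_add ((i2 _).const_mul _) ((i2 _).const_mul _)]
  simp only [integral_const_mul]
  rw [key, key]
  ring

/-- The Wirtinger derivative of a test function. -/
def testWirt (s : ℂ) (j : Fin m) (φ : TestFunction D ℂ ⊤) : TestFunction D ℂ ⊤ where
  toFun := wirt s j φ
  contDiff' := contDiff_wirt φ.contDiff (by rfl)
  hasCompactSupport' := φ.hasCompactSupport.mono' (subset_closure.trans tsupport_wirt_subset)
  tsupport_subset' := tsupport_wirt_subset.trans φ.tsupport_subset

theorem coe_testWirt (s : ℂ) (j : Fin m) (φ : TestFunction D ℂ ⊤) :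
    ⇑(testWirt s j φ) = wirt s j φ := rfl

theorem integral_mul_wirt_wirt {g φ : (Fin m → ℂ) → ℂ} (hg : ContDiffOn ℝ 2 g D)
    (hφ : ContDiff ℝ 2 φ) (hc : HasCompactSupport φ) (hs : tsupport φ ⊆ D) :
    ∫ z in D, g z * wirt s j (wirt t k φ) z = ∫ z in D, wirt s j (wirt t k g) z * φ z := by
  have hg' : ContDiffOn ℝ 1 (wirt t k g) D := fun x hx =>
    (contDiffAt_wirt (hg.contDiffAt (D.isOpen.mem_nhds hx)) (by norm_num)).contDiffWithinAt
  have e : wirt s j (wirt t k φ) = wirt t k (wirt s j φ) :=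
    funext fun x => wirt_comm hφ.contDiffAt
  rw [e, integral_mul_wirt (hg.of_le (by norm_num)) (contDiff_wirt hφ (by norm_num))
    (hc.mono' (subset_closure.trans tsupport_wirt_subset)) (tsupport_wirt_subset.trans hs),
    integral_mul_wirt hg' (hφ.of_le (by norm_num)) hc hs, neg_neg]

end IntegrationByParts

/-! ### Smoothness of holomorphic functions of several variables -/

theorem hasDerivAt_comp_line {m : ℕ} {G : Type*} [NormedAddCommGroup G] [NormedSpace ℂ G]
    {f : (Fin m → ℂ) → G} {z v : Fin m → ℂ} {t : ℂ}
    (hf : DifferentiableAt ℂ f (z + t • v)) :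
    HasDerivAt (fun t : ℂ => f (z + t • v)) (fderiv ℂ f (z + t • v) v) t := by
  have h1 : HasDerivAt (fun t : ℂ => z + t • v) v t := by
    simpa using ((hasDerivAt_id t).smul_const v).const_add z
  exact hf.hasFDerivAt.comp_hasDerivAt t h1

section Holomorphic

variable {m : ℕ} {G : Type} [NormedAddCommGroup G] [NormedSpace ℂ G] [FiniteDimensional ℂ G]
  {f : (Fin m → ℂ) → G} {U : Set (Fin m → ℂ)}

/-- Cauchy's estimate for the derivative of a holomorphic function of several variables. -/
theorem norm_fderiv_le_of_forall_closedBall {x : Fin m → ℂ} {R C : ℝ} (hR : 0 < R)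
    (hf : ∀ y ∈ Metric.closedBall x R, DifferentiableAt ℂ f y)
    (hC : ∀ y ∈ Metric.closedBall x R, ‖f y‖ ≤ C) : ‖fderiv ℂ f x‖ ≤ C / R := by
  have hC0 : 0 ≤ C := (norm_nonneg _).trans (hC x (Metric.mem_closedBall_self hR.le))
  have : CompleteSpace G := FiniteDimensional.complete ℂ G
  refine ContinuousLinearMap.opNorm_le_bound _ (by positivity) fun w => ?_
  rcases eq_or_ne w 0 with rfl | hw
  · simp
  have hw' : 0 < ‖w‖ := norm_pos_iff.2 hw
  -- With radius `R / ‖w‖` the disc in direction `w` stays in the ball, and the one-variable Cauchy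
  -- estimate on it gives `C ‖w‖ / R`.
  have hmem : ∀ t ∈ Metric.closedBall (0 : ℂ) (R / ‖w‖), x + t • w ∈ Metric.closedBall x R := by
    intro t ht
    rw [mem_closedBall_zero_iff] at ht
    rw [mem_closedBall_iff_norm, add_sub_cancel_left, norm_smul]
    exact (le_div_iff₀ hw').1 ht
  have hd : DiffContOnCl ℂ (fun t : ℂ => f (x + t • w)) (Metric.ball 0 (R / ‖w‖)) := by
    refine DifferentiableOn.diffContOnCl fun t ht => ?_
    exact (hasDerivAt_comp_line (hf _ (hmem t
      (Metric.closure_ball_subset_closedBall ht)))).differentiableAt.differentiableWithinAt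
  have h := Complex.norm_deriv_le_of_forall_mem_sphere_norm_le (div_pos hR hw') hd
    fun t ht => hC _ (hmem t (Metric.sphere_subset_closedBall ht))
  have hx := hasDerivAt_comp_line (f := f) (z := x) (v := w) (t := 0)
    (by simpa using hf x (Metric.mem_closedBall_self hR.le))
  rw [hx.deriv] at h
  simp only [zero_smul, add_zero] at h
  calc ‖fderiv ℂ f x w‖ ≤ C / (R / ‖w‖) := h
    _ = C / R * ‖w‖ := by field_simp

/-- On the complex line through `z` in direction `v`, Cauchy's formula writes the directional
derivative as a circle integral of `f (z + t v) / t²`. The integral can be differentiated in `z`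
under the integral sign, since Cauchy's estimate bounds `fderiv ℂ f` uniformly. -/
theorem differentiableOn_fderiv_apply (hU : IsOpen U) (hf : DifferentiableOn ℂ f U)
    (v : Fin m → ℂ) : DifferentiableOn ℂ (fun z => fderiv ℂ f z v) U := by
  have : CompleteSpace G := FiniteDimensional.complete ℂ G
  intro z₀ hz₀
  obtain ⟨R, hR, hRU⟩ := Metric.nhds_basis_closedBall.mem_iff.1 (hU.mem_nhds hz₀)
  have hfd : ∀ y ∈ Metric.closedBall z₀ R, DifferentiableAt ℂ f y :=
    fun y hy => hf.differentiableAt (hU.mem_nhds (hRU hy))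
  obtain ⟨M, hM⟩ := (isCompact_closedBall z₀ R).exists_bound_of_continuousOn
    (hf.continuousOn.mono hRU)
  -- The radius `R` is spent in thirds: one for moving `z`, one for the circle `t v`, and one for
  -- Cauchy's estimate at the resulting point. The summand `1` covers `v = 0`.
  set r : ℝ := R / 3 / (‖v‖ + 1) with hr
  have hv : 0 < ‖v‖ + 1 := by positivity
  have hr0 : 0 < r := by positivity
  have hmem : ∀ z ∈ Metric.ball z₀ (R / 3), ∀ t ∈ Metric.closedBall (0 : ℂ) r,
      z + t • v ∈ Metric.closedBall z₀ (2 * R / 3) := by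
    intro z hz t ht
    rw [mem_closedBall_zero_iff] at ht
    rw [mem_ball_iff_norm] at hz
    rw [mem_closedBall_iff_norm]
    have h1 : ‖t • v‖ ≤ R / 3 := by
      rw [norm_smul]
      calc ‖t‖ * ‖v‖ ≤ r * (‖v‖ + 1) := by gcongr; linarith
        _ = R / 3 := by rw [hr]; field_simp
    calc ‖z + t • v - z₀‖ = ‖(z - z₀) + t • v‖ := by congr 1; abel
      _ ≤ ‖z - z₀‖ + ‖t • v‖ := norm_add_le _ _
      _ ≤ 2 * R / 3 := by linarith
  have hsub : Metric.closedBall z₀ (2 * R / 3) ⊆ Metric.closedBall z₀ R :=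
    Metric.closedBall_subset_closedBall (by linarith)
  have hbd : ∀ y ∈ Metric.closedBall z₀ (2 * R / 3), ‖fderiv ℂ f y‖ ≤ M / (R / 3) := by
    intro y hy
    have hs : Metric.closedBall y (R / 3) ⊆ Metric.closedBall z₀ R :=
      Metric.closedBall_subset_closedBall' (by
        rw [Metric.mem_closedBall] at hy; linarith)
    exact norm_fderiv_le_of_forall_closedBall (by positivity) (fun w hw => hfd w (hs hw))
      fun w hw => hM w (hs hw)
  have hcm : ∀ θ : ℝ, circleMap 0 r θ ∈ Metric.closedBall (0 : ℂ) r :=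
    fun θ => circleMap_mem_closedBall 0 hr0.le θ
  have hcauchy : ∀ z ∈ Metric.ball z₀ (R / 3), fderiv ℂ f z v
      = (2 * Real.pi * Complex.I : ℂ)⁻¹ • ∫ θ in (0 : ℝ)..2 * Real.pi,
        (deriv (circleMap 0 r) θ * (circleMap 0 r θ) ^ (-2 : ℤ)) •
          f (z + circleMap 0 r θ • v) := by
    intro z hz
    have hd : DiffContOnCl ℂ (fun t : ℂ => f (z + t • v)) (Metric.ball 0 r) := by
      refine DifferentiableOn.diffContOnCl fun t ht => ?_
      exact (hasDerivAt_comp_line (hfd _ (hsub (hmem z hz t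
        (Metric.closure_ball_subset_closedBall ht))))).differentiableAt.differentiableWithinAt
    have h := DiffContOnCl.deriv_eq_smul_circleIntegral hr0 hd
    have hx := hasDerivAt_comp_line (f := f) (z := z) (v := v) (t := 0)
      (hfd _ (hsub (hmem z hz 0 (Metric.mem_closedBall_self hr0.le))))
    rw [hx.deriv] at h
    simp only [zero_smul, add_zero] at h
    rw [← inv_smul_smul₀ Complex.two_pi_I_ne_zero (fderiv ℂ f z v), ← h, circleIntegral]
    simp only [sub_zero, smul_smul, one_div, zpow_neg, zpow_ofNat]
  have hcont : ∀ z ∈ Metric.ball z₀ (R / 3), Continuous fun θ : ℝ =>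
      (deriv (circleMap 0 r) θ * (circleMap 0 r θ) ^ (-2 : ℤ)) • f (z + circleMap 0 r θ • v) := by
    intro z hz
    have h1 : Continuous fun θ : ℝ => f (z + circleMap 0 r θ • v) := by
      refine (hf.continuousOn.mono hRU).comp_continuous
        (continuous_const.add ((continuous_circleMap 0 r).smul continuous_const)) fun θ => ?_
      exact hsub (hmem z hz _ (hcm θ))
    have h2 : Continuous fun θ : ℝ => deriv (circleMap 0 r) θ := by
      simp only [deriv_circleMap]
      exact (continuous_circleMap 0 r).mul continuous_const
    exact (h2.mul ((continuous_circleMap 0 r).zpow₀ _ fun θ =>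
      Or.inl (circleMap_ne_center hr0.ne'))).smul h1
  have hz₀b : z₀ ∈ Metric.ball z₀ (R / 3) := Metric.mem_ball_self (by positivity)
  have hnorm : ∀ θ : ℝ, ‖deriv (circleMap 0 r) θ * (circleMap 0 r θ) ^ (-2 : ℤ)‖ = r⁻¹ := by
    intro θ
    rw [norm_mul, norm_zpow, deriv_circleMap, norm_mul, norm_circleMap_zero, Complex.norm_I,
      abs_of_pos hr0, mul_one, zpow_neg, zpow_ofNat]
    field_simp
  have hder := intervalIntegral.hasFDerivAt_integral_of_dominated_of_fderiv_le (𝕜 := ℂ)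
    (μ := volume) (a := 0) (b := 2 * Real.pi) (s := Metric.ball z₀ (R / 3)) (x₀ := z₀)
    (bound := fun _ => r⁻¹ * (M / (R / 3)))
    (F := fun z θ => (deriv (circleMap 0 r) θ * (circleMap 0 r θ) ^ (-2 : ℤ)) •
      f (z + circleMap 0 r θ • v))
    (F' := fun z θ => (deriv (circleMap 0 r) θ * (circleMap 0 r θ) ^ (-2 : ℤ)) •
      fderiv ℂ f (z + circleMap 0 r θ • v))
    (Metric.ball_mem_nhds z₀ (by positivity))
    (by
      filter_upwards [Metric.ball_mem_nhds z₀ (by positivity : 0 < R / 3)] with z hz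
      exact (hcont z hz).aestronglyMeasurable)
    ((hcont z₀ hz₀b).intervalIntegrable _ _)
    (by
      have h2 : Continuous fun θ : ℝ => deriv (circleMap 0 r) θ := by
        simp only [deriv_circleMap]
        exact (continuous_circleMap 0 r).mul continuous_const
      have h3 := (h2.mul ((continuous_circleMap 0 r).zpow₀ (-2) fun θ =>
        Or.inl (circleMap_ne_center hr0.ne')))
      have : ProperSpace ((Fin m → ℂ) →L[ℂ] G) := FiniteDimensional.proper ℂ _
      borelize G
      refine AEStronglyMeasurable.smul h3.aestronglyMeasurable ?_
      -- Continuity of the derivative is not available yet, but its measurability needs no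
      -- regularity of `f`.
      refine ((measurable_fderiv ℂ f).comp ?_).aestronglyMeasurable
      exact (continuous_const.add
        ((continuous_circleMap 0 r).smul continuous_const)).measurable)
    (by
      refine Eventually.of_forall fun θ _ z hz => ?_
      rw [norm_smul, hnorm]
      gcongr
      exact hbd _ (hmem z hz _ (hcm θ)))
    intervalIntegrable_const
    (by
      refine Eventually.of_forall fun θ _ z hz => ?_
      have h1 : HasFDerivAt (fun z : Fin m → ℂ => z + circleMap 0 r θ • v)
          (ContinuousLinearMap.id ℂ _) z := (hasFDerivAt_id z).add_const _
      have h2 := (hfd _ (hsub (hmem z hz _ (hcm θ)))).hasFDerivAt.comp z h1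
      exact h2.const_smul _)
  refine DifferentiableAt.differentiableWithinAt ?_
  refine (hder.differentiableAt.fun_const_smul
    (2 * Real.pi * Complex.I : ℂ)⁻¹).congr_of_eventuallyEq ?_
  filter_upwards [Metric.ball_mem_nhds z₀ (by positivity : 0 < R / 3)] with z hz
  exact hcauchy z hz

theorem contDiffOn_of_differentiableOn_complex (hU : IsOpen U) (hf : DifferentiableOn ℂ f U)
    (k : ℕ) : ContDiffOn ℂ k f U := by
  induction k generalizing G with
  | zero => exact contDiffOn_zero.2 hf.continuousOn
  | succ k ih =>
    rw [Nat.cast_succ, contDiffOn_succ_iff_fderiv_of_isOpen hU]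
    refine ⟨hf, by simp, ?_⟩
    rw [contDiffOn_clm_apply]
    exact fun v => ih (differentiableOn_fderiv_apply hU hf v)

end Holomorphic

section HolomorphicMap

variable {m n : ℕ} {F : (Fin m → ℂ) → (Fin n → ℂ)} {D : Set (Fin m → ℂ)}

theorem differentiableOn_partialDeriv (hD : IsOpen D) (hF : DifferentiableOn ℂ F D)
    (μ : Fin n) (j : Fin m) : DifferentiableOn ℂ (partialDeriv F μ j) D :=
  differentiableOn_pi.1 (differentiableOn_fderiv_apply hD hF (Pi.single j 1)) μ

theorem contDiffOn_real_of_holomorphic (hD : IsOpen D) (hF : DifferentiableOn ℂ F D) (k : ℕ) :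
    ContDiffOn ℝ k F D :=
  (contDiffOn_of_differentiableOn_complex hD hF k).restrict_scalars ℝ

end HolomorphicMap

/-! ### Convolution and mollification -/

open scoped Convolution

/-- The convolution `ψ * u` of complex functions. -/
def cv {n : ℕ} (ψ u : (Fin n → ℂ) → ℂ) : (Fin n → ℂ) → ℂ :=
  ψ ⋆[ContinuousLinearMap.mul ℝ ℂ, volume] u

section Convolution

variable {n : ℕ} {ψ u : (Fin n → ℂ) → ℂ}

theorem cv_apply (w : Fin n → ℂ) : cv ψ u w = ∫ y, ψ (w - y) * u y := by
  rw [cv, convolution_eq_swap]; rfl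

theorem cv_apply' (w : Fin n → ℂ) : cv ψ u w = ∫ y, ψ y * u (w - y) := rfl

theorem contDiff_cv {k : ℕ∞} (hc : HasCompactSupport ψ) (hψ : ContDiff ℝ k ψ)
    (hu : LocallyIntegrable u) : ContDiff ℝ k (cv ψ u) :=
  hc.contDiff_convolution_left _ hψ hu

theorem wirt_cv (s : ℂ) (j : Fin n) (hc : HasCompactSupport ψ) (hψ : ContDiff ℝ 1 ψ)
    (hu : LocallyIntegrable u) : wirt s j (cv ψ u) = cv (wirt s j ψ) u := by
  funext w
  have h := hc.hasFDerivAt_convolution_left (ContinuousLinearMap.mul ℝ ℂ) hψ hu w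
  have hi : Integrable fun t => (ContinuousLinearMap.precompL (Fin n → ℂ)
      (ContinuousLinearMap.mul ℝ ℂ)) (fderiv ℝ ψ t) (u (w - t)) :=
    ((hc.fderiv ℝ).convolutionExists_left _ (hψ.continuous_fderiv (by norm_num)) hu) w
  have key : ∀ v : Fin n → ℂ, fderiv ℝ (cv ψ u) w v = ∫ t, fderiv ℝ ψ t v * u (w - t) := by
    intro v
    rw [cv, h.fderiv, convolution_def, ContinuousLinearMap.integral_apply hi]
    rfl
  have hi' : ∀ v : Fin n → ℂ, Integrable fun t => fderiv ℝ ψ t v * u (w - t) := fun v =>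
    ((hc.fderiv_apply ℝ v).convolutionExists_left (ContinuousLinearMap.mul ℝ ℂ)
      ((hψ.continuous_fderiv (by norm_num)).clm_apply continuous_const) hu) w
  rw [wirt, key, key, cv_apply', ← integral_const_mul,
    ← integral_add (hi' _) ((hi' _).const_mul _), ← integral_const_mul]
  refine integral_congr_ae (Eventually.of_forall fun t => ?_)
  simp only [wirt]
  ring

theorem hasCompactSupport_wirt (s : ℂ) (j : Fin n) (hc : HasCompactSupport ψ) :
    HasCompactSupport (wirt s j ψ) :=
  hc.mono' (subset_closure.trans tsupport_wirt_subset)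

theorem wirt_wirt_cv (s t : ℂ) (j k : Fin n) (hc : HasCompactSupport ψ) (hψ : ContDiff ℝ 2 ψ)
    (hu : LocallyIntegrable u) :
    wirt s j (wirt t k (cv ψ u)) = cv (wirt s j (wirt t k ψ)) u := by
  rw [wirt_cv t k hc (hψ.of_le (by norm_num)) hu, wirt_cv s j (hasCompactSupport_wirt t k hc)
    (contDiff_wirt hψ (by norm_num)) hu]

theorem wirt_comp_sub (s : ℂ) (j : Fin n) (w y : Fin n → ℂ)
    (hψ : DifferentiableAt ℝ ψ (w - y)) :
    wirt s j (fun x => ψ (w - x)) y = - wirt s j ψ (w - y) := by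
  have h : HasFDerivAt (fun x => ψ (w - x))
      ((fderiv ℝ ψ (w - y)).comp (-ContinuousLinearMap.id ℝ (Fin n → ℂ))) y :=
    HasFDerivAt.comp (f := fun x => w - x) y hψ.hasFDerivAt ((hasFDerivAt_id y).const_sub w)
  simp only [wirt, h.fderiv, ContinuousLinearMap.comp_apply, _root_.neg_apply,
    ContinuousLinearMap.id_apply, map_neg]
  ring

theorem wirt_wirt_comp_sub (s t : ℂ) (j k : Fin n) (w y : Fin n → ℂ) (hψ : ContDiff ℝ 2 ψ) :
    wirt s j (wirt t k fun x => ψ (w - x)) y = wirt s j (wirt t k ψ) (w - y) := by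
  have h : (wirt t k fun x => ψ (w - x)) = fun y => (fun x => -1 * wirt t k ψ x) (w - y) :=
    funext fun y => by
      rw [wirt_comp_sub t k w y (hψ.differentiable (by norm_num) _)]; ring
  have hd : Differentiable ℝ (wirt t k ψ) := fun x => differentiableAt_wirt hψ.contDiffAt
  rw [h, wirt_comp_sub (ψ := fun x => -1 * wirt t k ψ x) _ _ _ _ ((hd _).const_mul _),
    wirt_const_mul _ (hd _)]
  ring

end Convolution

/-- A sequence of bump functions at `0` that are close to indicator functions of polydiscs. -/
def bump (n k : ℕ) : ContDiffBump (0 : Fin n → ℂ) where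
  rIn := 1 / (k + 1)
  -- The ratio `rOut / rIn` tends to `1`, which the comparison with polydisc averages needs, and it
  -- is at most `2`, which the differentiation theorem in `ae_tendsto_moll` needs. The norm is the
  -- sup norm, so balls are polydiscs.
  rOut := 1 / (k + 1) * (1 + 1 / (k + 1))
  rIn_pos := by positivity
  rIn_lt_rOut := by
    have : (0 : ℝ) < 1 / (k + 1) := by positivity
    nlinarith

/-- The normalized bump functions, as complex functions. -/
def kern (n k : ℕ) (x : Fin n → ℂ) : ℂ := ((bump n k).normed volume x : ℝ)

/-- The mollifications of `u`. -/
def moll {n : ℕ} (k : ℕ) (u : (Fin n → ℂ) → ℂ) : (Fin n → ℂ) → ℂ := cv (kern n k) u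

section Mollification

variable {n : ℕ} {k : ℕ} {u : (Fin n → ℂ) → ℂ}

theorem contDiff_kern (N : ℕ∞) : ContDiff ℝ N (kern n k) :=
  Complex.ofRealCLM.contDiff.comp (bump n k).contDiff_normed

theorem tsupport_kern : tsupport (kern n k) = Metric.closedBall 0 (bump n k).rOut := by
  rw [← (bump n k).tsupport_normed_eq (μ := volume), tsupport, tsupport]
  congr 1
  ext x
  simp [kern]

theorem hasCompactSupport_kern : HasCompactSupport (kern n k) := by
  rw [HasCompactSupport, tsupport_kern]
  exact isCompact_closedBall _ _

theorem continuous_kern : Continuous (kern n k) := (contDiff_kern 0).continuous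

theorem tendsto_bump_rOut : Tendsto (fun k => (bump n k).rOut) atTop (𝓝 0) := by
  have h := tendsto_one_div_add_atTop_nhds_zero_nat (𝕜 := ℝ)
  have h2 := h.mul (h.const_add 1)
  simpa [bump] using h2

theorem norm_kern (x : Fin n → ℂ) : ‖kern n k x‖ = (bump n k).normed volume x := by
  rw [kern, Complex.norm_real, Real.norm_of_nonneg ((bump n k).nonneg_normed x)]

theorem integrable_kern : Integrable (kern n k) := (bump n k).integrable_normed.ofReal

theorem integral_norm_kern : ∫ x, ‖kern n k x‖ = 1 := by
  simp only [norm_kern]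
  exact (bump n k).integral_normed

theorem moll_eq_convolution :
    moll k u = (bump n k).normed volume ⋆[ContinuousLinearMap.lsmul ℝ ℝ, volume] u := by
  funext w
  rw [moll, cv_apply', convolution_def]
  refine integral_congr_ae (Eventually.of_forall fun y => ?_)
  simp [kern]

theorem contDiff_moll (N : ℕ∞) (hu : LocallyIntegrable u) : ContDiff ℝ N (moll k u) :=
  contDiff_cv hasCompactSupport_kern (contDiff_kern N) hu

theorem ae_tendsto_moll (hu : LocallyIntegrable u) :
    ∀ᵐ w, Tendsto (fun k => moll k u w) atTop (𝓝 (u w)) := by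
  simp only [moll_eq_convolution]
  refine ContDiffBump.ae_convolution_tendsto_right_of_locallyIntegrable (K := 2)
    tendsto_bump_rOut (Eventually.of_forall fun k => ?_) hu
  have h1 : (1 : ℝ) / (k + 1) ≤ 1 := by
    rw [div_le_one (by positivity)]
    have : (0 : ℝ) ≤ k := by positivity
    linarith
  have h0 : (0 : ℝ) < 1 / (k + 1) := by positivity
  simp only [bump]
  nlinarith

/-- The kernel has `L¹` norm one, so a bound almost everywhere becomes a bound at every point,
including those of the null set `F(D)`. -/
theorem norm_moll_le {C : ℝ} (hu : ∀ᵐ y, ‖u y‖ ≤ C) (w : Fin n → ℂ) :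
    ‖moll k u w‖ ≤ C := by
  rw [moll, cv_apply]
  have hi : Integrable fun y => ‖kern n k (w - y)‖ * C :=
    (integrable_kern.norm.comp_sub_left w).mul_const C
  calc ‖∫ y, kern n k (w - y) * u y‖ ≤ ∫ y, ‖kern n k (w - y)‖ * C := by
        refine norm_integral_le_of_norm_le hi ?_
        filter_upwards [hu] with y hy
        rw [norm_mul]
        gcongr
    _ = C := by
        rw [integral_mul_const, integral_sub_left_eq_self (fun x => ‖kern n k x‖) volume w,
          integral_norm_kern, one_mul]

/-- The test function `y ↦ χ_k(w - y)`. -/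
def testKern {U : TopologicalSpace.Opens (Fin n → ℂ)} (k : ℕ) (w : Fin n → ℂ)
    (h : Metric.closedBall w (bump n k).rOut ⊆ U) : TestFunction U ℂ ⊤ where
  toFun y := kern n k (w - y)
  contDiff' := (contDiff_kern ⊤).comp (contDiff_const.sub contDiff_id)
  hasCompactSupport' := hasCompactSupport_kern.comp_homeomorph (Homeomorph.subLeft w)
  tsupport_subset' := by
    refine (closure_minimal (fun y hy => ?_) Metric.isClosed_closedBall).trans h
    have : w - y ∈ tsupport (kern n k) := subset_closure hy
    rw [tsupport_kern, mem_closedBall_zero_iff] at this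
    rwa [Metric.mem_closedBall, dist_comm, dist_eq_norm]

theorem coe_testKern {U : TopologicalSpace.Opens (Fin n → ℂ)} (w : Fin n → ℂ)
    (h : Metric.closedBall w (bump n k).rOut ⊆ U) :
    ⇑(testKern k w h) = fun y => kern n k (w - y) := rfl

/-- Mollification commutes with `dd^c`. -/
theorem wirt_wirt_moll {U : TopologicalSpace.Opens (Fin n → ℂ)} {u : (Fin n → ℂ) → ℝ}
    {a : Fin n → Fin n → (Fin n → ℂ) → ℂ} (h : HasDDc U u a) {S : Set (Fin n → ℂ)}
    (hSU : S ⊆ U)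
    (hu : LocallyIntegrable (S.indicator fun y => (u y : ℂ))) {w : Fin n → ℂ}
    (hw : Metric.closedBall w (bump n k).rOut ⊆ S) (i j : Fin n) :
    wirt (-1) i (wirt 1 j (moll k (S.indicator fun y => (u y : ℂ)))) w
      = moll k ((U : Set (Fin n → ℂ)).indicator (a i j)) w := by
  have hd := (h i j).2 (testKern k w (hw.trans hSU))
  rw [dz_eq_wirt, dzbar_eq_wirt, coe_testKern] at hd
  rw [moll, wirt_wirt_cv _ _ _ _ hasCompactSupport_kern (contDiff_kern 2) hu, moll, cv_apply,
    cv_apply]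
  have e1 : ∫ y, kern n k (w - y) * (U : Set (Fin n → ℂ)).indicator (a i j) y
      = ∫ y in U, a i j y * kern n k (w - y) := by
    rw [← integral_indicator U.isOpen.measurableSet]
    refine integral_congr_ae (Eventually.of_forall fun y => ?_)
    by_cases hy : y ∈ (U : Set (Fin n → ℂ))
    · simp only [indicator_of_mem hy]; ring
    · simp only [indicator_of_notMem hy]; ring
  rw [e1, ← hd, ← integral_indicator U.isOpen.measurableSet]
  refine integral_congr_ae (Eventually.of_forall fun y => ?_)
  simp only
  -- The cut-off to `S` is invisible at `w`: for `y ∉ S` the point `w - y` lies outside the support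
  -- of the kernel.
  by_cases hy : y ∈ S
  · rw [indicator_of_mem hy, indicator_of_mem (hSU hy),
      wirt_wirt_comp_sub _ _ _ _ _ _ (contDiff_kern 2), mul_comm]
  · have h0 : wirt (-1) i (wirt 1 j (kern n k)) (w - y) = 0 := by
      refine image_eq_zero_of_notMem_tsupport fun hmem => hy (hw ?_)
      have := tsupport_wirt_subset (tsupport_wirt_subset hmem)
      rw [tsupport_kern, mem_closedBall_zero_iff] at this
      rwa [Metric.mem_closedBall, dist_comm, dist_eq_norm]
    have h1 : (U : Set (Fin n → ℂ)).indicator (fun z => (u z : ℂ) *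
        wirt (-1) i (wirt 1 j fun y => kern n k (w - y)) z) y = 0 := by
      refine indicator_apply_eq_zero.2 fun _ => ?_
      rw [wirt_wirt_comp_sub _ _ _ _ _ _ (contDiff_kern 2), h0, mul_zero]
    rw [h1, h0, zero_mul]

theorem eventually_closedBall_subset_cthickening {K : Set (Fin n → ℂ)} {δ : ℝ} (hδ : 0 < δ) :
    ∀ᶠ k in atTop, ∀ w ∈ K, Metric.closedBall w (bump n k).rOut ⊆ Metric.cthickening δ K := by
  filter_upwards [(tendsto_bump_rOut (n := n)).eventually_le_const hδ] with k hk w hw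
  exact (Metric.closedBall_subset_closedBall hk).trans (Metric.closedBall_subset_cthickening hw δ)

/-- Mollifications of a continuous function converge locally uniformly. -/
theorem eventually_dist_moll_le {K S : Set (Fin n → ℂ)} {δ : ℝ} (hδ : 0 < δ)
    (hS : S = Metric.cthickening δ K) (hSc : IsCompact S) (hu : ContinuousOn u S) {ε : ℝ}
    (hε : 0 < ε) : ∀ᶠ k in atTop, ∀ w ∈ K, dist (moll k (S.indicator u) w) (u w) ≤ ε := by
  obtain ⟨η, hη, hη'⟩ := Metric.uniformContinuousOn_iff_le.1
    (hSc.uniformContinuousOn_of_continuous hu) ε hε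
  filter_upwards [eventually_closedBall_subset_cthickening (K := K) hδ,
    (tendsto_bump_rOut (n := n)).eventually_le_const hη] with k hk hk' w hw
  have hwS : w ∈ S := by rw [hS]; exact Metric.self_subset_cthickening K hw
  have hm : AEStronglyMeasurable (S.indicator u) :=
    (aestronglyMeasurable_indicator_iff hSc.measurableSet).2
      (hu.aestronglyMeasurable hSc.measurableSet)
  have h := (bump n k).dist_normed_convolution_le (μ := volume) (x₀ := w) (ε := ε) hm
    fun x hx => by
      have hxS : x ∈ S := by rw [hS]; exact hk w hw (Metric.ball_subset_closedBall hx)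
      rw [indicator_of_mem hxS, indicator_of_mem hwS]
      exact hη' x hxS w hwS ((Metric.mem_ball.1 hx).le.trans hk')
  rwa [indicator_of_mem hwS, ← moll_eq_convolution] at h

end Mollification

/-! ### Comparison of mollifications with averages over polydiscs -/

section PolydiscAverages

variable {n : ℕ} {u : (Fin n → ℂ) → ℂ}

/-- The bump lies between the indicators of the inner and the outer polydisc, whose volumes have
ratio `(1 + 1 / (k + 1)) ^ d`, with `d` the real dimension. -/
theorem tendsto_volume_div_integral_bump :
    Tendsto (fun k => volume.real (Metric.ball (0 : Fin n → ℂ) (bump n k).rIn)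
      / ∫ x, bump n k x) atTop (𝓝 1) := by
  set d := Module.finrank ℝ (Fin n → ℂ)
  have hpos : ∀ k, 0 < ∫ x, bump n k x := fun k => (bump n k).integral_pos
  have hV : ∀ k, 0 < volume.real (Metric.ball (0 : Fin n → ℂ) (bump n k).rIn) := fun k =>
    ENNReal.toReal_pos (Metric.measure_ball_pos volume _ (bump n k).rIn_pos).ne'
      measure_ball_lt_top.ne
  have hlow : ∀ k : ℕ, ((1 + 1 / ((k : ℝ) + 1)) ^ d)⁻¹
      ≤ volume.real (Metric.ball (0 : Fin n → ℂ) (bump n k).rIn) / ∫ x, bump n k x := by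
    intro k
    have h1 : volume.real (Metric.closedBall (0 : Fin n → ℂ) (bump n k).rOut)
        = (1 + 1 / ((k : ℝ) + 1)) ^ d
          * volume.real (Metric.ball (0 : Fin n → ℂ) (bump n k).rIn) := by
      rw [Measure.addHaar_real_closedBall volume _ (bump n k).rOut_pos.le,
        measureReal_def volume (Metric.ball _ (bump n k).rIn),
        Measure.addHaar_ball_of_pos volume _ (bump n k).rIn_pos, ENNReal.toReal_mul,
        ENNReal.toReal_ofReal (by have := (bump n k).rIn_pos; positivity), ← measureReal_def,
        ← mul_assoc, ← mul_pow]
      congr 2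
      simp only [bump]; ring
    rw [le_div_iff₀ (hpos k), inv_mul_le_iff₀ (by positivity), ← h1]
    exact (bump n k).integral_le_measure_closedBall volume
  have hup : ∀ k : ℕ, volume.real (Metric.ball (0 : Fin n → ℂ) (bump n k).rIn)
      / ∫ x, bump n k x ≤ 1 := fun k => by
    rw [div_le_one (hpos k)]
    refine le_trans ?_ ((bump n k).measure_closedBall_le_integral volume)
    exact measureReal_mono Metric.ball_subset_closedBall measure_closedBall_lt_top.ne
  refine tendsto_of_tendsto_of_tendsto_of_le_of_le ?_ tendsto_const_nhds hlow hup
  have h := ((tendsto_one_div_add_atTop_nhds_zero_nat (𝕜 := ℝ)).const_add 1).pow d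
  simpa using h.inv₀ (by simp)

/-- For a bounded function, mollifications converge wherever the averages over polydiscs do. -/
theorem tendsto_moll_of_tendsto_average {C : ℝ} (hu : LocallyIntegrable u)
    (hC : ∀ᵐ y, ‖u y‖ ≤ C) {w : Fin n → ℂ} {L : ℂ}
    (h : Tendsto (fun ε : ℝ => ⨍ x in Metric.ball w ε, u x) (𝓝[>] 0) (𝓝 L)) :
    Tendsto (fun k => moll k u w) atTop (𝓝 L) := by
  have hr : Tendsto (fun k => (bump n k).rIn) atTop (𝓝[>] 0) := by
    refine tendsto_nhdsWithin_iff.2 ⟨?_, Eventually.of_forall fun k => (bump n k).rIn_pos⟩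
    exact tendsto_one_div_add_atTop_nhds_zero_nat (𝕜 := ℝ)
  set q : ℕ → ℝ := fun k => volume.real (Metric.ball (0 : Fin n → ℂ) (bump n k).rIn)
      / ∫ x, bump n k x with hq
  have hq1 : Tendsto q atTop (𝓝 1) := tendsto_volume_div_integral_bump
  have hlim : Tendsto (fun k => (q k : ℂ) * ⨍ x in Metric.ball w (bump n k).rIn, u x) atTop
      (𝓝 L) := by
    have h1 : Tendsto (fun k => (q k : ℂ)) atTop (𝓝 1) := by
      exact_mod_cast (Complex.continuous_ofReal.tendsto 1).comp hq1
    simpa using h1.mul (h.comp hr)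
  -- The normalized bump dominates `1 / I` times the indicator of the inner polydisc. The difference
  -- is non-negative with total mass `1 - q k`, and `u` is bounded by `C`.
  have hbd : ∀ k, ‖moll k u w - (q k : ℂ) * ⨍ x in Metric.ball w (bump n k).rIn, u x‖
      ≤ C * (1 - q k) := by
    intro k
    set I := ∫ x, bump n k x with hI
    have hIpos : 0 < I := (bump n k).integral_pos
    set B := Metric.ball w (bump n k).rIn with hB
    have hVB : volume.real B = volume.real (Metric.ball (0 : Fin n → ℂ) (bump n k).rIn) := by
      rw [hB, Measure.addHaar_real_ball_center]
    have hVpos : 0 < volume.real B :=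
      ENNReal.toReal_pos (Metric.measure_ball_pos volume _ (bump n k).rIn_pos).ne'
        measure_ball_lt_top.ne
    have hint1 : Integrable fun y => (kern n k (w - y)) * u y := by
      have := (hasCompactSupport_kern.convolutionExists_left (ContinuousLinearMap.mul ℝ ℂ)
        (continuous_kern (n := n) (k := k)) hu w).integrable_swap
      simpa using this
    have huB : IntegrableOn u B :=
      (hu.integrableOn_isCompact (isCompact_closedBall w _)).mono_set Metric.ball_subset_closedBall
    have hint2 : Integrable (B.indicator fun y => ((I⁻¹ : ℝ) : ℂ) * u y) :=
      IntegrableOn.integrable_indicator (huB.const_mul _) Metric.isOpen_ball.measurableSet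
    have e1 : (q k : ℂ) * ⨍ x in B, u x = ∫ y, B.indicator (fun y => ((I⁻¹ : ℝ) : ℂ) * u y) y := by
      rw [integral_indicator Metric.isOpen_ball.measurableSet, integral_const_mul,
        setAverage_eq, Complex.real_smul, hq]
      simp only
      rw [← hVB, ← hI, ← mul_assoc, ← Complex.ofReal_mul]
      congr 2
      field_simp
    rw [e1, moll, cv_apply, ← integral_sub hint1 hint2]
    have hint3 : Integrable fun y => (bump n k).normed volume (w - y) :=
      (bump n k).integrable_normed.comp_sub_left w
    have hint4 : Integrable (B.indicator fun _ : Fin n → ℂ => (I⁻¹ : ℝ)) :=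
      (integrableOn_const measure_ball_lt_top.ne).integrable_indicator
        Metric.isOpen_ball.measurableSet
    have hle : ∀ y, B.indicator (fun _ => (I⁻¹ : ℝ)) y ≤ (bump n k).normed volume (w - y) := by
      intro y
      by_cases hy : y ∈ B
      · rw [indicator_of_mem hy, ContDiffBump.normed_def, (bump n k).one_of_mem_closedBall, one_div]
        rw [mem_closedBall_zero_iff, ← dist_eq_norm, dist_comm]
        exact (Metric.mem_ball.1 hy).le
      · rw [indicator_of_notMem hy]
        exact (bump n k).nonneg_normed _
    calc _ ≤ ∫ y, C * ((bump n k).normed volume (w - y) - B.indicator (fun _ => (I⁻¹ : ℝ)) y) := by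
          refine norm_integral_le_of_norm_le ((hint3.sub hint4).const_mul C) ?_
          filter_upwards [hC] with y hy
          have e2 : kern n k (w - y) * u y - B.indicator (fun y => ((I⁻¹ : ℝ) : ℂ) * u y) y
              = (((bump n k).normed volume (w - y)
                - B.indicator (fun _ => (I⁻¹ : ℝ)) y : ℝ) : ℂ) * u y := by
            by_cases hyB : y ∈ B
            · simp only [indicator_of_mem hyB, kern]; push_cast; ring
            · simp only [indicator_of_notMem hyB, kern]; push_cast; ring
          rw [e2, norm_mul, Complex.norm_real, Real.norm_of_nonneg (sub_nonneg.2 (hle y)), mul_comm]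
          exact mul_le_mul_of_nonneg_right hy (sub_nonneg.2 (hle y))
      _ = C * (1 - q k) := by
          rw [integral_const_mul, integral_sub hint3 hint4,
            integral_sub_left_eq_self (fun x => (bump n k).normed volume x) volume w,
            (bump n k).integral_normed, integral_indicator Metric.isOpen_ball.measurableSet,
            setIntegral_const, smul_eq_mul, hVB, hq]
          rfl
  have hz : Tendsto (fun k => C * (1 - q k)) atTop (𝓝 0) := by
    simpa using (hq1.const_sub 1).const_mul C
  have := (squeeze_zero_norm hbd hz).add hlim
  simpa using this

end PolydiscAverages

/-! ### Weak limits along an ultrafilter -/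

section WeakLimits

variable {X : Type*} [MeasurableSpace X] {μ : Measure X}

theorem inner_toLp_conj {f g : X → ℂ} (hf : MemLp (fun x => (starRingEnd ℂ) (f x)) 2 μ)
    (hg : MemLp g 2 μ) : inner ℂ (hf.toLp _) (hg.toLp g) = ∫ x, f x * g x ∂μ := by
  rw [L2.inner_def]
  refine integral_congr_ae ?_
  filter_upwards [hf.coeFn_toLp, hg.coeFn_toLp] with x h1 h2
  rw [h1, h2]
  simp [mul_comm]

/-- Bounded sequences in a Hilbert space converge weakly along ultrafilters. -/
theorem exists_tendsto_inner {H : Type*} [NormedAddCommGroup H] [InnerProductSpace ℂ H]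
    [CompleteSpace H] (B : ℕ → H) {R : ℝ} (hB : ∀ k, ‖B k‖ ≤ R) (𝒰 : Ultrafilter ℕ) :
    ∃ b : H, ∀ g : H, Tendsto (fun k => inner ℂ (B k) g) 𝒰 (𝓝 (inner ℂ b g)) := by
  -- By Banach–Alaoglu; an ultrafilter replaces the extraction of a subsequence, so no separability
  -- is needed.
  obtain ⟨x, -, hx⟩ := (WeakDual.isCompact_closedBall (𝕜 := ℂ) (E := H) 0 R).ultrafilter_le_nhds
    (𝒰.map fun k => StrongDual.toWeakDual (InnerProductSpace.toDual ℂ H (B k))) (by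
      refine tendsto_principal.2 (Eventually.of_forall fun k => ?_)
      simp only [mem_preimage, mem_closedBall_zero_iff]
      exact ((InnerProductSpace.toDual ℂ H).norm_map (B k)).trans_le (hB k))
  refine ⟨(InnerProductSpace.toDual ℂ H).symm (WeakDual.toStrongDual x), fun g => ?_⟩
  rw [InnerProductSpace.toDual_symm_apply]
  exact ((WeakDual.eval_continuous g).tendsto x).comp hx

variable [IsFiniteMeasure μ]

theorem memLp_of_measurable_of_bound {f : X → ℂ} (hf : Measurable f) {C : ℝ}
    (hC : ∀ x, ‖f x‖ ≤ C) (p : ℝ≥0∞) : MemLp f p μ :=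
  MemLp.of_bound hf.aestronglyMeasurable C (Eventually.of_forall hC)

/-- The limit is taken in `L²` of the push-forward measure, so that it is a function on `Y` and not
merely on `X`. Composition with `F` is an isometry into `L² μ`, and its adjoint turns a test
function on `X` into one on `Y`. -/
theorem exists_weak_limit_comp {Y : Type*} [MeasurableSpace Y] {F : X → Y} (hF : Measurable F)
    (b : ℕ → Y → ℂ) (hb : ∀ k, Measurable (b k)) {C : ℝ} (hC : ∀ k y, ‖b k y‖ ≤ C)
    (𝒰 : Ultrafilter ℕ) : ∃ h : Y → ℂ, Measurable h ∧ MemLp h 2 (μ.map F) ∧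
      ∀ ψ : X → ℂ, MemLp ψ 2 μ →
        Tendsto (fun k => ∫ x, b k (F x) * ψ x ∂μ) 𝒰 (𝓝 (∫ x, h (F x) * ψ x ∂μ)) := by
  set ν := μ.map F with hν
  have hmp : MeasurePreserving F μ ν := ⟨hF, rfl⟩
  have : IsFiniteMeasure ν := Measure.isFiniteMeasure_map μ F
  have hbc : ∀ k, MemLp (fun y => (starRingEnd ℂ) (b k y)) 2 ν := fun k =>
    memLp_of_measurable_of_bound (Complex.continuous_conj.measurable.comp (hb k))
      (fun y => by simpa using hC k y) 2
  obtain ⟨H, hH⟩ := exists_tendsto_inner (fun k => (hbc k).toLp _)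
    (R := ν.real univ ^ (2 : ℝ≥0∞).toReal⁻¹ * max C 0) (fun k => by
      refine Lp.norm_le_of_ae_bound (le_max_right _ _) ?_
      filter_upwards [(hbc k).coeFn_toLp] with y hy
      rw [hy]
      simpa using Or.inl (hC k y)) 𝒰
  have hHm : AEStronglyMeasurable (H : Y → ℂ) ν := Lp.aestronglyMeasurable H
  set h : Y → ℂ := fun y => (starRingEnd ℂ) (hHm.mk _ y) with hh
  have hhm : Measurable h :=
    Complex.continuous_conj.measurable.comp hHm.stronglyMeasurable_mk.measurable
  have hHl : MemLp (fun y => (starRingEnd ℂ) (h y)) 2 ν := by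
    refine (Lp.memLp H).ae_eq ?_
    filter_upwards [hHm.ae_eq_mk] with y hy
    simp [hh, hy]
  have hHe : H = hHl.toLp _ := by
    refine Lp.ext ?_
    filter_upwards [hHl.coeFn_toLp, hHm.ae_eq_mk] with y h1 h2
    rw [h1, h2]
    simp [hh]
  have hhl : MemLp h 2 ν := by
    refine hHl.norm.congr_norm hhm.aestronglyMeasurable (Eventually.of_forall fun y => ?_)
    simp
  refine ⟨h, hhm, hhl, fun ψ hψ => ?_⟩
  have key : ∀ f : Y → ℂ, ∀ hf : MemLp (fun y => (starRingEnd ℂ) (f y)) 2 ν,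
      ∫ x, f (F x) * ψ x ∂μ = inner ℂ (hf.toLp _)
        (ContinuousLinearMap.adjoint
          (Lp.compMeasurePreservingₗᵢ (p := 2) ℂ F hmp :
            Lp ℂ 2 ν →ₗᵢ[ℂ] Lp ℂ 2 μ).toContinuousLinearMap (hψ.toLp ψ)) := by
    intro f hf
    rw [ContinuousLinearMap.adjoint_inner_right]
    change _ = inner ℂ (Lp.compMeasurePreserving F hmp (hf.toLp _)) _
    rw [Lp.toLp_compMeasurePreserving hf hmp]
    exact (inner_toLp_conj (f := fun x => f (F x)) (hf.comp_measurePreserving hmp) hψ).symm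
  rw [key h hHl, ← hHe]
  simp only [key _ (hbc _)]
  exact hH _

/-- A bounded sequence `b_k` has a bounded Borel function `h` such that `b_k ∘ F → h ∘ F` weakly
along an ultrafilter, and `h` is the limit of `b_k` at every point where this limit exists. -/
theorem exists_weak_limit_comp_of_bound {Y : Type*} [MeasurableSpace Y] {F : X → Y}
    (hF : Measurable F) (b : ℕ → Y → ℂ) (hb : ∀ k, Measurable (b k)) {C : ℝ}
    (hC : ∀ k y, ‖b k y‖ ≤ C) {𝒰 : Ultrafilter ℕ} (h𝒰 : (𝒰 : Filter ℕ) ≤ atTop) :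
    ∃ h : Y → ℂ, Measurable h ∧ (∀ y, ‖h y‖ ≤ C) ∧
      (∀ y L, Tendsto (fun k => b k y) atTop (𝓝 L) → h y = L) ∧
      ∀ ψ : X → ℂ, MemLp ψ 2 μ →
        Tendsto (fun k => ∫ x, b k (F x) * ψ x ∂μ) 𝒰 (𝓝 (∫ x, h (F x) * ψ x ∂μ)) := by
  classical
  rcases isEmpty_or_nonempty Y with hY | ⟨⟨y₀⟩⟩
  · refine ⟨fun _ => 0, measurable_const, fun y => (hY.false y).elim,
      fun y => (hY.false y).elim, fun ψ _ => ?_⟩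
    have : IsEmpty X := F.isEmpty
    simp only [integral_of_isEmpty]
    exact tendsto_const_nhds
  have hC0 : 0 ≤ C := (norm_nonneg _).trans (hC 0 y₀)
  obtain ⟨h₀, hm₀, hl₀, hw₀⟩ := exists_weak_limit_comp (μ := μ) hF b hb hC 𝒰
  set ν := μ.map F with hν
  have : IsFiniteMeasure ν := Measure.isFiniteMeasure_map μ F
  have hwν : ∀ g : Y → ℂ, Measurable g → (∀ y, ‖g y‖ ≤ 1) →
      Tendsto (fun k => ∫ y, b k y * g y ∂ν) 𝒰 (𝓝 (∫ y, h₀ y * g y ∂ν)) := by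
    intro g hg hg1
    have := hw₀ (fun x => g (F x)) (memLp_of_measurable_of_bound (hg.comp hF)
      (fun x => hg1 _) 2)
    have e : ∀ f : Y → ℂ, Measurable f →
        ∫ y, f y * g y ∂ν = ∫ x, f (F x) * g (F x) ∂μ := fun f hf =>
      integral_map hF.aemeasurable (hf.mul hg).aestronglyMeasurable
    simpa only [e _ hm₀, e _ (hb _)] using this
  have hint₀ : Integrable h₀ ν := hl₀.integrable (by norm_num)
  -- Testing against the conjugate phase of `h₀` on the set `A` where `C < ‖h₀‖` gives `∫_A ‖h₀‖ ≤ C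
  -- ν(A)`, which is impossible unless `A` is null.
  have hbound : ∀ᵐ y ∂ν, ‖h₀ y‖ ≤ C := by
    set A : Set Y := {y | C < ‖h₀ y‖} with hA
    have hAm : MeasurableSet A := measurableSet_lt measurable_const hm₀.norm
    by_contra hcon
    have hAν : ν A ≠ 0 := fun h0 => hcon (by
      rw [ae_iff]; simpa [hA, not_le] using h0)
    have hgt := setIntegral_gt_gt hC0 hint₀.norm.integrableOn hAν
    set g : Y → ℂ := A.indicator fun y => (starRingEnd ℂ) (h₀ y) / (‖h₀ y‖ : ℂ) with hg
    have hgm : Measurable g :=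
      ((Complex.continuous_conj.measurable.comp hm₀).div
        (Complex.measurable_ofReal.comp hm₀.norm)).indicator hAm
    have hg1 : ∀ y, ‖g y‖ ≤ A.indicator (fun _ => (1 : ℝ)) y := by
      intro y
      by_cases hy : y ∈ A
      · rw [hg, indicator_of_mem hy, indicator_of_mem hy, norm_div, RCLike.norm_conj,
          Complex.norm_real, norm_norm]
        exact div_self_le_one _
      · rw [hg, indicator_of_notMem hy, indicator_of_notMem hy, norm_zero]
    have hlim := hwν g hgm fun y => (hg1 y).trans (indicator_le_self' (by simp) y)
    have e1 : ∫ y, h₀ y * g y ∂ν = ((∫ y in A, ‖h₀ y‖ ∂ν : ℝ) : ℂ) := by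
      rw [← integral_complex_ofReal, ← integral_indicator hAm]
      refine integral_congr_ae (Eventually.of_forall fun y => ?_)
      simp only
      by_cases hy : y ∈ A
      · have hne : (‖h₀ y‖ : ℂ) ≠ 0 := by
          have : 0 < ‖h₀ y‖ := hC0.trans_lt hy
          exact_mod_cast this.ne'
        rw [hg, indicator_of_mem hy, indicator_of_mem hy, mul_div_assoc', Complex.mul_conj,
          Complex.normSq_eq_norm_sq]
        push_cast
        field_simp
      · rw [hg, indicator_of_notMem hy, indicator_of_notMem hy, mul_zero]
    have hle : ‖∫ y, h₀ y * g y ∂ν‖ ≤ ν.real A * C := by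
      refine le_of_tendsto hlim.norm (Eventually.of_forall fun k => ?_)
      calc ‖∫ y, b k y * g y ∂ν‖ ≤ ∫ y, A.indicator (fun _ => C) y ∂ν := by
            refine norm_integral_le_of_norm_le ((integrable_const C).indicator hAm)
              (Eventually.of_forall fun y => ?_)
            rw [norm_mul]
            calc ‖b k y‖ * ‖g y‖ ≤ C * A.indicator (fun _ => (1 : ℝ)) y :=
                  mul_le_mul (hC k y) (hg1 y) (norm_nonneg _) hC0
              _ = A.indicator (fun _ => C) y := by
                  by_cases hy : y ∈ A <;> simp [hy]
        _ = ν.real A * C := by rw [integral_indicator hAm, setIntegral_const, smul_eq_mul]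
    rw [e1, Complex.norm_real] at hle
    exact absurd ((le_abs_self _).trans hle) (not_le.2 hgt)
  set E : Set Y := {y | ∃ c, Tendsto (fun k => b k y) atTop (𝓝 c)} with hE
  have hEm : MeasurableSet E := measurableSet_exists_tendsto hb
  set l : Y → ℂ := fun y => if hy : y ∈ E then hy.choose else 0 with hl
  have hlt : ∀ y ∈ E, Tendsto (fun k => b k y) atTop (𝓝 (l y)) := fun y hy => by
    have : l y = hy.choose := by rw [hl]; simp only [hy, dite_true]
    rw [this]; exact hy.choose_spec
  have hlm : Measurable l := by
    refine measurable_of_tendsto_metrizable (f := fun k => E.indicator (b k))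
      (fun k => (hb k).indicator hEm) (tendsto_pi_nhds.2 fun y => ?_)
    by_cases hy : y ∈ E
    · simpa only [indicator_of_mem hy] using hlt y hy
    · have : l y = 0 := by rw [hl]; simp only [hy, dite_false]
      simp only [indicator_of_notMem hy, this, tendsto_const_nhds]
  have hlC : ∀ y, ‖l y‖ ≤ C := fun y => by
    by_cases hy : y ∈ E
    · exact le_of_tendsto (hlt y hy).norm (Eventually.of_forall fun k => hC k y)
    · have : l y = 0 := by rw [hl]; simp only [hy, dite_false]
      rw [this, norm_zero]; exact hC0
  -- On `E` the pointwise limit is also a limit of integrals over measurable subsets, by dominated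
  -- convergence, hence agrees with the weak limit.
  have hEeq : ∀ᵐ y ∂ν.restrict E, h₀ y = l y := by
    have hli : Integrable l (ν.restrict E) := by
      exact (memLp_of_measurable_of_bound hlm hlC 1).integrable le_rfl
    refine Integrable.ae_eq_of_forall_setIntegral_eq h₀ l hint₀.restrict hli fun s hs _ => ?_
    rw [Measure.restrict_restrict hs]
    have hsE : MeasurableSet (s ∩ E) := hs.inter hEm
    have e : ∀ f : Y → ℂ, ∫ y in s ∩ E, f y ∂ν
        = ∫ y, f y * (s ∩ E).indicator (fun _ => 1) y ∂ν := fun f => by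
      rw [← integral_indicator hsE]
      refine integral_congr_ae (Eventually.of_forall fun y => ?_)
      by_cases hy : y ∈ s ∩ E <;> simp [hy]
    have h1 := hwν ((s ∩ E).indicator fun _ => 1) (measurable_const.indicator hsE) fun y => by
      by_cases hy : y ∈ s ∩ E <;> simp [hy]
    have h2 : Tendsto (fun k => ∫ y in s ∩ E, b k y ∂ν) atTop (𝓝 (∫ y in s ∩ E, l y ∂ν)) := by
      refine tendsto_integral_of_dominated_convergence (fun _ => C)
        (fun k => (hb k).aestronglyMeasurable) (integrable_const C)
        (fun k => Eventually.of_forall (hC k)) ?_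
      exact (ae_restrict_iff' hsE).2 (Eventually.of_forall fun y hy => hlt y hy.2)
    simp only [← e] at h1
    exact tendsto_nhds_unique h1 (h2.mono_left h𝒰)
  -- The values change only on a `ν`-null set, which `F` pulls back to a `μ`-null set; now the bound
  -- and the agreement with pointwise limits hold everywhere.
  set h : Y → ℂ := fun y => if y ∈ E then l y else if ‖h₀ y‖ ≤ C then h₀ y else 0 with hh
  have hhm : Measurable h := Measurable.ite hEm hlm
    (Measurable.ite (measurableSet_le hm₀.norm measurable_const) hm₀ measurable_const)
  have hae : h₀ =ᵐ[ν] h := by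
    filter_upwards [hbound, (ae_restrict_iff' hEm).1 hEeq] with y h1 h2
    by_cases hy : y ∈ E
    · simp only [hh, hy, if_true, h2 hy]
    · simp only [hh, hy, if_false, h1, if_true]
  refine ⟨h, hhm, fun y => ?_, fun y L hL => ?_, fun ψ hψ => ?_⟩
  · simp only [hh]
    split_ifs with h1 h2
    · exact hlC y
    · exact h2
    · rwa [norm_zero]
  · have hy : y ∈ E := ⟨L, hL⟩
    simp only [hh, hy, if_true]
    exact tendsto_nhds_unique (hlt y hy) hL
  · have : ∫ x, h (F x) * ψ x ∂μ = ∫ x, h₀ (F x) * ψ x ∂μ := by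
      refine integral_congr_ae ?_
      filter_upwards [ae_of_ae_map hF.aemeasurable hae] with x hx
      rw [hx]
    rw [this]
    exact hw₀ ψ hψ

end WeakLimits

/-! ### The sub-mean value inequality and the Laplacian of smooth functions -/

section Subharmonic

/-- Taylor's theorem of order two. -/
theorem eventually_norm_taylor_two_le {E G : Type*} [NormedAddCommGroup E] [NormedSpace ℝ E]
    [NormedAddCommGroup G] [NormedSpace ℝ G] {f : E → G} (hf : ContDiff ℝ 2 f) (w : E) {ε : ℝ}
    (hε : 0 < ε) : ∃ δ > 0, ∀ x : E, ‖x‖ < δ →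
      ‖f (w + x) - f w - fderiv ℝ f w x - (1 / 2 : ℝ) • fderiv ℝ (fderiv ℝ f) w x x‖
        ≤ ε * ‖x‖ ^ 2 := by
  set B := fderiv ℝ (fderiv ℝ f) w with hB
  have hsym : IsSymmSndFDerivAt ℝ f w := hf.contDiffAt.isSymmSndFDerivAt (by simp)
  have hd : HasFDerivAt (fderiv ℝ f) B w :=
    ((hf.fderiv_right (m := 1) (by norm_num)).differentiable (by norm_num) w).hasFDerivAt
  have hlo := (hasFDerivAt_iff_isLittleO_nhds_zero.1 hd).def hε
  obtain ⟨δ, hδ, hball⟩ := Metric.eventually_nhds_iff_ball.1 hlo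
  refine ⟨δ, hδ, fun x hx => ?_⟩
  set R : E → G := fun x => f (w + x) - f w - fderiv ℝ f w x - (1 / 2 : ℝ) • B x x with hR
  have hRd : ∀ y, HasFDerivAt R (fderiv ℝ f (w + y) - fderiv ℝ f w - B y) y := by
    intro y
    have h1 : HasFDerivAt (fun x => f (w + x)) (fderiv ℝ f (w + y)) y := by
      exact HasFDerivAt.comp (f := fun x => w + x) y
        (hf.differentiable (by norm_num) (w + y)).hasFDerivAt ((hasFDerivAt_id y).const_add w)
    have h2 : HasFDerivAt (fun x => B x x) (B y + B.flip y) y := by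
      simpa using B.hasFDerivAt.clm_apply (hasFDerivAt_id y)
    have h3 := ((h1.sub_const (f w)).sub (fderiv ℝ f w).hasFDerivAt).sub
      (h2.const_smul (1 / 2 : ℝ))
    refine h3.congr_fderiv ?_
    ext v
    have : B v y = B y v := hsym v y
    simp only [_root_.sub_apply, _root_.smul_apply, _root_.add_apply,
      ContinuousLinearMap.flip_apply, this, ← two_smul ℝ (B y v), smul_smul]
    norm_num
  -- At `y` with `‖y‖ ≤ ‖x‖` the remainder has derivative of norm at most `ε ‖x‖`, so the mean value
  -- inequality on the segment from `0` to `x` gives `ε ‖x‖²`.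
  have hmv := ((convex_closedBall (0 : E) ‖x‖).inter
    (convex_ball (0 : E) δ)).norm_image_sub_le_of_norm_hasFDerivWithin_le
    (f := R) (C := ε * ‖x‖) (x := 0) (y := x) (fun y _ => (hRd y).hasFDerivWithinAt)
    (fun y hy => by
      refine (hball y hy.2).trans ?_
      have := mem_closedBall_zero_iff.1 hy.1
      gcongr) ⟨by simp, by simpa using hδ⟩ ⟨by simp, by simpa using hx⟩
  have h0 : R 0 = 0 := by simp [hR]
  rw [h0, sub_zero, sub_zero] at hmv
  calc ‖R x‖ ≤ ε * ‖x‖ * ‖x‖ := hmv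
    _ = ε * ‖x‖ ^ 2 := by ring

theorem continuous_single_circleMap (r : ℝ) :
    Continuous fun θ : ℝ => (Pi.single 0 (circleMap 0 r θ) : Fin 1 → ℂ) :=
  continuous_pi fun i => by
    rw [Subsingleton.elim i 0]
    simpa using continuous_circleMap 0 r

/-- A smooth function of one complex variable that satisfies the sub-mean value inequality on
small circles about `0` has non-negative Laplacian at `0`. -/
theorem wirt_wirt_re_nonneg_of_subMean {g : (Fin 1 → ℂ) → ℂ} (hg : ContDiff ℝ 2 g)
    (h : ∀ᶠ r : ℝ in 𝓝[>] 0, (g 0).re * (2 * Real.pi)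
      ≤ (∫ θ in (0 : ℝ)..2 * Real.pi, g (Pi.single 0 (circleMap 0 r θ))).re) :
    0 ≤ (wirt (-1) 0 (wirt 1 0 g) 0).re := by
  set e : Fin 1 → ℂ := Pi.single 0 1 with he
  set e' : Fin 1 → ℂ := Pi.single 0 Complex.I with he'
  set B := fderiv ℝ (fderiv ℝ g) 0 with hB
  set L := fderiv ℝ g 0 with hL
  have hsym : IsSymmSndFDerivAt ℝ g 0 := hg.contDiffAt.isSymmSndFDerivAt (by simp)
  have hcirc : ∀ r θ : ℝ, (Pi.single 0 (circleMap 0 r θ) : Fin 1 → ℂ)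
      = (r * Real.cos θ) • e + (r * Real.sin θ) • e' := by
    intro r θ
    ext i
    rw [Subsingleton.elim i 0]
    simp only [he, he', Pi.single_eq_same, Pi.add_apply, Pi.smul_apply, Complex.real_smul,
      circleMap_zero, Complex.exp_mul_I]
    push_cast
    ring
  have hnorm : ∀ r θ : ℝ, 0 < r → ‖(Pi.single 0 (circleMap 0 r θ) : Fin 1 → ℂ)‖ = r := by
    intro r θ hr
    rw [Pi.norm_single, norm_circleMap_zero, abs_of_pos hr]
  -- Integrating Taylor's formula over a circle of radius `r` leaves `2π g(0) + (π r² / 2) (B e e +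
  -- B e' e')`, with error at most `2π ε r²`. Dividing `-2π ε r²` by `π r² / 2` gives `-4 ε`.
  have key : ∀ ε > 0, -(4 * ε) ≤ (B e e + B e' e').re := by
    intro ε hε
    obtain ⟨δ, hδ, hT⟩ := eventually_norm_taylor_two_le hg 0 hε
    obtain ⟨r, ⟨hr1, hr2⟩, hr3⟩ :=
      ((eventually_mem_set.2 (Ioo_mem_nhdsGT hδ : Ioo 0 δ ∈ 𝓝[>] (0 : ℝ))).and h).exists
    set P : ℝ → ℂ := fun θ => g 0 + ((Real.cos θ) • (r • L e) + (Real.sin θ) • (r • L e'))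
      + ((Real.cos θ ^ 2) • ((r ^ 2 / 2) • B e e) + ((Real.sin θ * Real.cos θ) • (r ^ 2 • B e e')
        + (Real.sin θ ^ 2) • ((r ^ 2 / 2) • B e' e'))) with hP
    have hPx : ∀ θ, P θ = g 0 + L (Pi.single 0 (circleMap 0 r θ))
        + (1 / 2 : ℝ) • B (Pi.single 0 (circleMap 0 r θ)) (Pi.single 0 (circleMap 0 r θ)) := by
      intro θ
      have hs : B e' e = B e e' := hsym e' e
      rw [hcirc]
      simp only [hP, map_add, map_smul, _root_.add_apply, _root_.smul_apply, hs,
        Complex.real_smul]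
      push_cast
      ring
    have hPi : ∫ θ in (0 : ℝ)..2 * Real.pi, P θ
        = 2 * Real.pi * g 0 + (Real.pi * r ^ 2 / 2 : ℝ) * (B e e + B e' e') := by
      simp only [hP]
      have c0 : Continuous Real.cos := Real.continuous_cos
      have s0 : Continuous Real.sin := Real.continuous_sin
      have ii : ∀ {f : ℝ → ℂ}, Continuous f → IntervalIntegrable f volume 0 (2 * Real.pi) :=
        fun hf => hf.intervalIntegrable _ _
      rw [intervalIntegral.integral_add (ii (by fun_prop)) (ii (by fun_prop)),
        intervalIntegral.integral_add (ii (by fun_prop)) (ii (by fun_prop)),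
        intervalIntegral.integral_add (ii (by fun_prop)) (ii (by fun_prop)),
        intervalIntegral.integral_add (ii (by fun_prop)) (ii (by fun_prop)),
        intervalIntegral.integral_add (ii (by fun_prop)) (ii (by fun_prop))]
      simp only [intervalIntegral.integral_smul_const, intervalIntegral.integral_const,
        integral_cos_sq, integral_sin_sq, integral_sin_mul_cos₁, integral_cos, integral_sin]
      simp
      ring
    have hdiff : ‖(∫ θ in (0 : ℝ)..2 * Real.pi, g (Pi.single 0 (circleMap 0 r θ)))
        - ∫ θ in (0 : ℝ)..2 * Real.pi, P θ‖ ≤ ε * r ^ 2 * (2 * Real.pi) := by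
      have i1 : Continuous fun θ : ℝ => g (Pi.single 0 (circleMap 0 r θ)) :=
        hg.continuous.comp (continuous_single_circleMap r)
      have i2 : Continuous P := by
        have c0 : Continuous Real.cos := Real.continuous_cos
        have s0 : Continuous Real.sin := Real.continuous_sin
        simp only [hP]; fun_prop
      rw [← intervalIntegral.integral_sub (i1.intervalIntegrable _ _)
        (i2.intervalIntegrable _ _)]
      have := intervalIntegral.norm_integral_le_of_norm_le_const (a := 0) (b := 2 * Real.pi)
        (f := fun θ => g (Pi.single 0 (circleMap 0 r θ)) - P θ) (C := ε * r ^ 2) fun θ _ => by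
          have h1 := hT (Pi.single 0 (circleMap 0 r θ)) (by rwa [hnorm r θ hr1])
          rw [hnorm r θ hr1, zero_add] at h1
          rw [hPx]
          refine (le_of_eq ?_).trans h1
          congr 1
          ring
      rwa [sub_zero, abs_of_pos Real.two_pi_pos] at this
    rw [hPi] at hdiff
    have h1 := (Complex.abs_re_le_norm _).trans hdiff
    have h2 := (abs_le.1 h1).2
    have e2 : (2 * Real.pi * g 0 + (Real.pi * r ^ 2 / 2 : ℝ) * (B e e + B e' e')).re
        = 2 * Real.pi * (g 0).re + (Real.pi * r ^ 2 / 2) * (B e e + B e' e').re := by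
      rw [Complex.add_re, Complex.re_ofReal_mul]
      congr 1
      rw [show (2 * Real.pi * g 0 : ℂ) = ((2 * Real.pi : ℝ) : ℂ) * g 0 by push_cast; ring,
        Complex.re_ofReal_mul]
    rw [Complex.sub_re, e2] at h2
    have hr0 : 0 < Real.pi * r ^ 2 / 2 := by have := Real.pi_pos; have : 0 < r := hr1; positivity
    have h4 : 0 ≤ (Real.pi * r ^ 2 / 2) * ((B e e + B e' e').re + 4 * ε) := by nlinarith
    have := (mul_nonneg_iff_of_pos_left hr0).1 h4
    linarith
  have hfin : 0 ≤ (B e e + B e' e').re := by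
    refine le_of_forall_pos_lt_add fun ε hε => ?_
    have := key (ε / 8) (by positivity)
    linarith
  rw [wirt_neg_one_wirt_one hg.contDiffAt, show (1 / 4 : ℂ) = ((1 / 4 : ℝ) : ℂ) by norm_num,
    Complex.re_ofReal_mul]
  positivity

/-- On real-valued functions `∂/∂z_j` and `∂/∂z̄_j` are conjugate to each other, and they commute.
The order on `ℂ` makes `0 ≤ c` include `c.im = 0`, so this half is needed too. -/
theorem wirt_wirt_im_eq_zero {m : ℕ} {g : (Fin m → ℂ) → ℂ} (hg : ContDiff ℝ 2 g)
    (h : ∀ x, (starRingEnd ℂ) (g x) = g x) (j : Fin m) (z : Fin m → ℂ) :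
    (wirt (-1) j (wirt 1 j g) z).im = 0 := by
  rw [← Complex.conj_eq_iff_im]
  have h1 : wirt (-1) j g = fun x => (starRingEnd ℂ) (wirt 1 j g x) := by
    funext x
    have := wirt_conj (s := -1) (j := j) (hg.differentiable (by norm_num) x)
    simpa [h] using this
  have h2 : wirt 1 j (wirt (-1) j g) z = (starRingEnd ℂ) (wirt (-1) j (wirt 1 j g) z) := by
    rw [h1, wirt_conj (differentiableAt_wirt hg.contDiffAt)]
    simp
  rw [← h2, wirt_comm hg.contDiffAt]

end Subharmonic

open scoped ComplexOrder

/-! ### Mollifications of plurisubharmonic functions -/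

section PlurisubharmonicMollification

variable {n : ℕ} {Ω : TopologicalSpace.Opens (Fin n → ℂ)} {ρ : (Fin n → ℂ) → ℝ}
  {S : Set (Fin n → ℂ)} {k : ℕ}

theorem integrable_indicator_ofReal (hS : IsCompact S) (hρ : ContinuousOn ρ S) :
    Integrable (S.indicator fun y => (ρ y : ℂ)) :=
  IntegrableOn.integrable_indicator ((Complex.continuous_ofReal.comp_continuousOn
    hρ).integrableOn_compact hS) hS.measurableSet

theorem moll_indicator_eq_ofReal {w : Fin n → ℂ}
    (hw : Metric.closedBall w (bump n k).rOut ⊆ S) :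
    moll k (S.indicator fun y => (ρ y : ℂ)) w
      = ((∫ y, (bump n k).normed volume y * ρ (w - y) : ℝ) : ℂ) := by
  rw [moll, cv_apply', ← integral_complex_ofReal]
  refine integral_congr_ae (Eventually.of_forall fun y => ?_)
  simp only
  by_cases hy : ‖y‖ ≤ (bump n k).rOut
  · have : w - y ∈ S := hw (by simpa [Metric.mem_closedBall, dist_eq_norm] using hy)
    rw [indicator_of_mem this, kern]
    push_cast
    rfl
  · have h0 : (bump n k).normed volume y = 0 := by
      rw [← Function.notMem_support, (bump n k).support_normed_eq, mem_ball_zero_iff]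
      exact fun h => hy h.le
    rw [kern, h0]
    simp

/-- The inequality for `ρ` on the disc centred at `w - y` is integrated against the non-negative
kernel in `y`, and Fubini exchanges the integrals. The radius `rOut + ‖v‖` keeps all these discs
inside `S`. -/
theorem subMean_moll (hρ : ContinuousOn ρ Ω) (hpsh : Plurisubharmonic Ω ρ) (hSΩ : S ⊆ Ω)
    {w v : Fin n → ℂ} (hw : Metric.closedBall w ((bump n k).rOut + ‖v‖) ⊆ S) :
    (moll k (S.indicator fun y => (ρ y : ℂ)) w).re * (2 * Real.pi)
      ≤ (∫ θ in (0 : ℝ)..2 * Real.pi,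
          moll k (S.indicator fun y => (ρ y : ℂ)) (w + circleMap 0 1 θ • v)).re := by
  set χ : (Fin n → ℂ) → ℝ := (bump n k).normed volume with hχ
  have hball : ∀ t : ℂ, ‖t‖ ≤ 1 → Metric.closedBall (w + t • v) (bump n k).rOut ⊆ S := by
    intro t ht
    refine (Metric.closedBall_subset_closedBall' ?_).trans hw
    rw [dist_eq_norm, add_sub_cancel_left, norm_smul]
    have : ‖t‖ * ‖v‖ ≤ 1 * ‖v‖ := by gcongr
    linarith
  have hcm : ∀ θ : ℝ, ‖circleMap 0 1 θ‖ ≤ 1 := fun θ => by simp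
  have hmem : ∀ t : ℂ, ‖t‖ ≤ 1 → ∀ y, ‖y‖ ≤ (bump n k).rOut → w + t • v - y ∈ S := by
    intro t ht y hy
    exact hball t ht (by simpa [Metric.mem_closedBall, dist_eq_norm] using hy)
  have hχ0 : ∀ y, ¬ ‖y‖ ≤ (bump n k).rOut → χ y = 0 := by
    intro y hy
    rw [← Function.notMem_support, hχ, (bump n k).support_normed_eq, mem_ball_zero_iff]
    exact fun h => hy h.le
  set f : ℝ → (Fin n → ℂ) → ℝ := fun θ y => χ y * ρ (w + circleMap 0 1 θ • v - y) with hf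
  have hcont : Continuous fun p : ℝ × (Fin n → ℂ) =>
      (ρ (w + circleMap 0 1 p.1 • v - p.2) : ℂ) * kern n k p.2 := by
    have hc0 : Continuous fun p : ℝ × (Fin n → ℂ) => w + circleMap 0 1 p.1 • v - p.2 :=
      (continuous_const.add (((continuous_circleMap 0 1).comp continuous_fst).smul
        continuous_const)).sub continuous_snd
    refine continuous_mul_of_tsupport_subset
      (h := fun p : ℝ × (Fin n → ℂ) => (ρ (w + circleMap 0 1 p.1 • v - p.2) : ℂ))
      (ψ := fun p : ℝ × (Fin n → ℂ) => kern n k p.2)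
      (Ω.isOpen.preimage hc0) ?_ (continuous_kern.comp continuous_snd) ?_
    · exact Complex.continuous_ofReal.comp_continuousOn
        (hρ.comp hc0.continuousOn fun p hp => hp)
    · have hsub : tsupport (fun p : ℝ × (Fin n → ℂ) => kern n k p.2)
          ⊆ Prod.snd ⁻¹' tsupport (kern n k) :=
        closure_minimal (fun p hp => subset_closure hp)
          ((isClosed_tsupport _).preimage continuous_snd)
      refine hsub.trans fun p hp => hSΩ (hmem _ (hcm p.1) _ ?_)
      rwa [mem_preimage, tsupport_kern, mem_closedBall_zero_iff] at hp
  have hfc : Continuous (Function.uncurry f) := by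
    have := Complex.continuous_re.comp hcont
    refine this.congr fun p => ?_
    simp only [Function.comp_apply, kern, ← Complex.ofReal_mul, Complex.ofReal_re, hf,
      Function.uncurry]
    ring
  have hint : Integrable (Function.uncurry f)
      ((volume.restrict (Ioc 0 (2 * Real.pi))).prod volume) := by
    have h1 : IntegrableOn (Function.uncurry f)
        (Icc 0 (2 * Real.pi) ×ˢ Metric.closedBall (0 : Fin n → ℂ) (bump n k).rOut)
        (volume.prod volume) :=
      hfc.continuousOn.integrableOn_compact (isCompact_Icc.prod (isCompact_closedBall _ _))
    have h2 := h1.of_forall_sdiff_eq_zero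
      (t := Ioc 0 (2 * Real.pi) ×ˢ (univ : Set (Fin n → ℂ)))
      (measurableSet_Ioc.prod MeasurableSet.univ) fun p hp => by
        have : ¬ ‖p.2‖ ≤ (bump n k).rOut := fun h =>
          hp.2 ⟨Ioc_subset_Icc_self hp.1.1, mem_closedBall_zero_iff.2 h⟩
        simp [Function.uncurry, hf, hχ0 _ this]
    rwa [IntegrableOn, ← Measure.prod_restrict, Measure.restrict_univ] at h2
  have hcont0 : Continuous fun y => χ y * ρ (w - y) := by
    have h1 : Continuous fun y => (ρ (w - y) : ℂ) * kern n k y := by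
      refine continuous_mul_of_tsupport_subset
        (h := fun y => (ρ (w - y) : ℂ)) (Ω.isOpen.preimage (continuous_const.sub continuous_id))
        (Complex.continuous_ofReal.comp_continuousOn
          (hρ.comp (continuous_const.sub continuous_id).continuousOn fun p hp => hp))
        continuous_kern fun y hy => hSΩ ?_
      rw [tsupport_kern, mem_closedBall_zero_iff] at hy
      simpa using hmem 0 (by simp) y hy
    refine (Complex.continuous_re.comp h1).congr fun p => ?_
    simp only [Function.comp_apply, kern, ← Complex.ofReal_mul, Complex.ofReal_re]
    ring
  have hint0 : Integrable fun y => χ y * ρ (w - y) :=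
    hcont0.integrable_of_hasCompactSupport ((bump n k).hasCompactSupport_normed.mul_right)
  have hle : ∀ y, χ y * ρ (w - y) * (2 * Real.pi)
      ≤ ∫ θ in Ioc 0 (2 * Real.pi), f θ y := by
    intro y
    simp only [hf]
    rw [integral_const_mul, mul_assoc]
    by_cases hy : ‖y‖ ≤ (bump n k).rOut
    · refine mul_le_mul_of_nonneg_left ?_ ((bump n k).nonneg_normed y)
      have h1 := (hpsh.2 (w - y) v fun t ht => hSΩ (by
        have := hmem t ht y hy
        rwa [add_sub_right_comm] at this)).2
      rw [Real.circleAverage_def, intervalIntegral.integral_of_le Real.two_pi_pos.le,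
        smul_eq_mul, inv_mul_eq_div, le_div_iff₀ Real.two_pi_pos] at h1
      simpa only [add_sub_right_comm] using h1
    · rw [hχ0 y hy, zero_mul, zero_mul]
  rw [intervalIntegral.integral_of_le Real.two_pi_pos.le]
  have e1 : moll k (S.indicator fun y => (ρ y : ℂ)) w = _ :=
    moll_indicator_eq_ofReal (by simpa using hball 0 (by simp))
  have e2 : ∀ θ : ℝ, moll k (S.indicator fun y => (ρ y : ℂ)) (w + circleMap 0 1 θ • v)
      = ((∫ y, f θ y : ℝ) : ℂ) := fun θ => moll_indicator_eq_ofReal (hball _ (hcm θ))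
  simp only [e2]
  rw [integral_complex_ofReal, e1, Complex.ofReal_re, Complex.ofReal_re,
    integral_integral_swap hint, ← integral_mul_const]
  exact integral_mono (hint0.mul_const _) hint.integral_prod_right hle

/-- Mollifications of a plurisubharmonic function have non-negative Levi form. -/
theorem levi_moll_nonneg (hρ : ContinuousOn ρ Ω) (hpsh : Plurisubharmonic Ω ρ)
    (hS : IsCompact S) (hSΩ : S ⊆ Ω) {δ : ℝ} (hδ : 0 < δ) {w : Fin n → ℂ}
    (hw : Metric.closedBall w ((bump n k).rOut + δ) ⊆ S) (η : Fin n → ℂ) :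
    0 ≤ ∑ μ, ∑ ν, wirt (-1) μ (wirt 1 ν (moll k (S.indicator fun y => (ρ y : ℂ)))) w
      * (η μ * (starRingEnd ℂ) (η ν)) := by
  set g := moll k (S.indicator fun y => (ρ y : ℂ)) with hg
  have hgs : ContDiff ℝ 2 g :=
    contDiff_moll 2 (integrable_indicator_ofReal hS (hρ.mono hSΩ)).locallyIntegrable
  -- The Levi form at `w` in direction `η` is `∂²/∂t∂t̄` of the restriction to a complex line. The
  -- line is parametrized by `Fin 1 → ℂ` so that the chain rule above applies.
  set G : (Fin 1 → ℂ) → (Fin n → ℂ) := fun t => w + t 0 • η with hG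
  have hGd : ∀ t, HasFDerivAt G
      ((ContinuousLinearMap.proj (R := ℂ) (φ := fun _ : Fin 1 => ℂ) 0).smulRight η) t := fun t =>
    ((ContinuousLinearMap.proj (R := ℂ) (φ := fun _ : Fin 1 => ℂ) 0).hasFDerivAt.smul_const
      η).const_add w
  have hGdiff : Differentiable ℂ G := fun t => (hGd t).differentiableAt
  have hpd : ∀ μ j t, partialDeriv G μ j t = η μ := by
    intro μ j t
    rw [partialDeriv, (hGd t).fderiv, Subsingleton.elim j 0]
    simp
  have hG0 : G 0 = w := by simp [hG]
  have hchain := wirt_wirt_comp (F := G) (g := g) (z := 0) isOpen_univ hgs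
    hGdiff.differentiableOn (fun μ j => by
      have : partialDeriv G μ j = fun _ => η μ := funext fun t => hpd μ j t
      rw [this]; exact differentiableOn_const _) (mem_univ _) 0 0
  simp only [hpd, hG0] at hchain
  rw [← hchain, Complex.le_def]
  have hGr : ContDiff ℝ 2 G := (contDiff_const.add ((contDiff_apply ℝ ℂ 0).smul contDiff_const))
  have hgG : ContDiff ℝ 2 fun t => g (G t) := hgs.comp hGr
  have hreal : ∀ x, (starRingEnd ℂ) (g x) = g x := by
    intro x
    rw [hg, moll, cv_apply', ← integral_conj]
    refine integral_congr_ae (Eventually.of_forall fun y => ?_)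
    by_cases hy : x - y ∈ S <;> simp [kern, hy]
  refine ⟨?_, (wirt_wirt_im_eq_zero hgG (fun t => hreal _) 0 0).symm⟩
  refine wirt_wirt_re_nonneg_of_subMean hgG ?_
  have hsmall : ∀ᶠ r : ℝ in 𝓝[>] 0, r * ‖η‖ ≤ δ := by
    have : Tendsto (fun r : ℝ => r * ‖η‖) (𝓝[>] 0) (𝓝 0) := by
      have h : Tendsto (fun r : ℝ => r * ‖η‖) (𝓝 0) (𝓝 (0 * ‖η‖)) :=
        tendsto_id.mul_const _
      rw [zero_mul] at h
      exact h.mono_left nhdsWithin_le_nhds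
    exact this.eventually_le_const hδ
  filter_upwards [hsmall, self_mem_nhdsWithin] with r hr hr0
  have hr0 : 0 < r := hr0
  -- The circle of radius `r` in direction `η` is the unit circle in direction `r η`.
  have h := subMean_moll (v := (r : ℂ) • η) hρ hpsh hSΩ (k := k) (w := w) (by
    refine (Metric.closedBall_subset_closedBall ?_).trans hw
    rw [norm_smul, Complex.norm_real, Real.norm_of_nonneg hr0.le]
    gcongr)
  have e : ∀ θ : ℝ, G (Pi.single 0 (circleMap 0 r θ)) = w + circleMap 0 1 θ • ((r : ℂ) • η) := by
    intro θ
    simp only [hG, Pi.single_eq_same, smul_smul, circleMap_zero, Complex.ofReal_one, one_mul]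
    rw [mul_comm]
  simp only [e, hG0]
  exact h

end PlurisubharmonicMollification

/-! ### Pull-back of the mollified Levi forms and passage to the limit -/

section Limits

theorem tendsto_integral_mul_of_eventually_dist_le {X : Type*} [MeasurableSpace X] {μ : Measure X}
    {f : ℕ → X → ℂ} {g ψ : X → ℂ} (hψ : Integrable ψ μ)
    (hf : ∀ k, Integrable (fun x => f k x * ψ x) μ) (hg : Integrable (fun x => g x * ψ x) μ)
    (h : ∀ ε > 0, ∀ᶠ k in atTop, ∀ x, ψ x ≠ 0 → dist (f k x) (g x) ≤ ε) :
    Tendsto (fun k => ∫ x, f k x * ψ x ∂μ) atTop (𝓝 (∫ x, g x * ψ x ∂μ)) := by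
  rw [Metric.tendsto_atTop']
  intro ε hε
  set M := ∫ x, ‖ψ x‖ ∂μ with hM
  have hM0 : 0 ≤ M := integral_nonneg fun x => norm_nonneg _
  obtain ⟨N, hN⟩ := eventually_atTop.1 (h (ε / (M + 1)) (by positivity))
  refine ⟨N, fun k hk => ?_⟩
  rw [dist_eq_norm, ← integral_sub (hf k) hg]
  calc ‖∫ x, (f k x * ψ x - g x * ψ x) ∂μ‖ ≤ ∫ x, ε / (M + 1) * ‖ψ x‖ ∂μ := by
        refine norm_integral_le_of_norm_le (hψ.norm.const_mul _) (Eventually.of_forall fun x => ?_)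
        rw [← sub_mul, norm_mul]
        rcases eq_or_ne (ψ x) 0 with h0 | h0
        · simp [h0]
        · gcongr
          rw [← dist_eq_norm]
          exact hN k hk.le x h0
    _ = ε / (M + 1) * M := by rw [integral_const_mul]
    _ < ε := by
        rw [div_mul_eq_mul_div, div_lt_iff₀ (by positivity)]
        nlinarith

end Limits

section Pullback

variable {m n : ℕ} {D : TopologicalSpace.Opens (Fin m → ℂ)}
  {Ω : TopologicalSpace.Opens (Fin n → ℂ)} {F : (Fin m → ℂ) → (Fin n → ℂ)}
  {ρ : (Fin n → ℂ) → ℝ} {b : Fin n → Fin n → (Fin n → ℂ) → ℂ}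

theorem continuousOn_partialDeriv_mul_conj (hhol : DifferentiableOn ℂ F D) (μ ν : Fin n)
    (i j : Fin m) : ContinuousOn
      (fun z => partialDeriv F μ i z * (starRingEnd ℂ) (partialDeriv F ν j z)) D :=
  (differentiableOn_partialDeriv D.isOpen hhol μ i).continuousOn.mul
    (Complex.continuous_conj.comp_continuousOn
      (differentiableOn_partialDeriv D.isOpen hhol ν j).continuousOn)

/-- The mollified coefficients of `dd^c ρ`, pulled back by a holomorphic map `F`, converge to
`dd^c (ρ ∘ F)` in the sense of currents. -/
theorem tendsto_integral_moll_comp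
    (hmaps : MapsTo F D Ω) (hhol : DifferentiableOn ℂ F D) (hρ : ContinuousOn ρ Ω)
    (hddc : HasDDc Ω ρ b) (φ : TestFunction D ℂ ⊤) (i j : Fin m) :
    Tendsto (fun k => ∫ z in D, (∑ μ, ∑ ν, moll k ((Ω : Set (Fin n → ℂ)).indicator (b μ ν)) (F z)
        * (partialDeriv F μ i z * (starRingEnd ℂ) (partialDeriv F ν j z))) * φ z) atTop
      (𝓝 (∫ z in D, (ρ (F z) : ℂ) * wirt (-1) i (wirt 1 j φ) z)) := by
  set K : Set (Fin n → ℂ) := F '' tsupport φ with hK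
  have hKc : IsCompact K :=
    φ.hasCompactSupport.isCompact.image_of_continuousOn
      (hhol.continuousOn.mono φ.tsupport_subset)
  have hKΩ : K ⊆ Ω := by
    rintro _ ⟨z, hz, rfl⟩
    exact hmaps (φ.tsupport_subset hz)
  obtain ⟨δ, hδ, hSΩ⟩ := hKc.exists_cthickening_subset_open Ω.isOpen hKΩ
  set S := Metric.cthickening δ K with hS
  have hSc : IsCompact S := hKc.cthickening
  have hu : ContinuousOn (fun y => (ρ y : ℂ)) S :=
    Complex.continuous_ofReal.comp_continuousOn (hρ.mono hSΩ)
  have hui : LocallyIntegrable (S.indicator fun y => (ρ y : ℂ)) :=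
    (integrable_indicator_ofReal hSc (hρ.mono hSΩ)).locallyIntegrable
  have hFr : ContDiffOn ℝ 2 F D := contDiffOn_real_of_holomorphic D.isOpen hhol 2
  have hgF : ∀ k, ContDiffOn ℝ 2
      (fun z => moll k (S.indicator fun y => (ρ y : ℂ)) (F z)) D := fun k =>
    (contDiff_moll 2 hui).comp_contDiffOn hFr
  set ψ := testWirt (-1) i (testWirt 1 j φ) with hψ
  have hψφ : tsupport ψ ⊆ tsupport φ := tsupport_wirt_subset.trans tsupport_wirt_subset
  have hlim : Tendsto (fun k => ∫ z in D, moll k (S.indicator fun y => (ρ y : ℂ)) (F z) * ψ z)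
      atTop (𝓝 (∫ z in D, (ρ (F z) : ℂ) * ψ z)) := by
    refine tendsto_integral_mul_of_eventually_dist_le
      (ψ.continuous.integrable_of_hasCompactSupport ψ.hasCompactSupport).restrict
      (fun k => (integrable_mul_of_tsupport_subset (hgF k).continuousOn ψ.continuous
        ψ.hasCompactSupport ψ.tsupport_subset).restrict)
      (integrable_mul_of_tsupport_subset (Complex.continuous_ofReal.comp_continuousOn
        (hρ.comp hhol.continuousOn hmaps)) ψ.continuous
        ψ.hasCompactSupport ψ.tsupport_subset).restrict fun ε hε => ?_
    filter_upwards [eventually_dist_moll_le hδ hS hSc hu hε] with k hk z hz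
    exact hk (F z) ⟨z, hψφ (subset_closure hz), rfl⟩
  -- Once the kernels centred on `F(supp φ)` are supported in `S`, two integrations by parts and the
  -- chain rule turn the mollified left-hand side into the pulled-back coefficients.
  refine hlim.congr' ?_
  filter_upwards [eventually_closedBall_subset_cthickening (K := K) hδ] with k hk
  have h2 : ContDiff ℝ 2 φ := φ.contDiff.of_le (WithTop.coe_le_coe.2 (le_top : (2 : ℕ∞) ≤ ⊤))
  rw [hψ, coe_testWirt, coe_testWirt,
    integral_mul_wirt_wirt (hgF k) h2 φ.hasCompactSupport φ.tsupport_subset]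
  refine setIntegral_congr_fun D.isOpen.measurableSet fun z hz => ?_
  by_cases hzs : z ∈ tsupport φ
  · rw [wirt_wirt_comp D.isOpen (contDiff_moll 2 hui) hhol
      (differentiableOn_partialDeriv D.isOpen hhol) hz]
    congr 1
    refine Finset.sum_congr rfl fun μ _ => Finset.sum_congr rfl fun ν _ => ?_
    rw [wirt_wirt_moll hddc hSΩ hui (hk _ ⟨z, hzs, rfl⟩)]
  · simp only [image_eq_zero_of_notMem_tsupport hzs, mul_zero]

/-- The mollified coefficients of `dd^c ρ` are positive semidefinite for plurisubharmonic `ρ`. -/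
theorem eventually_moll_coeff_nonneg (hρ : ContinuousOn ρ Ω) (hpsh : Plurisubharmonic Ω ρ)
    (hddc : HasDDc Ω ρ b) {K : Set (Fin n → ℂ)} (hK : IsCompact K) (hKΩ : K ⊆ Ω) :
    ∀ᶠ k in atTop, ∀ w ∈ K, ∀ η : Fin n → ℂ,
      0 ≤ ∑ μ, ∑ ν, moll k ((Ω : Set (Fin n → ℂ)).indicator (b μ ν)) w
        * (η μ * (starRingEnd ℂ) (η ν)) := by
  obtain ⟨δ, hδ, hSΩ⟩ := hK.exists_cthickening_subset_open Ω.isOpen hKΩ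
  have hSc : IsCompact (Metric.cthickening δ K) := hK.cthickening
  have hui := (integrable_indicator_ofReal hSc (hρ.mono hSΩ)).locallyIntegrable
  -- Half of `δ` is left for the support of the kernel, the other half for the discs in the sub-mean
  -- value inequality.
  filter_upwards [(tendsto_bump_rOut (n := n)).eventually_le_const (half_pos hδ)] with k hk w hw η
  have hball : Metric.closedBall w ((bump n k).rOut + δ / 2) ⊆ Metric.cthickening δ K :=
    (Metric.closedBall_subset_closedBall (by linarith)).trans
      (Metric.closedBall_subset_cthickening hw δ)
  have h := levi_moll_nonneg hρ hpsh hSc hSΩ (half_pos hδ) hball η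
  refine h.trans_eq (Finset.sum_congr rfl fun μ _ => Finset.sum_congr rfl fun ν _ => ?_)
  rw [wirt_wirt_moll hddc hSΩ hui
    ((Metric.closedBall_subset_closedBall (by linarith)).trans hball)]

/-- The mollified forms are semidefinite on `F(supp φ)` for large `k`, and semidefiniteness is
stable under pull-back and limits. Positivity is thus obtained without evaluating `b` on `F(D)`. -/
theorem integral_levi_comp_nonneg
    (hmaps : MapsTo F D Ω) (hhol : DifferentiableOn ℂ F D) (hρ : ContinuousOn ρ Ω)
    (hpsh : Plurisubharmonic Ω ρ) (hddc : HasDDc Ω ρ b)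
    (hb : ∀ μ ν, LocallyIntegrable ((Ω : Set (Fin n → ℂ)).indicator (b μ ν)))
    (φ : TestFunction D ℂ ⊤) (hφ : ∀ z, 0 ≤ φ z) (ξ : Fin m → ℂ) :
    0 ≤ ∑ i, ∑ j, ξ i * (starRingEnd ℂ) (ξ j)
      * ∫ z in D, (ρ (F z) : ℂ) * wirt (-1) i (wirt 1 j φ) z := by
  have hlim := tendsto_finsetSum Finset.univ fun i _ => tendsto_finsetSum Finset.univ fun j _ =>
    (tendsto_integral_moll_comp hmaps hhol hρ hddc φ i j).const_mul
      (ξ i * (starRingEnd ℂ) (ξ j))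
  refine ge_of_tendsto hlim ?_
  have hKc : IsCompact (F '' tsupport φ) :=
    φ.hasCompactSupport.isCompact.image_of_continuousOn
      (hhol.continuousOn.mono φ.tsupport_subset)
  have hKΩ : F '' tsupport φ ⊆ Ω := by
    rintro _ ⟨z, hz, rfl⟩
    exact hmaps (φ.tsupport_subset hz)
  filter_upwards [eventually_moll_coeff_nonneg hρ hpsh hddc hKc hKΩ] with k hk
  have hint : ∀ i j, Integrable (fun z => (∑ μ, ∑ ν,
      moll k ((Ω : Set (Fin n → ℂ)).indicator (b μ ν)) (F z)
        * (partialDeriv F μ i z * (starRingEnd ℂ) (partialDeriv F ν j z))) * φ z)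
      (volume.restrict D) := fun i j => by
    refine (integrable_mul_of_tsupport_subset ?_ φ.continuous φ.hasCompactSupport
      φ.tsupport_subset).restrict
    exact continuousOn_finsetSum _ fun μ _ => continuousOn_finsetSum _ fun ν _ =>
      ((contDiff_moll 0 (hb μ ν)).continuous.comp_continuousOn hhol.continuousOn).mul
        (continuousOn_partialDeriv_mul_conj hhol μ ν i j)
  simp only [← integral_const_mul]
  simp only [← integral_finsetSum _ fun j _ => (hint _ j).const_mul _]
  rw [← integral_finsetSum _ fun i _ => integrable_finsetSum _ fun j _ => (hint i j).const_mul _]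
  refine integral_nonneg_of_ae ((ae_restrict_iff' D.isOpen.measurableSet).2
    (Eventually.of_forall fun z hz => ?_))
  simp only [Pi.zero_apply]
  by_cases hzs : z ∈ tsupport φ
  -- The vector is the image of `ξ` under the differential of `F`.
  · have h := hk (F z) ⟨z, hzs, rfl⟩ fun μ => ∑ i, ξ i * partialDeriv F μ i z
    refine (mul_nonneg h (hφ z)).trans_eq ?_
    simp only [map_sum, map_mul, Finset.mul_sum, Finset.sum_mul]
    rw [Finset.sum_congr rfl fun μ _ => Finset.sum_comm]
    rw [Finset.sum_comm]
    conv_rhs => rw [Finset.sum_comm]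
    refine Finset.sum_congr rfl fun i _ => ?_
    rw [Finset.sum_congr rfl fun μ _ => Finset.sum_comm]
    rw [Finset.sum_comm]
    refine Finset.sum_congr rfl fun j _ => Finset.sum_congr rfl fun μ _ =>
      Finset.sum_congr rfl fun ν _ => ?_
    ring
  · simp [image_eq_zero_of_notMem_tsupport hzs]

/-- A function that is non-negative as a distribution is non-negative almost everywhere. -/
theorem ae_nonneg_of_forall_testFunction {U : TopologicalSpace.Opens (Fin m → ℂ)}
    {c : (Fin m → ℂ) → ℂ} (hc : IntegrableOn c U)
    (h : ∀ φ : TestFunction U ℂ ⊤, (∀ z, 0 ≤ φ z) → 0 ≤ ∫ z in U, c z * φ z) :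
    ∀ᵐ z ∂volume.restrict (U : Set (Fin m → ℂ)), 0 ≤ c z := by
  have hU := U.isOpen.measurableSet
  have hae := ae_tendsto_moll (hc.integrable_indicator hU).locallyIntegrable
  refine (ae_restrict_iff' hU).2 ?_
  filter_upwards [hae] with z hz hzU
  rw [indicator_of_mem hzU] at hz
  refine ge_of_tendsto hz ?_
  obtain ⟨r, hr, hrU⟩ := Metric.nhds_basis_closedBall.mem_iff.1 (U.isOpen.mem_nhds hzU)
  filter_upwards [(tendsto_bump_rOut (n := m)).eventually_le_const hr] with k hk
  have hb : Metric.closedBall z (bump m k).rOut ⊆ U :=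
    (Metric.closedBall_subset_closedBall hk).trans hrU
  refine (h (testKern k z hb) fun y => ?_).trans_eq ?_
  · simp only [coe_testKern, kern]
    exact_mod_cast (bump m k).nonneg_normed _
  · rw [moll, cv_apply, ← integral_indicator hU, coe_testKern]
    refine integral_congr_ae (Eventually.of_forall fun y => ?_)
    by_cases hy : y ∈ (U : Set (Fin m → ℂ))
    · simp only [indicator_of_mem hy]; ring
    · simp only [indicator_of_notMem hy]; ring

end Pullback

/-! ### Precise representatives and part (a) -/

section PreciseRepresentatives

variable {m n : ℕ} {D : TopologicalSpace.Opens (Fin m → ℂ)}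
  {Ω : TopologicalSpace.Opens (Fin n → ℂ)}

theorem ae_norm_indicator_le {b : (Fin n → ℂ) → ℂ} (hb : MemLp b ∞ (volume.restrict Ω)) :
    ∀ᵐ y, ‖(Ω : Set (Fin n → ℂ)).indicator b y‖ ≤ (eLpNorm b ∞ (volume.restrict Ω)).toReal := by
  have h := ae_le_eLpNormEssSup (f := b) (μ := volume.restrict (Ω : Set (Fin n → ℂ)))
  filter_upwards [(ae_restrict_iff' Ω.isOpen.measurableSet).1 h] with y hy
  by_cases hyΩ : y ∈ (Ω : Set (Fin n → ℂ))
  · rw [indicator_of_mem hyΩ, ← toReal_enorm, eLpNorm_exponent_top]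
    refine ENNReal.toReal_mono ?_ (hy hyΩ)
    rw [← eLpNorm_exponent_top]
    exact hb.2.ne
  · rw [indicator_of_notMem hyΩ, norm_zero]
    exact ENNReal.toReal_nonneg

theorem locallyIntegrable_indicator {b : (Fin n → ℂ) → ℂ}
    (hb : MemLp b ∞ (volume.restrict Ω)) :
    LocallyIntegrable ((Ω : Set (Fin n → ℂ)).indicator b) :=
  ((memLp_indicator_iff_restrict Ω.isOpen.measurableSet).2 hb).locallyIntegrable le_top

/-- Limits of mollifications suffice: they exist and equal `b` almost everywhere, and they exist
with the same value wherever the polydisc averages converge. -/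
theorem isPreciseRepr_of_moll {b h : (Fin n → ℂ) → ℂ} (hb : MemLp b ∞ (volume.restrict Ω))
    (hm : Measurable h) (hC : ∀ y, ‖h y‖ ≤ (eLpNorm b ∞ (volume.restrict Ω)).toReal)
    (hl : ∀ y L, Tendsto (fun k => moll k ((Ω : Set (Fin n → ℂ)).indicator b) y) atTop (𝓝 L) →
      h y = L) : IsPreciseRepr Ω b h := by
  have hbi := locallyIntegrable_indicator hb
  refine ⟨hm, ?_, fun w _ => ?_, fun w hw L hL => ?_⟩
  · refine (ae_restrict_iff' Ω.isOpen.measurableSet).2 ?_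
    filter_upwards [ae_tendsto_moll hbi] with y hy hyΩ
    rw [hl y _ hy, indicator_of_mem hyΩ]
  · rw [← ofReal_norm, ← ENNReal.ofReal_toReal hb.2.ne]
    exact ENNReal.ofReal_le_ofReal (hC w)
  · refine hl w L (tendsto_moll_of_tendsto_average hbi (ae_norm_indicator_le hb) ?_)
    refine hL.congr' ?_
    obtain ⟨r, hr, hrΩ⟩ := Metric.isOpen_iff.1 Ω.isOpen w hw
    filter_upwards [Ioo_mem_nhdsGT hr] with ε hε
    rw [setAverage_eq, setAverage_eq]
    congr 1
    refine setIntegral_congr_fun Metric.isOpen_ball.measurableSet fun x hx => ?_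
    rw [indicator_of_mem (hrΩ (Metric.ball_subset_ball hε.2.le hx))]

theorem locallyIntegrableOn_sum {ι : Type*} [Fintype ι] {U : Set (Fin m → ℂ)}
    {f : ι → (Fin m → ℂ) → ℂ} (h : ∀ i, LocallyIntegrableOn (f i) U) :
    LocallyIntegrableOn (fun z => ∑ i, f i z) U := by
  intro x hx
  choose t ht hti using fun i => h i x hx
  refine ⟨⋂ i, t i, iInter_mem.2 ht, ?_⟩
  exact integrable_finsetSum _ fun i _ => (hti i).mono_set (iInter_subset t i)

theorem exists_preciseRepr_hasDDc_comp {F : (Fin m → ℂ) → (Fin n → ℂ)}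
    {ρ : (Fin n → ℂ) → ℝ} {b : Fin n → Fin n → (Fin n → ℂ) → ℂ}
    (hDbdd : Bornology.IsBounded (D : Set (Fin m → ℂ)))
    (hmaps : MapsTo F D Ω) (hhol : DifferentiableOn ℂ F D) (hρ : ContinuousOn ρ Ω)
    (hb : ∀ μ ν, MemLp (b μ ν) ∞ (volume.restrict (Ω : Set (Fin n → ℂ))))
    (hddc : HasDDc Ω ρ b) :
    ∃ b' : Fin n → Fin n → (Fin n → ℂ) → ℂ,
      (∀ μ ν, IsPreciseRepr Ω (b μ ν) (b' μ ν)) ∧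
      HasDDc D (fun z => ρ (F z)) (fun j k z =>
        ∑ μ, ∑ ν, b' μ ν (F z) *
          (partialDeriv F μ j z * (starRingEnd ℂ) (partialDeriv F ν k z))) := by
  classical
  have hDm := D.isOpen.measurableSet
  have hfin : IsFiniteMeasure (volume.restrict (D : Set (Fin m → ℂ))) :=
    ⟨by rw [Measure.restrict_apply_univ]; exact hDbdd.measure_lt_top⟩
  -- `F` is controlled only on `D`; extending it by a constant makes it Borel on the whole space, as
  -- the push-forward requires.
  set F' : (Fin m → ℂ) → (Fin n → ℂ) := (D : Set (Fin m → ℂ)).piecewise F fun _ => 0 with hF'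
  have hF'm : Measurable F' :=
    hhol.continuousOn.measurable_piecewise continuousOn_const hDm
  have hF'D : ∀ z ∈ D, F' z = F z := fun z hz => piecewise_eq_of_mem _ _ _ hz
  set C : Fin n → Fin n → ℝ := fun μ ν => (eLpNorm (b μ ν) ∞ (volume.restrict Ω)).toReal with hC
  have hbi := fun μ ν => locallyIntegrable_indicator (hb μ ν)
  have hcont : ∀ μ ν k, Continuous (moll k ((Ω : Set (Fin n → ℂ)).indicator (b μ ν))) :=
    fun μ ν k => (contDiff_moll 0 (hbi μ ν)).continuous
  -- One ultrafilter serves all pairs `(μ, ν)`, so the limits can be summed.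
  choose h hm hhC hl hw using fun μ ν => exists_weak_limit_comp_of_bound
    (μ := volume.restrict (D : Set (Fin m → ℂ))) hF'm
    (fun k => moll k ((Ω : Set (Fin n → ℂ)).indicator (b μ ν))) (C := C μ ν)
    (fun k => (hcont μ ν k).measurable) (fun k => norm_moll_le (ae_norm_indicator_le (hb μ ν)))
    (𝒰 := hyperfilter ℕ) Nat.hyperfilter_le_atTop
  refine ⟨h, fun μ ν => isPreciseRepr_of_moll (hb μ ν) (hm μ ν) (hhC μ ν) (hl μ ν),
    fun i j => ⟨?_, fun φ => ?_⟩⟩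
  · have hterm : ∀ μ ν, LocallyIntegrableOn (fun z => h μ ν (F z) *
        (partialDeriv F μ i z * (starRingEnd ℂ) (partialDeriv F ν j z))) D := by
      intro μ ν
      refine (locallyIntegrableOn_iff D.isOpen.isLocallyClosed).2 fun K hKD hK => ?_
      have h1 : IntegrableOn (fun z => partialDeriv F μ i z *
          (starRingEnd ℂ) (partialDeriv F ν j z)) K :=
        ((continuousOn_partialDeriv_mul_conj hhol μ ν i j).mono hKD).integrableOn_compact hK
      have h2 : IntegrableOn (fun z => h μ ν (F' z) * (partialDeriv F μ i z *
          (starRingEnd ℂ) (partialDeriv F ν j z))) K :=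
        h1.bdd_mul ((hm μ ν).comp hF'm).aestronglyMeasurable
          (Eventually.of_forall fun z => hhC μ ν _)
      refine h2.congr_fun (fun z hz => ?_) hK.measurableSet
      simp only [hF'D z (hKD hz)]
    exact locallyIntegrableOn_sum fun μ => locallyIntegrableOn_sum fun ν => hterm μ ν
  · rw [dz_eq_wirt, dzbar_eq_wirt]
    set ψ : Fin n → Fin n → (Fin m → ℂ) → ℂ := fun μ ν z =>
      partialDeriv F μ i z * (starRingEnd ℂ) (partialDeriv F ν j z) * φ z with hψ
    have hψc : ∀ μ ν, Continuous (ψ μ ν) := fun μ ν =>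
      continuous_mul_of_tsupport_subset D.isOpen (continuousOn_partialDeriv_mul_conj hhol μ ν i j)
        φ.continuous φ.tsupport_subset
    have hψs : ∀ μ ν, HasCompactSupport (ψ μ ν) := fun μ ν => φ.hasCompactSupport.mul_left
    have hlim := (tendsto_integral_moll_comp hmaps hhol hρ hddc φ i j).mono_left
      Nat.hyperfilter_le_atTop
    -- The same integrals converge to the pairing with `dd^c (ρ ∘ F)` and, by weak convergence, to
    -- the pairing with the form given by `h`.
    refine tendsto_nhds_unique hlim ?_
    have hsplit : ∀ c : Fin n → Fin n → (Fin n → ℂ) → ℂ, (∀ μ ν, Measurable (c μ ν)) →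
        (∀ μ ν y, ‖c μ ν y‖ ≤ C μ ν) →
        ∫ z in D, (∑ μ, ∑ ν, c μ ν (F z) * (partialDeriv F μ i z *
          (starRingEnd ℂ) (partialDeriv F ν j z))) * φ z
        = ∑ μ, ∑ ν, ∫ z in D, c μ ν (F' z) * ψ μ ν z := by
      intro c hcm hcC
      have hint : ∀ μ ν, Integrable (fun z => c μ ν (F' z) * ψ μ ν z) (volume.restrict D) :=
        fun μ ν => Integrable.bdd_mul
          ((hψc μ ν).integrable_of_hasCompactSupport (hψs μ ν)).restrict
          ((hcm μ ν).comp hF'm).aestronglyMeasurable (Eventually.of_forall fun z => hcC μ ν _)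
      simp only [← integral_finsetSum _ fun ν _ => hint _ ν]
      rw [← integral_finsetSum _ fun μ _ => integrable_finsetSum _ fun ν _ => hint μ ν]
      refine setIntegral_congr_fun hDm fun z hz => ?_
      simp only [hF'D z hz, Finset.sum_mul, hψ]
      exact Finset.sum_congr rfl fun μ _ => Finset.sum_congr rfl fun ν _ => by ring
    rw [hsplit h hm hhC]
    refine Tendsto.congr (fun k => (hsplit
      (fun μ ν => moll k ((Ω : Set (Fin n → ℂ)).indicator (b μ ν)))
      (fun μ ν => (hcont μ ν k).measurable)
      fun μ ν => norm_moll_le (ae_norm_indicator_le (hb μ ν))).symm) ?_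
    exact tendsto_finsetSum _ fun μ _ => tendsto_finsetSum _ fun ν _ =>
      hw μ ν (ψ μ ν) (((hψc μ ν).memLp_of_hasCompactSupport (hψs μ ν)).restrict _)

end PreciseRepresentatives

/-! ### Weak convergence of mollifications in `L^p` -/

section LpTranslation

variable {n : ℕ} {a g : (Fin n → ℂ) → ℂ} {p q : ℝ≥0∞}

/-- Translations are continuous in `L^p` for finite `p`. -/
theorem tendsto_eLpNorm_translate_sub (hp1 : 1 ≤ p) (hp : p ≠ ∞) (ha : MemLp a p) :
    Tendsto (fun y : Fin n → ℂ => eLpNorm ((fun x => a (x - y)) - a) p) (𝓝 0) (𝓝 0) := by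
  have : Fact (1 ≤ p) := ⟨hp1⟩
  set T : (Fin n → ℂ) → C(Fin n → ℂ, Fin n → ℂ) := fun y => ⟨fun x => x - y, by fun_prop⟩ with hT
  have hTc : Continuous T :=
    (ContinuousMap.curry (⟨fun q : (Fin n → ℂ) × (Fin n → ℂ) => q.2 - q.1, by fun_prop⟩ :
      C((Fin n → ℂ) × (Fin n → ℂ), Fin n → ℂ))).continuous
  have hTm : ∀ y, MeasurePreserving (T y) volume volume := fun y =>
    measurePreserving_sub_right volume y
  have h := (tendsto_const_nhds (x := ha.toLp a)).compMeasurePreservingLp (hTc.tendsto 0)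
    hTm (hTm 0) hp
  have h0 : ∀ y, Lp.compMeasurePreserving (T y) (hTm y) (ha.toLp a)
      = (ha.comp_measurePreserving (hTm y)).toLp (a ∘ T y) := fun y =>
    Lp.toLp_compMeasurePreserving ha (hTm y)
  simp only [h0] at h
  have h2 := (Lp.tendsto_Lp_iff_tendsto_eLpNorm'' _ _ _ _).1 h
  have e : a ∘ T 0 = a := by funext x; simp [hT]
  rw [e] at h2
  exact h2

theorem lintegral_enorm_mul_le {X : Type*} [MeasurableSpace X] {μ : Measure X} {f h : X → ℂ}
    (p q : ℝ≥0∞) [p.HolderTriple q 1] (hf : AEStronglyMeasurable f μ)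
    (hh : AEStronglyMeasurable h μ) :
    ∫⁻ x, ‖f x * h x‖ₑ ∂μ ≤ eLpNorm f p μ * eLpNorm h q μ := by
  have h1 := eLpNorm_smul_le_mul_eLpNorm (p := p) (q := q) (r := 1) hh hf
  rw [eLpNorm_one_eq_lintegral_enorm] at h1
  exact h1

/-- Mollifications of a function in `L^p` converge weakly. -/
theorem tendsto_integral_moll_mul [p.HolderTriple q 1] (hp1 : 1 ≤ p) (hp : p ≠ ∞)
    (ha : MemLp a p) (hg : MemLp g q) :
    Tendsto (fun k => ∫ x, moll k a x * g x) atTop (𝓝 (∫ x, a x * g x)) := by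
  have htr : ∀ y : Fin n → ℂ, MemLp (fun x => a (x - y)) p := fun y =>
    ha.comp_measurePreserving (measurePreserving_sub_right volume y)
  have hnorm : ∀ y : Fin n → ℂ, eLpNorm (fun x => a (x - y)) p = eLpNorm a p := fun y =>
    eLpNorm_comp_measurePreserving ha.1 (measurePreserving_sub_right volume y)
  -- By Fubini the pairing equals `∫ χ_k G`, which tends to `G 0` as soon as `G` is continuous at
  -- `0`; that follows from continuity of translations in `L^p`, hence the need for `p ≠ ∞`.
  set G : (Fin n → ℂ) → ℂ := fun y => ∫ x, a (x - y) * g x with hG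
  have hG0 : G 0 = ∫ x, a x * g x := by simp [hG]
  have hmeas : ∀ k, AEStronglyMeasurable
      (fun z : (Fin n → ℂ) × (Fin n → ℂ) => kern n k z.2 * (a (z.1 - z.2) * g z.1))
      (volume.prod volume) := fun k =>
    (continuous_kern.comp continuous_snd).aestronglyMeasurable.mul
      ((ha.1.comp_quasiMeasurePreserving
        (quasiMeasurePreserving_sub_of_right_invariant volume volume)).mul
        (hg.1.comp_quasiMeasurePreserving Measure.quasiMeasurePreserving_fst))
  have hint : ∀ k, Integrable
      (fun z : (Fin n → ℂ) × (Fin n → ℂ) => kern n k z.2 * (a (z.1 - z.2) * g z.1))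
      (volume.prod volume) := by
    intro k
    refine ⟨hmeas k, ?_⟩
    rw [HasFiniteIntegral, lintegral_prod_symm _ (hmeas k).enorm]
    calc ∫⁻ y, ∫⁻ x, ‖kern n k y * (a (x - y) * g x)‖ₑ
        ≤ ∫⁻ y, ‖kern n k y‖ₑ * (eLpNorm a p * eLpNorm g q) := by
          refine lintegral_mono fun y => ?_
          simp only [enorm_mul (kern n k y)]
          rw [lintegral_const_mul' _ _ enorm_ne_top]
          gcongr
          rw [← hnorm y]
          exact lintegral_enorm_mul_le p q (htr y).1 hg.1
      _ < ∞ := by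
          rw [lintegral_mul_const' _ _ (ENNReal.mul_ne_top ha.2.ne hg.2.ne)]
          exact ENNReal.mul_lt_top integrable_kern.2 (ENNReal.mul_lt_top ha.2 hg.2)
  have hswap : ∀ k, ∫ x, moll k a x * g x = ∫ y, kern n k y * G y := by
    intro k
    have h1 : ∀ x, moll k a x * g x = ∫ y, kern n k y * (a (x - y) * g x) := fun x => by
      rw [moll, cv_apply', ← integral_mul_const]
      exact integral_congr_ae (Eventually.of_forall fun y => by simp only; ring)
    simp only [h1]
    rw [integral_integral_swap (hint k)]
    exact integral_congr_ae (Eventually.of_forall fun y => by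
      simp only [hG]; rw [integral_const_mul])
  have hGi : ∀ k, Integrable fun y => kern n k y * G y := by
    intro k
    refine (hint k).integral_prod_right.congr (Eventually.of_forall fun y => ?_)
    simp only [hG]; rw [integral_const_mul]
  have hGc : Tendsto G (𝓝 0) (𝓝 (G 0)) := by
    have hag : Integrable fun x => a x * g x := by
      refine memLp_one_iff_integrable.1 (hg.mul ha)
    have hyg : ∀ y, Integrable fun x => a (x - y) * g x := fun y =>
      memLp_one_iff_integrable.1 (hg.mul (htr y))
    rw [tendsto_iff_edist_tendsto_0]
    have hle : ∀ y, edist (G y) (G 0)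
        ≤ eLpNorm ((fun x => a (x - y)) - a) p * eLpNorm g q := by
      intro y
      rw [edist_eq_enorm_sub, hG0, ← integral_sub (hyg y) hag]
      refine (enorm_integral_le_lintegral_enorm _).trans ?_
      refine le_of_eq_of_le ?_ (lintegral_enorm_mul_le p q ((htr y).sub ha).1 hg.1)
      refine lintegral_congr fun x => ?_
      rw [Pi.sub_apply, sub_mul]
    refine tendsto_of_tendsto_of_tendsto_of_le_of_le tendsto_const_nhds ?_ (fun y => zero_le)
      hle
    have := ENNReal.Tendsto.mul_const (tendsto_eLpNorm_translate_sub hp1 hp ha)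
      (Or.inr hg.eLpNorm_ne_top)
    simpa using this
  simp only [hswap]
  rw [← hG0, Metric.tendsto_nhds]
  intro ε hε
  obtain ⟨δ, hδ, hball⟩ := Metric.eventually_nhds_iff_ball.1
    (Metric.tendsto_nhds.1 hGc (ε / 2) (half_pos hε))
  filter_upwards [(tendsto_bump_rOut (n := n)).eventually_lt_const hδ] with k hk
  have h1 : G 0 = ∫ y, kern n k y * G 0 := by
    have : ∫ y, kern n k y = 1 := by
      simp only [kern]
      rw [integral_complex_ofReal, (bump n k).integral_normed, Complex.ofReal_one]
    rw [integral_mul_const, this, one_mul]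
  have h2 : dist (∫ y, kern n k y * G y) (G 0) ≤ ε / 2 := by
    conv_lhs => rw [h1]
    rw [dist_eq_norm, ← integral_sub (hGi k) (integrable_kern.mul_const _)]
    calc _ ≤ ∫ y, ‖kern n k y‖ * (ε / 2) := by
          refine norm_integral_le_of_norm_le (integrable_kern.norm.mul_const _)
            (Eventually.of_forall fun y => ?_)
          rw [← mul_sub, norm_mul]
          by_cases hy : y ∈ Metric.ball (0 : Fin n → ℂ) δ
          · gcongr
            rw [← dist_eq_norm]
            exact (hball y hy).le
          · have h0 : kern n k y = 0 := by
              refine image_eq_zero_of_notMem_tsupport fun hmem => hy ?_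
              rw [tsupport_kern] at hmem
              exact Metric.closedBall_subset_ball hk hmem
            simp [h0]
      _ = ε / 2 := by rw [integral_mul_const, integral_norm_kern, one_mul]
  linarith

end LpTranslation

/-! ### The top power of a form as a determinant -/

section Determinant

variable {m : ℕ}

/-- Multilinear expansion of the determinant, with each row written in the standard basis. -/
theorem det_submatrix_eq_sum (A : Matrix (Fin m) (Fin m) ℂ) :
    A.det = ∑ K : Fin m → Fin m, (∏ i, A i (K i)) *
      ((1 : Matrix (Fin m) (Fin m) ℂ).submatrix K id).det := by
  have hA : A = fun i => ∑ k, A i k • (1 : Matrix (Fin m) (Fin m) ℂ) k := by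
    ext i j
    simp [Finset.sum_apply, Matrix.one_apply]
  have h := (Matrix.detRowAlternating (n := Fin m) (R := ℂ)).toMultilinearMap.map_sum
    (fun i k => A i k • (1 : Matrix (Fin m) (Fin m) ℂ) k)
  have h1 : A.det = (Matrix.detRowAlternating (n := Fin m) (R := ℂ)).toMultilinearMap
      fun i => ∑ k, A i k • (1 : Matrix (Fin m) (Fin m) ℂ) k := congrArg Matrix.det hA
  rw [h1, h]
  refine Finset.sum_congr rfl fun K _ => ?_
  rw [MultilinearMap.map_smul_univ, smul_eq_mul]
  rfl

/-- The sum of the coefficients of `(i/2 ∑ A_{jk} dz_j ∧ dz̄_k)^m` with respect to the volume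
form. -/
theorem sum_topCoeff_mul_prod (A : Matrix (Fin m) (Fin m) ℂ) :
    ∑ e : Fin m → Fin m × Fin m, topCoeff e * ∏ i, A (e i).1 (e i).2
      = (∑ J : Fin m → Fin m, ((1 : Matrix (Fin m) (Fin m) ℂ).submatrix J id).det ^ 2)
        * A.det := by
  rw [← (Equiv.arrowProdEquivProdArrow (Fin m) (fun _ => Fin m) (fun _ => Fin m)).symm.sum_comp,
    Fintype.sum_prod_type, Finset.sum_mul]
  refine Finset.sum_congr rfl fun J _ => ?_
  -- The sum over `K` reassembles the determinant of `A` with rows selected by `J`. It vanishes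
  -- unless `J` is a permutation, so the constant in the statement is `m!`; only its sign matters
  -- later.
  have h1 : (A.submatrix J id).det = ((1 : Matrix (Fin m) (Fin m) ℂ).submatrix J id).det * A.det := by
    rw [← Matrix.det_mul]
    congr 1
    ext i j
    simp [Matrix.mul_apply, Matrix.one_apply]
  rw [pow_two, mul_assoc, ← h1, det_submatrix_eq_sum (A.submatrix J id), Finset.mul_sum]
  refine Finset.sum_congr rfl fun K _ => ?_
  simp only [topCoeff, Equiv.arrowProdEquivProdArrow, Equiv.coe_fn_symm_mk, Matrix.submatrix_apply,
    id]
  ring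

/-- Over `ℂ` hermitian symmetry comes for free, since a sesquilinear form with real diagonal values
is hermitian. The indices here are conjugate to the usual convention, so `star x` is inserted. -/
theorem posSemidef_of_forall_nonneg (A : Matrix (Fin m) (Fin m) ℂ)
    (h : ∀ ξ : Fin m → ℂ, 0 ≤ ∑ i, ∑ j, ξ i * (starRingEnd ℂ) (ξ j) * A i j) :
    A.PosSemidef := by
  have h2 : ∀ x, 0 ≤ star x ⬝ᵥ (A.mulVec x) := fun x => by
    refine (h (star x)).trans_eq ?_
    simp only [dotProduct, Matrix.mulVec, Finset.mul_sum, Pi.star_apply, Complex.star_def,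
      Complex.conj_conj]
    exact Finset.sum_congr rfl fun i _ => Finset.sum_congr rfl fun j _ => by ring
  rw [← Matrix.isPositive_toEuclideanLin_iff, LinearMap.isPositive_iff_complex]
  intro x
  have h3 : 0 ≤ inner ℂ x (Matrix.toEuclideanLin A x) := by
    rw [EuclideanSpace.inner_eq_star_dotProduct, Matrix.ofLp_toLpLin, Matrix.toLin'_apply,
      dotProduct_comm]
    exact h2 x.ofLp
  rw [← inner_conj_symm]
  generalize inner ℂ x (Matrix.toEuclideanLin A x) = c at h3
  have h4 := Complex.le_def.1 h3
  refine ⟨?_, by simpa using h4.1⟩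
  apply Complex.ext
  · simp
  · simpa using h4.2.symm

theorem sum_topCoeff_mul_prod_nonneg (A : Matrix (Fin m) (Fin m) ℂ)
    (h : ∀ ξ : Fin m → ℂ, 0 ≤ ∑ i, ∑ j, ξ i * (starRingEnd ℂ) (ξ j) * A i j) :
    0 ≤ ∑ e : Fin m → Fin m × Fin m, topCoeff e * ∏ i, A (e i).1 (e i).2 := by
  rw [sum_topCoeff_mul_prod]
  refine mul_nonneg (Finset.sum_nonneg fun J _ => ?_)
    (posSemidef_of_forall_nonneg A h).det_nonneg
  have hr : ((1 : Matrix (Fin m) (Fin m) ℂ).submatrix J id).det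
      = ((((1 : Matrix (Fin m) (Fin m) ℝ).submatrix J id).det : ℝ) : ℂ) := by
    have := RingHom.map_det Complex.ofRealHom ((1 : Matrix (Fin m) (Fin m) ℝ).submatrix J id)
    rw [Complex.ofRealHom_eq_coe] at this
    rw [this]
    congr 1
    ext i j
    simp [Matrix.one_apply]
  rw [hr]
  rw [← Complex.ofReal_pow]
  exact Complex.zero_le_real.2 (sq_nonneg _)

end Determinant

/-! ### Wedge products of `dd^c u` with closed currents -/

section ClosedCurrents

variable {m : ℕ} {D : TopologicalSpace.Opens (Fin m → ℂ)}
  {d : Fin m → Fin m → (Fin m → ℂ) → ℂ}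

/-- The product of a smooth function and a test function. -/
def testMul (v : (Fin m → ℂ) → ℂ) (hv : ContDiff ℝ (⊤ : ℕ∞) v) (φ : TestFunction D ℂ ⊤) :
    TestFunction D ℂ ⊤ where
  toFun z := v z * φ z
  contDiff' := hv.mul φ.contDiff
  hasCompactSupport' := φ.hasCompactSupport.mul_left
  tsupport_subset' := (tsupport_mul_subset_right (f := v)).trans φ.tsupport_subset

theorem coe_testMul (v : (Fin m → ℂ) → ℂ) (hv : ContDiff ℝ (⊤ : ℕ∞) v)
    (φ : TestFunction D ℂ ⊤) : ⇑(testMul v hv φ) = fun z => v z * φ z := rfl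

theorem integrable_testFunction_mul {f : (Fin m → ℂ) → ℂ} (hf : IntegrableOn f D)
    (φ : TestFunction D ℂ ⊤) : Integrable (fun z => φ z * f z) (volume.restrict D) := by
  obtain ⟨C, hC⟩ := φ.hasCompactSupport.exists_bound_of_continuous φ.continuous
  exact hf.bdd_mul φ.continuous.aestronglyMeasurable (Eventually.of_forall hC)

/-- Integration by parts for `dd^c` against a closed current with integrable coefficients. -/
theorem sum_integral_mul_wirt_wirt_comm (hd : ∀ j l, IntegrableOn (d j l) D)
    (h1 : ∀ (ψ : TestFunction D ℂ ⊤) l, ∑ j, ∫ z in D, wirt (-1) j ψ z * d j l z = 0)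
    (h2 : ∀ (ψ : TestFunction D ℂ ⊤) j, ∑ l, ∫ z in D, wirt 1 l ψ z * d j l z = 0)
    {v : (Fin m → ℂ) → ℂ} (hv : ContDiff ℝ (⊤ : ℕ∞) v) (φ : TestFunction D ℂ ⊤) :
    ∑ j, ∑ l, ∫ z in D, v z * wirt (-1) j (wirt 1 l φ) z * d j l z
      = ∑ j, ∑ l, ∫ z in D, φ z * wirt (-1) j (wirt 1 l v) z * d j l z := by
  have hv2 : ContDiff ℝ 2 v := hv.of_le (WithTop.coe_le_coe.2 (le_top : (2 : ℕ∞) ≤ ⊤))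
  have hφ2 : ContDiff ℝ 2 φ :=
    φ.contDiff.of_le (WithTop.coe_le_coe.2 (le_top : (2 : ℕ∞) ≤ ⊤))
  have hvw : ∀ j, ContDiff ℝ (⊤ : ℕ∞) (wirt (-1) j v) := fun j => contDiff_wirt hv (by rfl)
  have hvww : ∀ j l, ContDiff ℝ (⊤ : ℕ∞) (wirt (-1) j (wirt 1 l v)) := fun j l =>
    contDiff_wirt (n := (⊤ : ℕ∞)) (contDiff_wirt (n := (⊤ : ℕ∞)) hv (by rfl)) (by rfl)
  -- With `A_l = v ∂φ/∂z̄_l` and `B_j = φ ∂v/∂z_j`, the difference of the two integrands is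
  -- `∂A_l/∂z_j - ∂B_j/∂z̄_l` times `d_{jl}`, and closedness annihilates both sums.
  set A : Fin m → TestFunction D ℂ ⊤ := fun l => testMul v hv (testWirt 1 l φ) with hA
  set B : Fin m → TestFunction D ℂ ⊤ := fun j => testMul (wirt (-1) j v) (hvw j) φ with hB
  have e : ∀ j l z, v z * wirt (-1) j (wirt 1 l φ) z * d j l z
      - φ z * wirt (-1) j (wirt 1 l v) z * d j l z
      = wirt (-1) j (A l) z * d j l z - wirt 1 l (B j) z * d j l z := by
    intro j l z
    have e1 : wirt (-1) j (A l) z = wirt (-1) j v z * wirt 1 l φ z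
        + v z * wirt (-1) j (wirt 1 l φ) z :=
      wirt_mul (hv2.differentiable (by norm_num) z) (differentiableAt_wirt hφ2.contDiffAt)
    have e2 : wirt 1 l (B j) z = wirt 1 l (wirt (-1) j v) z * φ z
        + wirt (-1) j v z * wirt 1 l φ z :=
      wirt_mul (differentiableAt_wirt hv2.contDiffAt) (hφ2.differentiable (by norm_num) z)
    rw [e1, e2, wirt_comm hv2.contDiffAt]
    ring
  have iA : ∀ j l, Integrable (fun z => wirt (-1) j (A l) z * d j l z) (volume.restrict D) :=
    fun j l => integrable_testFunction_mul (hd j l) (testWirt (-1) j (A l))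
  have iB : ∀ j l, Integrable (fun z => wirt 1 l (B j) z * d j l z) (volume.restrict D) :=
    fun j l => integrable_testFunction_mul (hd j l) (testWirt 1 l (B j))
  have i1 : ∀ j l, Integrable (fun z => v z * wirt (-1) j (wirt 1 l φ) z * d j l z)
      (volume.restrict D) := fun j l =>
    integrable_testFunction_mul (hd j l) (testMul v hv (testWirt (-1) j (testWirt 1 l φ)))
  have i2 : ∀ j l, Integrable (fun z => φ z * wirt (-1) j (wirt 1 l v) z * d j l z)
      (volume.restrict D) := fun j l => by
    have h := integrable_testFunction_mul (hd j l)
      (testMul (wirt (-1) j (wirt 1 l v)) (hvww j l) φ)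
    refine h.congr (Eventually.of_forall fun z => ?_)
    simp only [coe_testMul]
    ring
  rw [← sub_eq_zero]
  simp only [← Finset.sum_sub_distrib, ← integral_sub (i1 _ _) (i2 _ _), e,
    integral_sub (iA _ _) (iB _ _)]
  simp only [Finset.sum_sub_distrib, h2, sub_zero]
  rw [Finset.sum_comm]
  simp only [h1, Finset.sum_const_zero]

/-- For a closed current with coefficients `d` in `L^q` and a continuous function `u` whose `dd^c`
has coefficients in the dual space `L^p`, the current `dd^c (u d)` is the product
`dd^c u ∧ d`. -/
theorem sum_integral_mul_wirt_wirt_eq {p q : ℝ≥0∞} [p.HolderTriple q 1] (hp1 : 1 ≤ p)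
    (hp : p ≠ ∞) (hDbdd : Bornology.IsBounded (D : Set (Fin m → ℂ)))
    {u : (Fin m → ℂ) → ℝ} (hu : ContinuousOn u D) {a : Fin m → Fin m → (Fin m → ℂ) → ℂ}
    (ha : ∀ j l, MemLp (a j l) p (volume.restrict D)) (hddc : HasDDc D u a)
    (hd : ∀ j l, MemLp (d j l) q (volume.restrict D))
    (hdi : ∀ j l, IntegrableOn (d j l) D)
    (h1 : ∀ (ψ : TestFunction D ℂ ⊤) l, ∑ j, ∫ z in D, wirt (-1) j ψ z * d j l z = 0)
    (h2 : ∀ (ψ : TestFunction D ℂ ⊤) j, ∑ l, ∫ z in D, wirt 1 l ψ z * d j l z = 0)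
    (φ : TestFunction D ℂ ⊤) :
    ∑ j, ∑ l, ∫ z in D, (u z : ℂ) * wirt (-1) j (wirt 1 l φ) z * d j l z
      = ∑ j, ∑ l, ∫ z in D, φ z * (a j l z * d j l z) := by
  have hDm := D.isOpen.measurableSet
  have hfin : IsFiniteMeasure (volume.restrict (D : Set (Fin m → ℂ))) :=
    ⟨by rw [Measure.restrict_apply_univ]; exact hDbdd.measure_lt_top⟩
  set K := tsupport φ with hK
  have hKc : IsCompact K := φ.hasCompactSupport.isCompact
  obtain ⟨δ, hδ, hSD⟩ := hKc.exists_cthickening_subset_open D.isOpen φ.tsupport_subset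
  set S := Metric.cthickening δ K with hS
  have hSc : IsCompact S := hKc.cthickening
  have huS : ContinuousOn (fun y => (u y : ℂ)) S :=
    Complex.continuous_ofReal.comp_continuousOn (hu.mono hSD)
  have hui : LocallyIntegrable (S.indicator fun y => (u y : ℂ)) :=
    (integrable_indicator_ofReal hSc (hu.mono hSD)).locallyIntegrable
  set v : ℕ → (Fin m → ℂ) → ℂ := fun k => moll k (S.indicator fun y => (u y : ℂ)) with hv
  have hvs : ∀ k, ContDiff ℝ (⊤ : ℕ∞) (v k) := fun k => contDiff_moll ⊤ hui
  have hψ : ∀ j l, Integrable (fun z => wirt (-1) j (wirt 1 l φ) z * d j l z)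
      (volume.restrict D) := fun j l =>
    integrable_testFunction_mul (hdi j l) (testWirt (-1) j (testWirt 1 l φ))
  have hlimL : Tendsto (fun k => ∑ j, ∑ l, ∫ z in D, v k z * wirt (-1) j (wirt 1 l φ) z * d j l z)
      atTop (𝓝 (∑ j, ∑ l, ∫ z in D, (u z : ℂ) * wirt (-1) j (wirt 1 l φ) z * d j l z)) := by
    refine tendsto_finsetSum _ fun j _ => tendsto_finsetSum _ fun l _ => ?_
    simp only [mul_assoc]
    refine tendsto_integral_mul_of_eventually_dist_le (hψ j l) (fun k => ?_) ?_ fun ε hε => ?_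
    · have h := integrable_testFunction_mul (hdi j l)
        (testMul (v k) (hvs k) (testWirt (-1) j (testWirt 1 l φ)))
      refine h.congr (Eventually.of_forall fun z => ?_)
      simp only [coe_testMul, coe_testWirt, mul_assoc]
    · have hsub : tsupport (wirt (-1) j (wirt 1 l φ)) ⊆ D :=
        (testWirt (-1) j (testWirt 1 l φ)).tsupport_subset
      have hc : Continuous fun z => (u z : ℂ) * wirt (-1) j (wirt 1 l φ) z :=
        continuous_mul_of_tsupport_subset D.isOpen
          (Complex.continuous_ofReal.comp_continuousOn hu)
          (testWirt (-1) j (testWirt 1 l φ)).continuous hsub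
      have hcs : HasCompactSupport fun z => (u z : ℂ) * wirt (-1) j (wirt 1 l φ) z :=
        (testWirt (-1) j (testWirt 1 l φ)).hasCompactSupport.mul_left
      obtain ⟨C, hC⟩ := hcs.exists_bound_of_continuous hc
      have h := (hdi j l).bdd_mul hc.aestronglyMeasurable (Eventually.of_forall hC)
      exact h.congr (Eventually.of_forall fun z => by simp only [mul_assoc])
    · filter_upwards [eventually_dist_moll_le hδ hS hSc huS hε] with k hk z hz
      exact hk z (tsupport_wirt_subset (tsupport_wirt_subset
        (subset_closure (left_ne_zero_of_mul hz))))
  -- On the left the potentials converge uniformly on `supp φ`. Here their Levi coefficients, the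
  -- mollifications of `a j l`, converge weakly in `L^p` against `φ d`, which lies in `L^q`.
  have hlimR : Tendsto (fun k => ∑ j, ∑ l, ∫ z in D,
      φ z * wirt (-1) j (wirt 1 l (v k)) z * d j l z) atTop
      (𝓝 (∑ j, ∑ l, ∫ z in D, φ z * (a j l z * d j l z))) := by
    refine tendsto_finsetSum _ fun j _ => tendsto_finsetSum _ fun l _ => ?_
    have ha' : MemLp ((D : Set (Fin m → ℂ)).indicator (a j l)) p :=
      (memLp_indicator_iff_restrict hDm).2 (ha j l)
    obtain ⟨C, hC⟩ := φ.hasCompactSupport.exists_bound_of_continuous φ.continuous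
    have hφd : MemLp ((D : Set (Fin m → ℂ)).indicator fun z => φ z * d j l z) q := by
      refine (memLp_indicator_iff_restrict hDm).2 ?_
      refine ((hd j l).const_mul (C : ℂ)).of_le
        (φ.continuous.aestronglyMeasurable.mul (hd j l).1) (Eventually.of_forall fun z => ?_)
      rw [norm_mul, norm_mul, Complex.norm_real]
      gcongr
      exact (hC z).trans (le_abs_self C)
    have hw := tendsto_integral_moll_mul hp1 hp ha' hφd
    have hR : ∫ z, (D : Set (Fin m → ℂ)).indicator (a j l) z *
        (D : Set (Fin m → ℂ)).indicator (fun z => φ z * d j l z) z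
        = ∫ z in D, φ z * (a j l z * d j l z) := by
      rw [← integral_indicator hDm]
      refine integral_congr_ae (Eventually.of_forall fun z => ?_)
      by_cases hz : z ∈ (D : Set (Fin m → ℂ))
      · simp only [indicator_of_mem hz]; ring
      · simp only [indicator_of_notMem hz, mul_zero]
    rw [hR] at hw
    refine hw.congr' ?_
    filter_upwards [eventually_closedBall_subset_cthickening (K := K) hδ] with k hk
    rw [← integral_indicator hDm]
    refine integral_congr_ae (Eventually.of_forall fun z => ?_)
    simp only
    by_cases hz : z ∈ (D : Set (Fin m → ℂ))
    · simp only [indicator_of_mem hz]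
      by_cases hzK : z ∈ K
      · rw [hv, wirt_wirt_moll hddc hSD hui (hk z hzK)]
        ring
      · rw [image_eq_zero_of_notMem_tsupport hzK]
        ring
    · simp only [indicator_of_notMem hz, mul_zero]
  refine tendsto_nhds_unique hlimL (hlimR.congr fun k => ?_)
  exact (sum_integral_mul_wirt_wirt_comm hdi h1 h2 (hvs k) φ).symm

end ClosedCurrents

/-! ### Inductive construction of the Bedford–Taylor powers -/

section Powers

variable {m r : ℕ} {D : TopologicalSpace.Opens (Fin m → ℂ)} {p : ℝ≥0∞} {q : ℕ}
  {a : Fin m → Fin m → (Fin m → ℂ) → ℂ}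

/-- The current `T` is closed, has coefficients in `L^{p/q}`, and its wedge product with the
`r`-th power of the form with coefficients `a` is the `m`-th power of that form. -/
structure IsClosedPower (p : ℝ≥0∞) (q : ℕ) (a : Fin m → Fin m → (Fin m → ℂ) → ℂ)
    (T : Current D r) : Prop where
  mass_eq : T.mass = volume
  memLp : ∀ e, MemLp (T.dens e) (p / q) (volume.restrict D)
  -- At every point, unlike `Current.alternating`, so that sums of coefficients can be rearranged
  -- pointwise.
  perm : ∀ e (σ τ : Equiv.Perm (Fin r)) z, T.dens (fun i => ((e (σ i)).1, (e (τ i)).2)) z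
    = ((σ.sign : ℤ) : ℂ) * ((τ.sign : ℤ) : ℂ) * T.dens e z
  closed_left : ∀ (ψ : TestFunction D ℂ ⊤) (e : Fin r → Fin m × Fin m) i,
    ∑ j, ∫ z in D, wirt (-1) j ψ z * T.dens (Function.update e i (j, (e i).2)) z = 0
  closed_right : ∀ (ψ : TestFunction D ℂ ⊤) (e : Fin r → Fin m × Fin m) i,
    ∑ k, ∫ z in D, wirt 1 k ψ z * T.dens (Function.update e i ((e i).1, k)) z = 0
  -- At `r = 0` the left side is the single density of `T`; this invariant identifies it as a
  -- multiple of a determinant.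
  contract : ∀ z, ∑ e, T.dens e z * ∏ i, a (e i).1 (e i).2 z
    = ∑ e : Fin m → Fin m × Fin m, topCoeff e * ∏ i, a (e i).1 (e i).2 z

theorem integral_wirt_testFunction (s : ℂ) (j : Fin m) (ψ : TestFunction D ℂ ⊤) :
    ∫ z in D, wirt s j ψ z = 0 := by
  have h := integral_mul_wirt (s := s) (j := j) (g := fun _ => (1 : ℂ)) (D := D)
    contDiffOn_const (ψ.contDiff.of_le (WithTop.coe_le_coe.2 (le_top : (1 : ℕ∞) ≤ ⊤)))
    ψ.hasCompactSupport ψ.tsupport_subset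
  simpa [wirt] using h

theorem isClosedPower_one (hDbdd : Bornology.IsBounded (D : Set (Fin m → ℂ))) :
    IsClosedPower p 0 a (Current.one D) where
  mass_eq := rfl
  memLp e := by
    have hfin : IsFiniteMeasure (volume.restrict (D : Set (Fin m → ℂ))) :=
      ⟨by rw [Measure.restrict_apply_univ]; exact hDbdd.measure_lt_top⟩
    exact memLp_const _
  perm e σ τ z := topCoeff_perm e σ τ
  closed_left ψ e i := by
    simp only [Current.one, integral_mul_const, integral_wirt_testFunction, zero_mul,
      Finset.sum_const_zero]
  closed_right ψ e i := by
    simp only [Current.one, integral_mul_const, integral_wirt_testFunction, zero_mul,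
      Finset.sum_const_zero]
  contract z := rfl

/-- Symmetry in `j` and `j'`, paired with the antisymmetry of the coefficients of a current, is what
makes `dd^c (u S)` closed. -/
theorem wirt_wirt_wirt_swap_left (ψ : TestFunction D ℂ ⊤) (j j' k : Fin m) (z : Fin m → ℂ) :
    wirt (-1) j (wirt 1 k (wirt (-1) j' ψ)) z = wirt (-1) j' (wirt 1 k (wirt (-1) j ψ)) z := by
  have h2 : ∀ φ : TestFunction D ℂ ⊤, ∀ z, ContDiffAt ℝ 2 φ z := fun φ z =>
    (φ.contDiff.of_le (WithTop.coe_le_coe.2 (le_top : (2 : ℕ∞) ≤ ⊤))).contDiffAt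
  have e : wirt (-1) j (wirt (-1) j' ψ) = wirt (-1) j' (wirt (-1) j ψ) :=
    funext fun z => wirt_comm (h2 ψ z)
  have h := wirt_comm (s := -1) (j := j) (t := 1) (k := k) (h2 (testWirt (-1) j' ψ) z)
  have h' := wirt_comm (s := -1) (j := j') (t := 1) (k := k) (h2 (testWirt (-1) j ψ) z)
  rw [coe_testWirt] at h h'
  rw [h, h', e]

theorem wirt_wirt_wirt_swap_right (ψ : TestFunction D ℂ ⊤) (j k k' : Fin m) (z : Fin m → ℂ) :
    wirt (-1) j (wirt 1 k (wirt 1 k' ψ)) z = wirt (-1) j (wirt 1 k' (wirt 1 k ψ)) z := by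
  have e : wirt 1 k (wirt 1 k' ψ) = wirt 1 k' (wirt 1 k ψ) := funext fun z => wirt_comm
    (ψ.contDiff.of_le (WithTop.coe_le_coe.2 (le_top : (2 : ℕ∞) ≤ ⊤))).contDiffAt
  rw [e]

namespace IsClosedPower

theorem dens_cons_swap_left {S : Current D (r + 1)} (hS : IsClosedPower p q a S)
    (e : Fin r → Fin m × Fin m) (i : Fin r) (j j' k l : Fin m) (z : Fin m → ℂ) :
    S.dens (Fin.cons (j, k) (Function.update e i (j', l))) z
      = - S.dens (Fin.cons (j', k) (Function.update e i (j, l))) z := by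
  have h := hS.perm (Fin.cons (j', k) (Function.update e i (j, l))) (Equiv.swap 0 i.succ) 1 z
  rw [Equiv.Perm.sign_swap (Fin.succ_ne_zero i).symm] at h
  simp only [Units.val_neg, Units.val_one, Int.cast_neg, Int.cast_one, Equiv.Perm.sign_one,
    mul_one, neg_mul, one_mul] at h
  rw [← h]
  congr 1
  funext x
  rcases eq_or_ne x 0 with rfl | hx
  · simp
  · obtain ⟨y, rfl⟩ := Fin.exists_succ_eq.2 hx
    rcases eq_or_ne y i with rfl | hy
    · simp
    · rw [Equiv.swap_apply_of_ne_of_ne (Fin.succ_ne_zero y) (fun h => hy (Fin.succ_inj.1 h))]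
      simp [hy]

theorem dens_cons_swap_right {S : Current D (r + 1)} (hS : IsClosedPower p q a S)
    (e : Fin r → Fin m × Fin m) (i : Fin r) (j k k' l : Fin m) (z : Fin m → ℂ) :
    S.dens (Fin.cons (j, k) (Function.update e i (l, k'))) z
      = - S.dens (Fin.cons (j, k') (Function.update e i (l, k))) z := by
  have h := hS.perm (Fin.cons (j, k') (Function.update e i (l, k))) 1 (Equiv.swap 0 i.succ) z
  rw [Equiv.Perm.sign_swap (Fin.succ_ne_zero i).symm] at h
  simp only [Units.val_neg, Units.val_one, Int.cast_neg, Int.cast_one, Equiv.Perm.sign_one,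
    neg_mul, one_mul] at h
  rw [← h]
  congr 1
  funext x
  rcases eq_or_ne x 0 with rfl | hx
  · simp
  · obtain ⟨y, rfl⟩ := Fin.exists_succ_eq.2 hx
    rcases eq_or_ne y i with rfl | hy
    · simp
    · rw [Equiv.swap_apply_of_ne_of_ne (Fin.succ_ne_zero y) (fun h => hy (Fin.succ_inj.1 h))]
      simp [hy]

end IsClosedPower

/-- Hölder's inequality in the form `L^{p/q} · L^p ⊆ L^{p/(q+1)}`: each wedge factor costs one more
division. -/
theorem holderTriple_div_succ (hp : p ≠ 0) (q : ℕ) :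
    p.HolderTriple (p / q) (p / ((q + 1 : ℕ) : ℝ≥0∞)) where
  inv_add_inv_eq_inv := by
    rw [ENNReal.inv_div (Or.inl (ENNReal.natCast_ne_top _)) (Or.inr hp),
      ENNReal.inv_div (Or.inl (ENNReal.natCast_ne_top _)) (Or.inr hp), ← one_div,
      ENNReal.div_add_div_same, Nat.cast_succ, add_comm]

theorem holderTriple_one_sub_inv {t : ℝ≥0∞} (ht : 1 ≤ t) : t.HolderTriple (1 - t⁻¹)⁻¹ 1 where
  inv_add_inv_eq_inv := by
    rw [inv_inv, inv_one, add_tsub_cancel_of_le (ENNReal.inv_le_one.2 ht)]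

/-- In terms of reciprocals this is `q/p + 1/t ≤ (q+1)/t ≤ 1`. With `t = m` it says that the `q`-th
power can be paired with `L^m` as long as `q + 1 ≤ m`. -/
theorem one_sub_inv_inv_le_div {t : ℝ≥0∞} (ht0 : t ≠ 0) (hp : t ≤ p)
    (hq : ((q + 1 : ℕ) : ℝ≥0∞) ≤ t) : (1 - t⁻¹)⁻¹ ≤ p / q := by
  have hp0 : p ≠ 0 := fun h => ht0 (by simpa [h] using hp)
  rw [ENNReal.inv_le_iff_inv_le, ENNReal.inv_div (Or.inl (ENNReal.natCast_ne_top _)) (Or.inr hp0)]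
  refine ENNReal.le_sub_of_add_le_right (ENNReal.inv_ne_top.2 ht0) ?_
  calc (q : ℝ≥0∞) / p + t⁻¹ ≤ q / t + 1 / t := by
        rw [one_div]
        gcongr
    _ = ((q + 1 : ℕ) : ℝ≥0∞) / t := by rw [ENNReal.div_add_div_same, Nat.cast_succ]
    _ ≤ 1 := ENNReal.div_le_of_le_mul (by rwa [one_mul])

theorem memLp_sum_mul {S : Current D (r + 1)} (hS : IsClosedPower p q a S) (hp : p ≠ 0)
    (ha : ∀ j k, MemLp (a j k) p (volume.restrict D)) (e : Fin r → Fin m × Fin m) :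
    MemLp (fun z => ∑ j, ∑ k, a j k z * S.dens (Fin.cons (j, k) e) z)
      (p / ((q + 1 : ℕ) : ℝ≥0∞)) (volume.restrict D) := by
  have := holderTriple_div_succ hp q
  exact memLp_finsetSum _ fun j _ => memLp_finsetSum _ fun k _ => (hS.memLp _).mul (ha j k)

theorem dens_cons_perm {S : Current D (r + 1)} (hS : IsClosedPower p q a S) (x : Fin m × Fin m)
    (e : Fin r → Fin m × Fin m) (σ τ : Equiv.Perm (Fin r)) (z : Fin m → ℂ) :
    S.dens (Fin.cons x fun i => ((e (σ i)).1, (e (τ i)).2)) z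
      = ((σ.sign : ℤ) : ℂ) * ((τ.sign : ℤ) : ℂ) * S.dens (Fin.cons x e) z := by
  have h := hS.perm (Fin.cons x e) (Equiv.Perm.decomposeFin.symm (0, σ))
    (Equiv.Perm.decomposeFin.symm (0, τ)) z
  rw [Equiv.Perm.decomposeFin.symm_sign, Equiv.Perm.decomposeFin.symm_sign, if_pos rfl,
    one_mul, one_mul] at h
  rw [← h]
  congr 1
  funext i
  refine Fin.cases ?_ (fun i => ?_) i <;> simp

theorem integral_mul_sum_mul {X : Type*} [MeasurableSpace X] {μ : Measure X} {φ : X → ℂ}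
    {c : Fin m → Fin m → X → ℂ} (h : ∀ j k, Integrable (fun x => φ x * c j k x) μ) :
    ∫ x, φ x * ∑ j, ∑ k, c j k x ∂μ = ∑ j, ∑ k, ∫ x, φ x * c j k x ∂μ := by
  simp only [Finset.mul_sum]
  rw [integral_finsetSum _ fun j _ => integrable_finsetSum _ fun k _ => h j k]
  exact Finset.sum_congr rfl fun j _ => integral_finsetSum _ fun k _ => h j k

theorem exists_isDDcMul {u : (Fin m → ℂ) → ℝ} (hp : (m : ℝ≥0∞) < p)
    (hq : q + 1 ≤ m) (hDbdd : Bornology.IsBounded (D : Set (Fin m → ℂ)))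
    (hu : ContinuousOn u D) (ha : ∀ j k, MemLp (a j k) p (volume.restrict D))
    (hddc : HasDDc D u a) {S : Current D (r + 1)} (hS : IsClosedPower p q a S) :
    ∃ T : Current D r, IsDDcMul u S T ∧ IsClosedPower p (q + 1) a T := by
  have hfin : IsFiniteMeasure (volume.restrict (D : Set (Fin m → ℂ))) :=
    ⟨by rw [Measure.restrict_apply_univ]; exact hDbdd.measure_lt_top⟩
  have hp0 : p ≠ 0 := (bot_le.trans_lt hp).ne'
  have hm1 : (1 : ℝ≥0∞) ≤ m := by exact_mod_cast (by lia : 1 ≤ m)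
  have hm0 : (m : ℝ≥0∞) ≠ 0 := (zero_lt_one.trans_le hm1).ne'
  have hqm : ((q + 1 : ℕ) : ℝ≥0∞) ≤ m := by exact_mod_cast hq
  have hq0 : ((q + 1 : ℕ) : ℝ≥0∞) ≠ 0 := by exact_mod_cast q.succ_ne_zero
  have hpq1 : 1 ≤ p / ((q + 1 : ℕ) : ℝ≥0∞) := by
    rw [ENNReal.le_div_iff_mul_le (Or.inl hq0) (Or.inl (ENNReal.natCast_ne_top _)), one_mul]
    exact hqm.trans hp.le
  have hmul := memLp_sum_mul hS hp0 ha
  have htriple := holderTriple_one_sub_inv hm1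
  have hexp := one_sub_inv_inv_le_div hm0 hp.le hqm
  have hd : ∀ e, MemLp (S.dens e) (1 - (m : ℝ≥0∞)⁻¹)⁻¹ (volume.restrict D) :=
    fun e => (hS.memLp e).mono_exponent hexp
  have hdi : ∀ e, IntegrableOn (S.dens e) D := fun e => (hd e).integrable
    (ENNReal.one_le_inv.2 tsub_le_self)
  -- The exponent is lowered from `p` to `m`, on the bounded domain, because weak convergence needs
  -- a finite exponent and `p` may be `∞`.
  have ham : ∀ j k, MemLp (a j k) m (volume.restrict D) := fun j k =>
    (ha j k).mono_exponent hp.le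
  -- The wedge product of `dd^c u` with `S`, defined pointwise by contraction in the first slot.
  let T : Current D r :=
    { mass := volume
      dens := fun e z => ∑ j, ∑ k, a j k z * S.dens (Fin.cons (j, k) e) z
      integrableOn_compact := fun e K _ hK => IntegrableOn.mono_set ((hmul e).integrable hpq1) hK
      alternating := fun e σ τ => Eventually.of_forall fun z => by
        simp only [dens_cons_perm hS, Finset.mul_sum]
        exact Finset.sum_congr rfl fun j _ => Finset.sum_congr rfl fun k _ => by ring }
  have hT : IsDDcMul u S T := by
    intro φ e
    simp only [Current.pair, hS.mass_eq, dz_eq_wirt, dzbar_eq_wirt]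
    rw [sum_integral_mul_wirt_wirt_eq (d := fun j k => S.dens (Fin.cons (j, k) e)) hm1
      (ENNReal.natCast_ne_top m) hDbdd hu ham hddc (fun j k => hd _) (fun j k => hdi _)
      (fun ψ l => ?_) (fun ψ j => ?_) φ]
    · exact integral_mul_sum_mul fun j k => integrable_testFunction_mul
        (memLp_one_iff_integrable.1 ((hd _).mul (ham j k))) φ
    · have h := hS.closed_left ψ (Fin.cons (l, l) e) 0
      simpa only [Fin.update_cons_zero, Fin.cons_zero] using h
    · have h := hS.closed_right ψ (Fin.cons (j, j) e) 0
      simpa only [Fin.update_cons_zero, Fin.cons_zero] using h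
  refine ⟨T, hT, rfl, hmul, fun e σ τ z => ?_, fun ψ e i => ?_, fun ψ e i => ?_, fun z => ?_⟩
  · simp only [T, dens_cons_perm hS, Finset.mul_sum]
    exact Finset.sum_congr rfl fun j _ => Finset.sum_congr rfl fun k _ => by ring
  · have h := fun j' => hT (testWirt (-1) j' ψ) (Function.update e i (j', (e i).2))
    simp only [Current.pair, hS.mass_eq, dz_eq_wirt, dzbar_eq_wirt, coe_testWirt] at h
    -- Swapping `j` and `j'` preserves the third derivative of `ψ` and changes the sign of the
    -- coefficient, so the sum equals its negative.
    refine (Finset.sum_congr rfl fun j' _ => h j').trans (self_eq_neg.1 ?_)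
    conv_lhs => rw [Finset.sum_comm]
    simp only [← Finset.sum_neg_distrib, ← integral_neg]
    refine Finset.sum_congr rfl fun j _ => Finset.sum_congr rfl fun j' _ =>
      Finset.sum_congr rfl fun k _ => integral_congr_ae (Eventually.of_forall fun z => ?_)
    simp only
    rw [hS.dens_cons_swap_left, wirt_wirt_wirt_swap_left]
    ring
  · have h := fun k' => hT (testWirt 1 k' ψ) (Function.update e i ((e i).1, k'))
    simp only [Current.pair, hS.mass_eq, dz_eq_wirt, dzbar_eq_wirt, coe_testWirt] at h
    refine (Finset.sum_congr rfl fun k' _ => h k').trans ?_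
    rw [Finset.sum_comm]
    refine Finset.sum_eq_zero fun j _ => self_eq_neg.1 ?_
    conv_lhs => rw [Finset.sum_comm]
    simp only [← Finset.sum_neg_distrib, ← integral_neg]
    refine Finset.sum_congr rfl fun k _ => Finset.sum_congr rfl fun k' _ =>
      integral_congr_ae (Eventually.of_forall fun z => ?_)
    simp only
    rw [hS.dens_cons_swap_right, wirt_wirt_wirt_swap_right]
    ring
  · rw [← hS.contract z, ← (Fin.consEquiv fun _ : Fin (r + 1) => Fin m × Fin m).sum_comp,
      Fintype.sum_prod_type_right]
    refine Finset.sum_congr rfl fun e _ => ?_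
    rw [Fintype.sum_prod_type, Finset.sum_mul]
    refine Finset.sum_congr rfl fun j _ => ?_
    rw [Finset.sum_mul]
    refine Finset.sum_congr rfl fun k _ => ?_
    simp only [Fin.consEquiv, Equiv.coe_fn_mk, Fin.prod_univ_succ, Fin.cons_zero, Fin.cons_succ]
    ring

theorem exists_isDDcPower {u : (Fin m → ℂ) → ℝ} (hp : (m : ℝ≥0∞) < p)
    (hDbdd : Bornology.IsBounded (D : Set (Fin m → ℂ)))
    (hu : ContinuousOn u D) (ha : ∀ j k, MemLp (a j k) p (volume.restrict D))
    (hddc : HasDDc D u a) :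
    ∀ q r : ℕ, r + q = m → ∃ T : Current D r, IsDDcPower u T ∧ IsClosedPower p q a T := by
  intro q
  induction q with
  | zero =>
    rintro r rfl
    exact ⟨Current.one D, .zero, isClosedPower_one hDbdd⟩
  | succ q ih =>
    intro r h
    obtain ⟨S, hS, hSq⟩ := ih (r + 1) (by lia)
    obtain ⟨T, hT, hTq⟩ := exists_isDDcMul hp (by lia) hDbdd hu ha hddc hSq
    exact ⟨T, .succ hS hT, hTq⟩

end Powers

/-! ### The Monge–Ampère density and part (b) -/

section MongeAmpere

variable {m n : ℕ} {D : TopologicalSpace.Opens (Fin m → ℂ)}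
  {Ω : TopologicalSpace.Opens (Fin n → ℂ)} {F : (Fin m → ℂ) → (Fin n → ℂ)}
  {p : ℝ≥0∞} {a : Fin m → Fin m → (Fin m → ℂ) → ℂ}

/-- A form whose `dd^c`-potential is positive as a distribution is positive semidefinite almost
everywhere. -/
theorem ae_forall_levi_nonneg {u : (Fin m → ℂ) → ℝ} (ha : ∀ j k, IntegrableOn (a j k) D)
    (hddc : HasDDc D u a)
    (hpos : ∀ φ : TestFunction D ℂ ⊤, (∀ z, 0 ≤ φ z) → ∀ ξ : Fin m → ℂ,
      0 ≤ ∑ i, ∑ j, ξ i * (starRingEnd ℂ) (ξ j)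
        * ∫ z in D, (u z : ℂ) * wirt (-1) i (wirt 1 j φ) z) :
    ∀ᵐ z ∂volume.restrict (D : Set (Fin m → ℂ)), ∀ ξ : Fin m → ℂ,
      0 ≤ ∑ i, ∑ j, ξ i * (starRingEnd ℂ) (ξ j) * a i j z := by
  have hξ : ∀ ξ : Fin m → ℂ, ∀ᵐ z ∂volume.restrict (D : Set (Fin m → ℂ)),
      0 ≤ ∑ i, ∑ j, ξ i * (starRingEnd ℂ) (ξ j) * a i j z := by
    intro ξ
    refine ae_nonneg_of_forall_testFunction (integrable_finsetSum _ fun i _ =>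
      integrable_finsetSum _ fun j _ => (ha i j).const_mul _) fun φ hφ => ?_
    refine (hpos φ hφ ξ).trans_eq ?_
    have hint : ∀ i j, Integrable
        (fun z => φ z * (ξ i * (starRingEnd ℂ) (ξ j) * a i j z)) (volume.restrict D) :=
      fun i j => integrable_testFunction_mul ((ha i j).const_mul _) φ
    simp only [mul_comm _ (φ _)]
    rw [integral_mul_sum_mul hint]
    refine Finset.sum_congr rfl fun i _ => Finset.sum_congr rfl fun j _ => ?_
    have h := (hddc i j).2 φ
    rw [dz_eq_wirt, dzbar_eq_wirt] at h
    rw [h, ← integral_const_mul]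
    exact integral_congr_ae (Eventually.of_forall fun z => by simp only; ring)
  -- The exceptional null set depends on `ξ`; a countable dense set of `ξ` and continuity remove
  -- this dependence.
  filter_upwards [ae_all_iff.2 fun k => hξ (TopologicalSpace.denseSeq (Fin m → ℂ) k)] with z hz ξ
  have hcl : IsClosed {ξ : Fin m → ℂ | 0 ≤ ∑ i, ∑ j, ξ i * (starRingEnd ℂ) (ξ j) * a i j z} :=
    isClosed_le continuous_const (by fun_prop)
  refine hcl.closure_subset_iff.2 (range_subset_iff.2 hz) ?_
  rw [(TopologicalSpace.denseRange_denseSeq (Fin m → ℂ)).closure_range]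
  trivial

/-- The Bedford–Taylor Monge–Ampère measure of a function whose `dd^c` is positive with
coefficients in `L^p`. -/
theorem exists_mongeAmpereEq {u : (Fin m → ℂ) → ℝ} (hm : 0 < m) (hp : (m : ℝ≥0∞) < p)
    (hDbdd : Bornology.IsBounded (D : Set (Fin m → ℂ)))
    (hu : ContinuousOn u D) (ha : ∀ j k, MemLp (a j k) p (volume.restrict D))
    (hddc : HasDDc D u a)
    (hpos : ∀ φ : TestFunction D ℂ ⊤, (∀ z, 0 ≤ φ z) → ∀ ξ : Fin m → ℂ,
      0 ≤ ∑ i, ∑ j, ξ i * (starRingEnd ℂ) (ξ j)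
        * ∫ z in D, (u z : ℂ) * wirt (-1) i (wirt 1 j φ) z) :
    ∃ f : (Fin m → ℂ) → ℝ, MongeAmpereEq D u f ∧
      (∀ᵐ z ∂(volume.restrict (D : Set (Fin m → ℂ))), 0 ≤ f z) ∧
      MemLp f (p / (m : ℝ≥0∞)) (volume.restrict (D : Set (Fin m → ℂ))) := by
  have hfin : IsFiniteMeasure (volume.restrict (D : Set (Fin m → ℂ))) :=
    ⟨by rw [Measure.restrict_apply_univ]; exact hDbdd.measure_lt_top⟩
  have hm1 : (1 : ℝ≥0∞) ≤ m := by exact_mod_cast hm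
  have hpm : 1 ≤ p / m := by
    rw [ENNReal.le_div_iff_mul_le (Or.inl (zero_lt_one.trans_le hm1).ne')
      (Or.inl (ENNReal.natCast_ne_top _)), one_mul]
    exact hp.le
  obtain ⟨T, hT, hTm⟩ := exists_isDDcPower hp hDbdd hu ha hddc m 0 (zero_add m)
  have hnn : ∀ᵐ z ∂volume.restrict (D : Set (Fin m → ℂ)), 0 ≤ T.dens Fin.elim0 z := by
    filter_upwards [ae_forall_levi_nonneg
      (fun j k => (ha j k).integrable (hm1.trans hp.le)) hddc hpos] with z hz
    -- For `r = 0` there is only one multi-index, so the density is the sum that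
    -- `sum_topCoeff_mul_prod` evaluates.
    have h := hTm.contract z
    rw [Fintype.sum_unique, Finset.univ_eq_empty, Finset.prod_empty, mul_one,
      Subsingleton.elim default Fin.elim0] at h
    rw [h]
    exact sum_topCoeff_mul_prod_nonneg (fun j k => a j k z) hz
  have hL : MemLp (fun z => (T.dens Fin.elim0 z).re) (p / m) (volume.restrict D) :=
    (hTm.memLp Fin.elim0).re
  refine ⟨fun z => (T.dens Fin.elim0 z).re,
    ⟨IntegrableOn.locallyIntegrableOn (hL.integrable hpm), T, hT, fun φ => ?_⟩, ?_, hL⟩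
  · rw [Current.pair, hTm.mass_eq]
    refine integral_congr_ae ?_
    filter_upwards [hnn] with z hz
    rw [← Complex.eq_re_of_ofReal_le (r := 0) (by simpa using hz)]
  · filter_upwards [hnn] with z hz using (Complex.le_def.1 hz).1

/-- The bound on `b'` at every point of `Ω` is essential: a bound almost everywhere would give
nothing after composition with `F`. -/
theorem memLp_sum_comp_mul {b b' : Fin n → Fin n → (Fin n → ℂ) → ℂ}
    {c : Fin n → Fin n → (Fin m → ℂ) → ℂ}
    (hb : ∀ μ ν, MemLp (b μ ν) ∞ (volume.restrict (Ω : Set (Fin n → ℂ))))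
    (hb' : ∀ μ ν, IsPreciseRepr Ω (b μ ν) (b' μ ν)) (hmaps : MapsTo F D Ω)
    (hF : ContinuousOn F D) (hc : ∀ μ ν, MemLp (c μ ν) p (volume.restrict D)) :
    MemLp (fun z => ∑ μ, ∑ ν, b' μ ν (F z) * c μ ν z) p (volume.restrict D) := by
  have hDm := D.isOpen.measurableSet
  refine memLp_finsetSum _ fun μ _ => memLp_finsetSum _ fun ν _ => ?_
  have hmeas : AEStronglyMeasurable (fun z => b' μ ν (F z)) (volume.restrict D) :=
    ((hb' μ ν).1.comp_aemeasurable (hF.aemeasurable hDm)).aestronglyMeasurable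
  refine (hc μ ν).mul (p := ∞) (memLp_top_of_bound hmeas
    (eLpNorm (b μ ν) ∞ (volume.restrict Ω)).toReal ((ae_restrict_iff' hDm).2
      (Eventually.of_forall fun z hz => ?_)))
  rw [← toReal_enorm]
  exact ENNReal.toReal_mono (hb μ ν).2.ne ((hb' μ ν).2.2.1 _ (hmaps hz))

end MongeAmpere

end

end SCV

/-! ### The main theorem -/

theorem propositionP {m n : ℕ} (hm : 0 < m) (hmn : m < n)
    (D : TopologicalSpace.Opens (Fin m → ℂ)) (Ω : TopologicalSpace.Opens (Fin n → ℂ))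
    (hDconn : IsConnected (D : Set (Fin m → ℂ)))
    (hDbdd : Bornology.IsBounded (D : Set (Fin m → ℂ)))
    (hΩconn : IsConnected (Ω : Set (Fin n → ℂ)))
    (hΩbdd : Bornology.IsBounded (Ω : Set (Fin n → ℂ)))
    (F : (Fin m → ℂ) → (Fin n → ℂ))
    (hmaps : Set.MapsTo F (D : Set (Fin m → ℂ)) (Ω : Set (Fin n → ℂ)))
    (hhol : DifferentiableOn ℂ F (D : Set (Fin m → ℂ)))
    (hproper : IsProperMap hmaps.restrict)
    (ρ : (Fin n → ℂ) → ℝ)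
    (hρcont : ContinuousOn ρ (Ω : Set (Fin n → ℂ)))
    (hρpsh : SCV.Plurisubharmonic Ω ρ)
    (b : Fin n → Fin n → (Fin n → ℂ) → ℂ)
    (hb : ∀ μ ν, MemLp (b μ ν) ∞ (volume.restrict (Ω : Set (Fin n → ℂ))))
    (hddc : SCV.HasDDc Ω ρ b) :
    (∃ b' : Fin n → Fin n → (Fin n → ℂ) → ℂ,
      (∀ μ ν, SCV.IsPreciseRepr Ω (b μ ν) (b' μ ν)) ∧
      SCV.HasDDc D (fun z => ρ (F z)) (fun j k z =>
        ∑ μ, ∑ ν, b' μ ν (F z) *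
          (SCV.partialDeriv F μ j z * (starRingEnd ℂ) (SCV.partialDeriv F ν k z)))) ∧
    (∀ p : ℝ≥0∞, (m : ℝ≥0∞) < p →
      (∀ (j k : Fin m) (μ ν : Fin n),
        MemLp (fun z => SCV.partialDeriv F μ j z * (starRingEnd ℂ) (SCV.partialDeriv F ν k z)) p
          (volume.restrict (D : Set (Fin m → ℂ)))) →
      ∃ f : (Fin m → ℂ) → ℝ,
        SCV.MongeAmpereEq D (fun z => ρ (F z)) f ∧
        (∀ᵐ z ∂(volume.restrict (D : Set (Fin m → ℂ))), 0 ≤ f z) ∧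
        MemLp f (p / (m : ℝ≥0∞)) (volume.restrict (D : Set (Fin m → ℂ)))) := by
  obtain ⟨b', hb', hdd⟩ :=
    SCV.exists_preciseRepr_hasDDc_comp hDbdd hmaps hhol hρcont hb hddc
  refine ⟨⟨b', hb', hdd⟩, fun p hp hL => ?_⟩
  exact SCV.exists_mongeAmpereEq hm hp hDbdd (hρcont.comp hhol.continuousOn hmaps)
    (fun j k => SCV.memLp_sum_comp_mul hb hb' hmaps hhol.continuousOn (hL j k)) hdd
    fun φ hφ ξ => SCV.integral_levi_comp_nonneg hmaps hhol hρcont hρpsh hddc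
      (fun μ ν => SCV.locallyIntegrable_indicator (hb μ ν)) φ hφ ξ
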